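/- Let $\Gamma<\mathrm{PSL}_2(\mathbb C)$ be a quasi-Fuchsian group, i.e. a discrete subgroup acting freely on $\mathbb H^3$ whose limit set $\Lambda_\Gamma\subset\partial_\infty\mathbb H^3$ is a quasi-circle, and let $M=\mathbb H^3/\Gamma$. Assume that $M$ is homeomorphic to $\Sigma\times\mathbb R$ for a closed connected surface $\Sigma$, and fix such a homeomorphism. Let $\Omega^+,\Omega^-$ be the two connected components of $\partial_\infty\mathbb H^3\setminus\Lambda_\Gamma$ (in either order). For a closed embedded surface $S\subset M$ homotopic to $\Sigma\times\{*\}$, the preimage $\widetilde S\subset\mathbb H^3$ disconnects $\mathbb H^3$ into two components, one whose closure in $\mathbb H^3\cup\partial_\infty\mathbb H^3$ contains $\Omega^+$ and one whose closure contains $\Omega^-$; the unit normal of $S$ is the one lifting to the unit normal of $\widetilde S$ that points towards the component whose closure contains $\Omega^+$, and the mean curvature of $S$ is one half of the trace of the second fundamental form with respect to the first fundamental form, computed with this unit normal. Let $H\in(-1,1)$, and let $S_H$ and $S_H'$ be closed embedded $C^2$ surfaces in $M$, each of them the image of an embedding $\Sigma\to M$ homotopic to $\Sigma\times\{*\}$,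 both of mean curvature identically equal to $H$. If the principal curvatures of $S_H$ lie in $(-1,1)$ at every point, then $S_H=S_H'$. -/

import Mathlib

noncomputable section

namespace QF

open Topology Filter
open scoped Matrix ComplexOrder

/-- Four-dimensional space with coordinates `x₀, x₁, x₂, x₃`, carrying the Minkowski form below. -/
abbrev Mink : Type := EuclideanSpace ℝ (Fin 4)

/-- The Minkowski form of signature `(-,+,+,+)`. -/
def mink (x y : Mink) : ℝ := -(x 0 * y 0) + x 1 * y 1 + x 2 * y 2 + x 3 * y 3

/-- Hyperbolic three-space: the upper sheet of the hyperboloid `⟨x, x⟩ = -1`; its Riemannian metric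
is the restriction of the Minkowski form to tangent spaces. -/
abbrev H3 : Type := {x : Mink // mink x x = -1 ∧ 0 < x 0}

/-- The identification of Minkowski space with Hermitian `2 × 2` matrices, for which
`det = -⟨x, x⟩`. -/
def toHerm (x : Mink) : Matrix (Fin 2) (Fin 2) ℂ :=
  !![(x 0 : ℂ) + x 3, (x 1 : ℂ) - x 2 * Complex.I; (x 1 : ℂ) + x 2 * Complex.I, (x 0 : ℂ) - x 3]

/-- The inverse identification. -/
def ofHerm (A : Matrix (Fin 2) (Fin 2) ℂ) : Mink :=
  !₂[((A 0 0).re + (A 1 1).re) / 2, (A 1 0).re, (A 1 0).im, ((A 0 0).re - (A 1 1).re) / 2]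

theorem ofHerm_toHerm (x : Mink) : ofHerm (toHerm x) = x := by
  ext i
  fin_cases i <;> simp [ofHerm, toHerm]

theorem toHerm_ofHerm {A : Matrix (Fin 2) (Fin 2) ℂ} (hA : A.IsHermitian) :
    toHerm (ofHerm A) = A := by
  have h0 := congrArg Complex.im (hA.apply 0 0)
  have h1 := congrArg Complex.im (hA.apply 1 1)
  have h2 := hA.apply 0 1
  have h2r := congrArg Complex.re h2
  have h2i := congrArg Complex.im h2
  simp at h0 h1 h2r h2i
  ext i j
  fin_cases i <;> fin_cases j <;> apply Complex.ext <;> simp [ofHerm, toHerm] <;> linarith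

theorem toHerm_isHermitian (x : Mink) : (toHerm x).IsHermitian := by
  ext i j
  fin_cases i <;> fin_cases j <;> apply Complex.ext <;> simp [toHerm]

theorem det_toHerm (x : Mink) : (toHerm x).det = ((-mink x x : ℝ) : ℂ) := by
  apply Complex.ext <;> simp [toHerm, mink, Matrix.det_fin_two] <;> ring

theorem trace_toHerm (x : Mink) : (toHerm x).trace = ((2 * x 0 : ℝ) : ℂ) := by
  simp [toHerm, Matrix.trace, Fin.sum_univ_two]; ring

theorem posDef_toHerm (x : H3) : (toHerm x.1).PosDef := by
  obtain ⟨x, hx, h0⟩ := x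
  have hm : x 0 * x 0 = 1 + x 1 * x 1 + x 2 * x 2 + x 3 * x 3 := by
    simp only [mink] at hx; linarith
  have hp : 0 < x 0 + x 3 := by nlinarith [mul_self_nonneg (x 1), mul_self_nonneg (x 2)]
  refine Matrix.PosDef.of_dotProduct_mulVec_pos (toHerm_isHermitian x) ?_
  intro v hv
  obtain ⟨a, ha⟩ : ∃ a, a = v 0 := ⟨_, rfl⟩
  obtain ⟨b, hb⟩ : ∃ b, b = v 1 := ⟨_, rfl⟩
  have hab : ¬(a = 0 ∧ b = 0) := by
    rintro ⟨h1, h2⟩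
    apply hv
    ext i
    fin_cases i
    · simpa [ha] using h1
    · simpa [hb] using h2
  have key : (0 : ℝ) < (x 0 + x 3) * (a.re ^ 2 + a.im ^ 2) + (x 0 - x 3) * (b.re ^ 2 + b.im ^ 2)
      + 2 * (x 1 * (a.re * b.re + a.im * b.im) + x 2 * (a.re * b.im - a.im * b.re)) := by
    refine pos_of_mul_pos_right (a := x 0 + x 3) ?_ hp.le
    have e : (x 0 + x 3) * ((x 0 + x 3) * (a.re ^ 2 + a.im ^ 2)
        + (x 0 - x 3) * (b.re ^ 2 + b.im ^ 2)
        + 2 * (x 1 * (a.re * b.re + a.im * b.im) + x 2 * (a.re * b.im - a.im * b.re)))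
        = ((x 0 + x 3) * a.re + x 1 * b.re + x 2 * b.im) ^ 2
          + ((x 0 + x 3) * a.im + x 1 * b.im - x 2 * b.re) ^ 2 + (b.re ^ 2 + b.im ^ 2) := by
      linear_combination (b.re ^ 2 + b.im ^ 2) * hm
    rw [e]
    by_cases hb0 : b = 0
    · have ha0 : a ≠ 0 := fun h => hab ⟨h, hb0⟩
      have : 0 < a.re ^ 2 + a.im ^ 2 := by
        have := Complex.normSq_pos.2 ha0
        rw [Complex.normSq_apply] at this
        linarith [sq a.re, sq a.im]
      simp only [hb0, Complex.zero_re, Complex.zero_im]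
      have h2 := mul_pos (mul_pos hp hp) this
      nlinarith
    · have := Complex.normSq_pos.2 hb0
      rw [Complex.normSq_apply] at this
      nlinarith [sq_nonneg ((x 0 + x 3) * a.re + x 1 * b.re + x 2 * b.im),
        sq_nonneg ((x 0 + x 3) * a.im + x 1 * b.im - x 2 * b.re)]
  rw [Complex.lt_def]
  simp only [toHerm, dotProduct, Matrix.mulVec, Fin.sum_univ_two]
  constructor
  · simp [← ha, ← hb]; nlinarith
  · simp [← ha, ← hb]; ring

theorem ofHerm_mem {A : Matrix (Fin 2) (Fin 2) ℂ} (hA : A.PosDef) (hd : A.det = 1) :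
    mink (ofHerm A) (ofHerm A) = -1 ∧ 0 < ofHerm A 0 := by
  have e := toHerm_ofHerm hA.1
  constructor
  · have h := det_toHerm (ofHerm A)
    rw [e, hd] at h
    have h' := congrArg Complex.re h
    rw [Complex.ofReal_re, Complex.one_re] at h'
    linarith
  · have h := hA.trace_pos
    rw [← e, trace_toHerm] at h
    have h' : (0 : ℝ) < 2 * ofHerm A 0 := by exact_mod_cast h
    linarith

/-- The group `SL(2, ℂ)`. -/
abbrev SL2C : Type := Matrix.SpecialLinearGroup (Fin 2) ℂ

/-- The group `PSL(2, ℂ)` with the quotient topology. -/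
abbrev PSL2C : Type := Matrix.ProjectiveSpecialLinearGroup (Fin 2) ℂ

theorem conj_posDef (g : SL2C) {A : Matrix (Fin 2) (Fin 2) ℂ} (hA : A.PosDef) :
    ((g : Matrix (Fin 2) (Fin 2) ℂ) * A * (g : Matrix (Fin 2) (Fin 2) ℂ)ᴴ).PosDef := by
  apply hA.mul_mul_conjTranspose_same
  apply Matrix.vecMul_injective_of_isUnit
  rw [Matrix.isUnit_iff_isUnit_det]
  simp

theorem conj_det (g : SL2C) (x : H3) :
    ((g : Matrix (Fin 2) (Fin 2) ℂ) * toHerm x.1 * (g : Matrix (Fin 2) (Fin 2) ℂ)ᴴ).det = 1 := by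
  simp [Matrix.det_mul, Matrix.det_conjTranspose, det_toHerm, x.2.1]

/-- `SL(2, ℂ)` acts on hyperbolic space by `g • A = g A gᴴ` on Hermitian matrices. -/
instance : MulAction SL2C H3 where
  smul g x := ⟨ofHerm ((g : Matrix (Fin 2) (Fin 2) ℂ) * toHerm x.1 *
    (g : Matrix (Fin 2) (Fin 2) ℂ)ᴴ), ofHerm_mem (conj_posDef g (posDef_toHerm x)) (conj_det g x)⟩
  one_smul x := by
    apply Subtype.ext
    change ofHerm _ = _
    simp [ofHerm_toHerm]
  mul_smul g h x := by
    apply Subtype.ext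
    change ofHerm _ = ofHerm (_ * toHerm (ofHerm _) * _)
    rw [toHerm_ofHerm (conj_posDef h (posDef_toHerm x)).1]
    simp [Matrix.mul_assoc]

theorem coe_smul_SL2C (g : SL2C) (x : H3) :
    ((g • x : H3) : Mink) = ofHerm ((g : Matrix (Fin 2) (Fin 2) ℂ) * toHerm x.1 *
      (g : Matrix (Fin 2) (Fin 2) ℂ)ᴴ) := rfl

theorem center_le_ker :
    Subgroup.center SL2C ≤ (MulAction.toPermHom SL2C H3).ker := by
  intro g hg
  obtain ⟨r, hr, hrg⟩ := Matrix.SpecialLinearGroup.mem_center_iff.1 hg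
  rw [MonoidHom.mem_ker]
  ext1 x
  apply Subtype.ext
  change ((g • x : H3) : Mink) = x.1
  have hn : r * star r = 1 := by
    have h1 : ‖r‖ = 1 := by
      have := congrArg norm hr
      rw [norm_pow, norm_one] at this
      exact (pow_eq_one_iff_of_nonneg (norm_nonneg _) (by simp)).1 this
    have := Complex.mul_conj r
    rw [Complex.normSq_eq_norm_sq, h1] at this
    simpa using this
  have e : (g : Matrix (Fin 2) (Fin 2) ℂ) * toHerm x.1 * (g : Matrix (Fin 2) (Fin 2) ℂ)ᴴ
      = toHerm x.1 := by
    rw [← hrg]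
    ext i j
    simp only [Matrix.scalar_apply, Matrix.diagonal_mul, Matrix.diagonal_conjTranspose,
      Matrix.mul_diagonal, Pi.star_apply]
    linear_combination (toHerm x.1 i j) * hn
  rw [coe_smul_SL2C, e, ofHerm_toHerm]

/-- The induced action of `PSL(2, ℂ)`, which is the group of orientation preserving isometries of
hyperbolic space. -/
instance : MulAction PSL2C H3 :=
  MulAction.compHom H3 (QuotientGroup.lift (Subgroup.center SL2C) (MulAction.toPermHom SL2C H3)
    center_le_ker)

theorem coe_smul_PSL2C (g : SL2C) (x : H3) : ((g : PSL2C) • x : H3) = g • x := rfl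

/-- The quotient `ℍ³/Γ`, with the quotient topology. -/
abbrev Quot3 (Γ : Subgroup PSL2C) : Type := MulAction.orbitRel.Quotient Γ H3

/-- The quotient map `ℍ³ → ℍ³/Γ`. -/
def proj (Γ : Subgroup PSL2C) (x : H3) : Quot3 Γ := Quotient.mk _ x

/-- Euclidean three-space, containing the closed unit ball `ℍ³ ∪ ∂ℍ³` of the projective model. -/
abbrev E3 : Type := EuclideanSpace ℝ (Fin 3)

/-- The projective (Klein) model: hyperbolic space as the open unit ball. -/
def klein (x : H3) : E3 := !₂[x.1 1 / x.1 0, x.1 2 / x.1 0, x.1 3 / x.1 0]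

/-- The boundary at infinity of hyperbolic space, the unit sphere, with the chordal metric. -/
abbrev Bdry : Type := Metric.sphere (0 : E3) 1

/-- The limit set: the accumulation points at infinity of the orbits in hyperbolic space. -/
def limitSet (Γ : Subgroup PSL2C) : Set Bdry :=
  {p | ∃ x : H3, AccPt (p : E3) (𝓟 (klein '' MulAction.orbit Γ x))}

/-- Quasiconformality (metric definition): the linear dilatation
`limsup_{r → 0} (sup_{d(x,y) ≤ r} d(φ x, φ y)) / (inf_{d(x,z) ≥ r} d(φ x, φ z))` is bounded. -/
def IsQuasiconformal (φ : Bdry ≃ₜ Bdry) : Prop :=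
  ∃ K : ℝ, ∀ x : Bdry, ∀ᶠ r in 𝓝[>] (0 : ℝ), ∀ y z : Bdry, dist x y ≤ r → r ≤ dist x z →
    dist (φ x) (φ y) ≤ K * dist (φ x) (φ z)

/-- A quasi-circle: the image of a round circle under a quasiconformal homeomorphism. -/
def IsQuasiCircle (Λ : Set Bdry) : Prop :=
  ∃ φ : Bdry ≃ₜ Bdry, IsQuasiconformal φ ∧ Λ = φ '' {p | (p : E3) 2 = 0}

/-- Quasi-Fuchsian groups: discrete subgroups of `PSL(2, ℂ)` acting freely on hyperbolic space whose
limit set is a quasi-circle. -/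
structure IsQuasiFuchsian (Γ : Subgroup PSL2C) : Prop where
  discrete : DiscreteTopology Γ
  free : ∀ γ ∈ Γ, γ ≠ 1 → ∀ x : H3, γ • x ≠ x
  quasiCircle : IsQuasiCircle (limitSet Γ)

/-- `C` is a connected component of the set `A`. -/
def IsComponent {X : Type*} [TopologicalSpace X] (A C : Set X) : Prop :=
  ∃ x ∈ A, C = connectedComponentIn A x

/-- `Ωp` and `Ωm` are the two connected components of the domain of discontinuity on the sphere at
infinity (labelled in this order). -/
structure AreDomains (Γ : Subgroup PSL2C) (Ωp Ωm : Set Bdry) : Prop where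
  pos : IsComponent (limitSet Γ)ᶜ Ωp
  neg : IsComponent (limitSet Γ)ᶜ Ωm
  ne : Ωp ≠ Ωm

/-- The closure in the closed unit ball of the subset `C` of hyperbolic space contains the subset
`Ω` of the boundary at infinity. -/
def ClosureContains (C : Set H3) (Ω : Set Bdry) : Prop :=
  (fun p : Bdry => (p : E3)) '' Ω ⊆ closure (klein '' C)

/-- The parameter plane. -/
abbrev Plane : Type := EuclideanSpace ℝ (Fin 2)

/-- `f`, restricted to the open set `U`, is a regular `C²` parametrization of a relatively open part
of the subset `T` of hyperbolic space. -/
structure IsLocalParam (T : Set H3) (U : Set Plane) (f : Plane → Mink) : Prop where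
  isOpen : IsOpen U
  contDiffOn : ContDiffOn ℝ 2 f U
  immersion : ∀ u ∈ U, Function.Injective (fderiv ℝ f u)
  isEmbedding : IsEmbedding (U.domRestrict f)
  image : ∃ V : Set Mink, IsOpen V ∧ f '' U = (fun x : H3 => (x : Mink)) '' T ∩ V

/-- `T` is an embedded surface of class `C²` in hyperbolic space. -/
def IsSurface (T : Set H3) : Prop :=
  ∀ x ∈ T, ∃ U f, IsLocalParam T U f ∧ (x : Mink) ∈ f '' U

/-- `N` is a unit normal vector of the surface `T` at `x`: it is tangent to hyperbolic space, of
length one, and orthogonal to the tangent plane of `T`. -/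
structure IsUnitNormal (T : Set H3) (x : H3) (N : Mink) : Prop where
  tangent : mink x N = 0
  unit : mink N N = 1
  normal : ∀ U f, IsLocalParam T U f → ∀ u ∈ U, f u = x → ∀ v, mink (fderiv ℝ f u v) N = 0

/-- The unit speed geodesic starting at `x` with unit velocity `N`. -/
def geo (x : H3) (N : Mink) (t : ℝ) : Mink := Real.cosh t • (x : Mink) + Real.sinh t • N

/-- `N` is the unit normal of `T` at `x` pointing towards the component of the complement of `T`
whose closure contains `Ωp`, the component on the other side of `T` being the one whose closure
contains `Ωm`. -/
def IsUnitNormalTowards (T : Set H3) (Ωp Ωm : Set Bdry) (x : H3) (N : Mink) : Prop :=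
  IsUnitNormal T x N ∧
  ∃ Cp Cm : Set H3, IsComponent Tᶜ Cp ∧ IsComponent Tᶜ Cm ∧ Cp ≠ Cm ∧
    ClosureContains Cp Ωp ∧ ClosureContains Cm Ωm ∧
    ∀ᶠ t in 𝓝[>] (0 : ℝ), (∃ y ∈ Cp, geo x N t = y) ∧ ∃ y ∈ Cm, geo x N (-t) = y

/-- The first fundamental form of a parametrization `f` at `u`. -/
def firstForm (f : Plane → Mink) (u : Plane) : Matrix (Fin 2) (Fin 2) ℝ :=
  Matrix.of fun i j => mink (fderiv ℝ f u (EuclideanSpace.single i 1))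
    (fderiv ℝ f u (EuclideanSpace.single j 1))

/-- The second fundamental form of a parametrization `f` at `u` with respect to a unit normal `N`.
As `N` is orthogonal to the position vector, the Levi-Civita connection of hyperbolic space may be
replaced by ordinary differentiation in Minkowski space. -/
def secondForm (f : Plane → Mink) (u : Plane) (N : Mink) : Matrix (Fin 2) (Fin 2) ℝ :=
  Matrix.of fun i j => mink (fderiv ℝ (fderiv ℝ f) u (EuclideanSpace.single i 1)
    (EuclideanSpace.single j 1)) N

/-- The matrix of the shape operator in a parametrization. -/
def shape (f : Plane → Mink) (u : Plane) (N : Mink) : Matrix (Fin 2) (Fin 2) ℝ :=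
  (firstForm f u)⁻¹ * secondForm f u N

/-- The principal curvatures (eigenvalues of the shape operator) of `T` lie in `(-1, 1)`. -/
def HasSmallCurvatures (T : Set H3) : Prop :=
  ∀ x ∈ T, ∀ N, IsUnitNormal T x N → ∀ U f, IsLocalParam T U f → ∀ u ∈ U, f u = x →
    ∀ k : ℝ, Module.End.HasEigenvalue (Matrix.toLin' (shape f u N)) k → k ∈ Set.Ioo (-1 : ℝ) 1

/-- The surface `T` has constant mean curvature `H` (half the trace of the shape operator) with
respect to its unit normal pointing towards `Ωp`. -/
def HasMeanCurvature (T : Set H3) (Ωp Ωm : Set Bdry) (H : ℝ) : Prop :=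
  ∀ x ∈ T, ∃ N, IsUnitNormalTowards T Ωp Ωm x N ∧
    ∀ U f, IsLocalParam T U f → ∀ u ∈ U, f u = x → (shape f u N).trace / 2 = H

/-- `S` is a closed embedded `C²` surface in `ℍ³/Γ`, homeomorphic to the closed surface `F` and
homotopic to the fiber `F × {0}` of the product structure `Φ`. Being an embedded surface is a local
condition, expressed on the preimage in the covering `ℍ³`. -/
structure IsFiberSurface {F : Type*} [TopologicalSpace F] (Γ : Subgroup PSL2C)
    (Φ : F × ℝ ≃ₜ Quot3 Γ) (S : Set (Quot3 Γ)) : Prop where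
  isSurface : IsSurface (proj Γ ⁻¹' S)
  homotopic : ∃ j : C(F, Quot3 Γ), IsEmbedding j ∧ Set.range j = S ∧
    j.Homotopic ⟨fun p => Φ (p, 0), by fun_prop⟩

end QF

end

/-! Everything happens in `H3`, with `T` and `T'` the preimages of the two surfaces: closed,
`Γ`-invariant and cocompact. The argument is a maximum principle for the distance to `T`, the
surface whose principal curvatures lie in `(-1, 1)`.

Small curvatures make the distance to `T` tractable. If `p` is on the normal geodesic at `x`, say `p
= cosh s · x + sinh s · N`, then `x` is critical on `T` for `y ↦ -⟨y, p⟩`, the hyperbolic cosine of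
the distance to `p`, with Hessian `cosh s · I - sinh s · II`. This is positive because `|II| < I`.
Seen on the closed far side of `T`, where the function is proper, every point therefore either
admits a descent or is a strict local minimum, and a mountain pass argument (`strictMinAt_unique`)
allows only one such minimum. Hence nearest points are unique and depend continuously on `p`, and
the normal geodesics sweep out each side of `T` (`IsSided.ray_mem`, `IsSided.exists_ray_eq`).

The surface parallel to `T` at distance `t` in the direction `N` has principal curvatures `(k - tanh
t) / (1 - k tanh t)`, which are less than `k` for `t > 0` and `|k| < 1`. So its mean curvature at
each point is less than `H`. By cocompactness some `x'` in `T'` is at maximal distance `t` from `T`.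
If `t > 0` and `x'` is on the side of `N`, then `T'` touches the parallel surface at `x'` from
inside. The region beyond the parallel surface is connected, misses `T'` and reaches the same domain
at infinity as the positive side of `T'`, so the normals agree. The mean curvature of `T'` at `x'`
is then less than `H`, a contradiction. The other side is symmetric.

In `IsSided.not_max` the parallel surface is never differentiated: equality of traces gives one
tangent direction in which the second form of `T'` is at least that of `T`, and the second
derivative test is applied to the distance between a point of `T` and a point of a curve in `T'`
with that direction (`comparison_form_pos`, `eventually_neg_mink_lt`). The conclusion is `t = 0`, so
`T' ⊆ T`; as both surfaces separate the same two ends, they coincide. -/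

noncomputable section

namespace QF

open Topology Filter
open scoped Matrix

/-! ### Mountain pass principle for proper functions on connected sets -/

section MountainPass

variable {X : Type*} [TopologicalSpace X]

/-- The intersection of a directed family of compact preconnected sets is preconnected. -/
theorem isPreconnected_iInter_of_directed [T2Space X] {ι : Type*} [Nonempty ι] {V : ι → Set X}
    (hV : Directed (· ⊇ ·) V) (hc : ∀ i, IsCompact (V i)) (hp : ∀ i, IsPreconnected (V i)) :
    IsPreconnected (⋂ i, V i) := by
  have hcl : IsClosed (⋂ i, V i) := isClosed_iInter fun i => (hc i).isClosed
  have hK : IsCompact (⋂ i, V i) :=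
    (hc (Classical.arbitrary ι)).of_isClosed_subset hcl (Set.iInter_subset _ _)
  rw [isPreconnected_iff_subset_of_disjoint_closed]
  intro u v hu hv huv hd
  have hdis : Disjoint ((⋂ i, V i) ∩ u) ((⋂ i, V i) ∩ v) := by
    rw [Set.disjoint_left]
    rintro z ⟨hz, hzu⟩ ⟨-, hzv⟩
    exact (Set.mem_empty_iff_false z).1 (hd ▸ ⟨hz, hzu, hzv⟩)
  obtain ⟨U', V', hU', hV', hsu, hsv, hUV⟩ :=
    SeparatedNhds.of_isCompact_isCompact (hK.inter_right hu) (hK.inter_right hv) hdis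
  obtain ⟨i, hi⟩ := exists_subset_nhds_of_isCompact hV hc (U := U' ∪ V') fun x hx =>
    (hU'.union hV').mem_nhds <| (huv hx).imp (fun h => hsu ⟨hx, h⟩) fun h => hsv ⟨hx, h⟩
  rcases (hp i).subset_or_subset hU' hV' hUV hi with h | h
  · left
    intro x hx
    rcases huv hx with h1 | h1
    · exact h1
    · exact absurd (hsv ⟨hx, h1⟩) (Set.disjoint_left.1 hUV (h (Set.mem_iInter.1 hx i)))
  · right
    intro x hx
    rcases huv hx with h1 | h1
    · exact absurd (h (Set.mem_iInter.1 hx i)) (Set.disjoint_left.1 hUV (hsu ⟨hx, h1⟩))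
    · exact h1

theorem isCompact_connectedComponentIn [T2Space X] {K : Set X} (hK : IsCompact K) (x : X) :
    IsCompact (connectedComponentIn K x) := by
  by_cases hx : x ∈ K
  · refine hK.of_isClosed_subset (isClosed_of_closure_subset ?_) (connectedComponentIn_subset _ _)
    exact isPreconnected_connectedComponentIn.closure.subset_connectedComponentIn
      (subset_closure (mem_connectedComponentIn hx))
      (closure_minimal (connectedComponentIn_subset _ _) hK.isClosed)
  · rw [connectedComponentIn_eq_empty hx]
    exact isCompact_empty

/-- The set `A` is locally connected at `z`. -/
def LocConnAt (A : Set X) (z : X) : Prop :=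
  ∀ W ∈ 𝓝 z, ∃ W' ∈ 𝓝 z, ∃ D, IsPreconnected D ∧ D ⊆ A ∩ W ∧ A ∩ W' ⊆ D

/-- Near `q`, the part of `A` where `φ < φ q` is nonempty and lies in a connected subset of
`A ∩ {φ < φ q}`. -/
def DescendsAt (A : Set X) (φ : X → ℝ) (q : X) : Prop :=
  ∃ D, IsPreconnected D ∧ (∀ w ∈ D, w ∈ A ∧ φ w < φ q) ∧ q ∈ closure D ∧
    ∀ᶠ w in 𝓝 q, w ∈ A → φ w < φ q → w ∈ D

/-- The point `q` is a strict local minimum of `φ` on `A`. -/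
def StrictMinAt (A : Set X) (φ : X → ℝ) (q : X) : Prop :=
  ∀ᶠ y in 𝓝 q, y ∈ A → y ≠ q → φ q < φ y

/-- The points `x` and `y` lie in a common connected subset of `A ∩ {φ ≤ c}`. -/
def JoinedBelow (A : Set X) (φ : X → ℝ) (c : ℝ) (x y : X) : Prop :=
  ∃ L, IsPreconnected L ∧ (∀ w ∈ L, w ∈ A ∧ φ w ≤ c) ∧ x ∈ L ∧ y ∈ L

theorem JoinedBelow.trans {A : Set X} {φ : X → ℝ} {c d : ℝ} {x y z : X}
    (h : JoinedBelow A φ c x y) (h' : JoinedBelow A φ d y z) : JoinedBelow A φ (max c d) x z := by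
  obtain ⟨L, hL, hs, hx, hy⟩ := h
  obtain ⟨L', hL', hs', hx', hy'⟩ := h'
  refine ⟨L ∪ L', hL.union y hy hx' hL', ?_, Or.inl hx, Or.inr hy'⟩
  rintro w (hw | hw)
  · exact ⟨(hs w hw).1, (hs w hw).2.trans (le_max_left _ _)⟩
  · exact ⟨(hs' w hw).1, (hs' w hw).2.trans (le_max_right _ _)⟩

theorem JoinedBelow.mono {A : Set X} {φ : X → ℝ} {c d : ℝ} {x y : X}
    (h : JoinedBelow A φ c x y) (hcd : c ≤ d) : JoinedBelow A φ d x y := by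
  obtain ⟨L, hL, hs, hx, hy⟩ := h
  exact ⟨L, hL, fun w hw => ⟨(hs w hw).1, (hs w hw).2.trans hcd⟩, hx, hy⟩

theorem JoinedBelow.symm {A : Set X} {φ : X → ℝ} {c : ℝ} {x y : X}
    (h : JoinedBelow A φ c x y) : JoinedBelow A φ c y x := by
  obtain ⟨L, hL, hs, hx, hy⟩ := h
  exact ⟨L, hL, hs, hy, hx⟩

variable {A : Set X} {φ : X → ℝ}

theorem LocConnAt.eventually_joinedBelow {z : X} (h : LocConnAt A z) (hz : z ∈ A)
    (hφ : Continuous φ) {c : ℝ} (hc : φ z < c) :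
    ∀ᶠ y in 𝓝 z, y ∈ A → JoinedBelow A φ c z y := by
  obtain ⟨W', hW', D, hD, hDs, hsD⟩ := h {y | φ y < c} ((isOpen_lt hφ continuous_const).mem_nhds hc)
  filter_upwards [hW'] with y hy hyA
  exact ⟨D, hD, fun w hw => ⟨(hDs hw).1, le_of_lt (show φ w < c from (hDs hw).2)⟩,
    hsD ⟨hz, mem_of_mem_nhds hW'⟩,
    hsD ⟨hyA, hy⟩⟩

/-- Local connectedness makes the set of points joined to `x` at some level both open and closed
relative to `A`. -/
theorem exists_joinedBelow (hφ : Continuous φ) (hA : IsPreconnected A)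
    (hloc : ∀ z ∈ A, LocConnAt A z) {x y : X} (hx : x ∈ A) (hy : y ∈ A) :
    ∃ c, JoinedBelow A φ c x y := by
  let U : Set X := {z | ∃ c, JoinedBelow A φ c x z}
  have key : ∀ z ∈ A, (∀ᶠ w in 𝓝 z, w ∈ A → w ∈ U) ∨ (∀ᶠ w in 𝓝 z, w ∈ A → w ∉ U) := by
    intro z hz
    have h := (hloc z hz).eventually_joinedBelow hz hφ (lt_add_one (φ z))
    by_cases hzU : z ∈ U
    · left
      obtain ⟨c, hc⟩ := hzU
      exact h.mono fun w hw hwA => ⟨_, hc.trans (hw hwA)⟩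
    · right
      exact h.mono fun w hw hwA ⟨c, hc⟩ => hzU ⟨_, hc.trans (hw hwA).symm⟩
  by_contra hcon
  have hyU : y ∉ U := hcon
  have hxU : x ∈ U := by
    refine ⟨φ x, {x}, isPreconnected_singleton, ?_, rfl, rfl⟩
    rintro w rfl
    exact ⟨hx, le_rfl⟩
  obtain ⟨z, hz, h1, h2⟩ := hA (interior {w | w ∈ A → w ∈ U}) (interior {w | w ∈ A → w ∉ U})
    isOpen_interior isOpen_interior
    (fun z hz => (key z hz).imp mem_interior_iff_mem_nhds.2 mem_interior_iff_mem_nhds.2)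
    ⟨x, hx, (mem_interior_iff_mem_nhds.2 ((key x hx).resolve_right fun h =>
      h.self_of_nhds hx hxU))⟩
    ⟨y, hy, (mem_interior_iff_mem_nhds.2 ((key y hy).resolve_left fun h =>
      hyU (h.self_of_nhds hy)))⟩
  exact interior_subset h2 hz (interior_subset h1 hz)

/-- Near a strict minimum `q`, no other point of `A` has value at most `φ q`. Thus `q` is isolated
in `K`, and connectedness leaves nothing else. -/
theorem StrictMinAt.subset_singleton {K : Set X} (hK : IsPreconnected K) [T2Space X] {q : X}
    (h : StrictMinAt A φ q) (hKs : ∀ w ∈ K, w ∈ A ∧ φ w ≤ φ q) (hq : q ∈ K) {y : X} (hy : y ∈ K) :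
    y = q := by
  by_contra hne
  obtain ⟨z, hz, h1, h2⟩ := hK (interior {w | w ∈ A → w ≠ q → φ q < φ w}) {q}ᶜ isOpen_interior
    isOpen_compl_singleton (fun z hz => by
      by_cases hzq : z = q
      · subst hzq
        exact Or.inl (mem_interior_iff_mem_nhds.2 h)
      · exact Or.inr hzq) ⟨q, hq, mem_interior_iff_mem_nhds.2 h⟩ ⟨y, hy, hne⟩
  exact absurd (interior_subset h1 (hKs z hz).1 h2) (not_lt.2 (hKs z hz).2)

/-- The infimum of the joining levels is attained: for levels decreasing to it, the components of
`x` in the sublevel sets are nested compact connected sets containing `y`, and their intersection is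
connected. -/
theorem exists_minimal_joinedBelow [T2Space X]
    (hcpt : ∀ c, IsCompact (A ∩ {y | φ y ≤ c})) {x y : X} (h : ∃ c, JoinedBelow A φ c x y) :
    ∃ c, JoinedBelow A φ c x y ∧ ∀ d, JoinedBelow A φ d x y → c ≤ d := by
  let J : Set ℝ := {c | JoinedBelow A φ c x y}
  have hbdd : BddBelow J := ⟨φ x, fun c ⟨L, _, hs, hx, _⟩ => (hs x hx).2⟩
  refine ⟨sInf J, ?_, fun d hd => csInf_le hbdd hd⟩
  have hJ : ∀ n : Set.Ioi (sInf J), JoinedBelow A φ n x y := by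
    rintro ⟨n, hn⟩
    obtain ⟨c, hc, hcn⟩ := (csInf_lt_iff hbdd h).1 hn
    exact JoinedBelow.mono hc hcn.le
  let V : Set.Ioi (sInf J) → Set X := fun n => connectedComponentIn (A ∩ {y | φ y ≤ n}) x
  have hVs : ∀ n, V n ⊆ A ∩ {y | φ y ≤ n} := fun n => connectedComponentIn_subset _ _
  have hVx : ∀ n, x ∈ V n := by
    intro n
    obtain ⟨L, hL, hs, hx, hy⟩ := hJ n
    exact mem_connectedComponentIn (hs x hx)
  have hVc : ∀ n, IsCompact (V n) := fun n =>
    isCompact_connectedComponentIn (hcpt n) x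
  have : Nonempty (Set.Ioi (sInf J)) := ⟨⟨sInf J + 1, by simp⟩⟩
  refine ⟨⋂ n, V n, isPreconnected_iInter_of_directed ?_ hVc
    (fun n => isPreconnected_connectedComponentIn), ?_, Set.mem_iInter.2 hVx, ?_⟩
  · refine directed_of_isDirected_ge ?_
    intro n m hnm
    exact connectedComponentIn_mono _ fun w hw => ⟨hw.1, le_trans (show φ w ≤ n from hw.2) hnm⟩
  · intro w hw
    rw [Set.mem_iInter] at hw
    refine ⟨(hVs ⟨sInf J + 1, by simp⟩ (hw _)).1, ?_⟩
    exact le_of_forall_gt_imp_ge_of_dense fun n hn => (hVs ⟨n, hn⟩ (hw ⟨n, hn⟩)).2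
  · refine Set.mem_iInter.2 fun n => ?_
    obtain ⟨L, hL, hs, hx, hy⟩ := hJ n
    exact hL.subset_connectedComponentIn hx hs hy

/-- A form of the mountain pass principle: if all the critical points of a proper function on a
connected set are strict local minima, there is at most one of them. -/
theorem strictMinAt_unique [T2Space X] (hφ : Continuous φ) (hA : IsPreconnected A)
    (hcpt : ∀ c, IsCompact (A ∩ {y | φ y ≤ c})) (hloc : ∀ z ∈ A, LocConnAt A z)
    (hdich : ∀ z ∈ A, DescendsAt A φ z ∨ StrictMinAt A φ z) {x y : X} (hx : x ∈ A) (hy : y ∈ A)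
    (hxm : StrictMinAt A φ x) (hym : StrictMinAt A φ y) : x = y := by
  by_contra hxy
  obtain ⟨c, ⟨K, hK, hKs, hxK, hyK⟩, hmin⟩ :=
    exists_minimal_joinedBelow hcpt (exists_joinedBelow hφ hA hloc hx hy)
  have hxc : φ x < c := lt_of_le_of_ne (hKs x hxK).2 fun h =>
    hxy (hxm.subset_singleton hK (h ▸ hKs) hxK hyK).symm
  have hyc : φ y < c := lt_of_le_of_ne (hKs y hyK).2 fun h =>
    hxy (hym.subset_singleton hK (h ▸ hKs) hyK hxK)
  -- Membership in `P`, being joined to `x` strictly below the pass level `c`, is locally constant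
  -- on `A ∩ {φ < c}`. Minimality of `c` excludes `y` from `P`.
  let P : Set X := {z | ∃ d < c, JoinedBelow A φ d x z}
  have hP : ∀ z ∈ A, φ z < c → (∀ᶠ w in 𝓝 z, w ∈ A → (w ∈ P ↔ z ∈ P)) := by
    intro z hz hzc
    obtain ⟨d, hzd, hdc⟩ := exists_between hzc
    refine ((hloc z hz).eventually_joinedBelow hz hφ hzd).mono fun w hw hwA => ⟨?_, ?_⟩
    · rintro ⟨e, he, hj⟩
      exact ⟨_, max_lt he hdc, hj.trans (hw hwA).symm⟩
    · rintro ⟨e, he, hj⟩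
      exact ⟨_, max_lt he hdc, hj.trans (hw hwA)⟩
  have hPD : ∀ D, IsPreconnected D → (∀ w ∈ D, w ∈ A ∧ φ w < c) → D ⊆ P ∨ Disjoint D P := by
    intro D hD hDs
    by_contra hcon
    rw [not_or, Set.not_subset, Set.not_disjoint_iff] at hcon
    obtain ⟨⟨a, ha, haP⟩, b, hb, hbP⟩ := hcon
    obtain ⟨z, hz, h1, h2⟩ := hD (interior {w | w ∈ A → w ∈ P}) (interior {w | w ∈ A → w ∉ P})
      isOpen_interior isOpen_interior (fun z hz => by
        by_cases hzP : z ∈ P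
        · left
          rw [mem_interior_iff_mem_nhds]
          exact (hP z (hDs z hz).1 (hDs z hz).2).mono fun w hw hwA => (hw hwA).2 hzP
        · right
          rw [mem_interior_iff_mem_nhds]
          exact (hP z (hDs z hz).1 (hDs z hz).2).mono fun w hw hwA h => hzP ((hw hwA).1 h))
      ⟨b, hb, mem_interior_iff_mem_nhds.2
        ((hP b (hDs b hb).1 (hDs b hb).2).mono fun w hw hwA => (hw hwA).2 hbP)⟩
      ⟨a, ha, mem_interior_iff_mem_nhds.2
        ((hP a (hDs a ha).1 (hDs a ha).2).mono fun w hw hwA h => haP ((hw hwA).1 h))⟩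
    exact interior_subset h2 (hDs z hz).1 (interior_subset h1 (hDs z hz).1)
  have hxP : x ∈ P := by
    refine ⟨φ x, hxc, {x}, isPreconnected_singleton, ?_, rfl, rfl⟩
    rintro w rfl
    exact ⟨hx, le_rfl⟩
  have hyP : y ∉ P := fun ⟨d, hd, hj⟩ => absurd (hmin d hj) (not_le.2 hd)
  let O : Set X := interior {w | w ∈ A → φ w < c → w ∈ P}
  let O' : Set X := interior {w | w ∈ A → φ w < c → w ∉ P}
  -- A strict minimum at the top level would reduce `K` to one point. So the part below `c` near
  -- each top point of `K` is connected and nonempty, and lies wholly inside or wholly outside `P`;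
  -- this splits `K`.
  have htop : ∀ z ∈ K, φ z = c → DescendsAt A φ z := by
    intro z hz hzc
    refine (hdich z (hKs z hz).1).resolve_right fun h => ?_
    have := h.subset_singleton hK (hzc ▸ hKs) hz hxK
    exact hxc.ne (this ▸ hzc)
  have hcov : K ⊆ O ∪ O' := by
    intro z hz
    rcases (hKs z hz).2.lt_or_eq with hzc | hzc
    · by_cases hzP : z ∈ P
      · left
        rw [mem_interior_iff_mem_nhds]
        exact (hP z (hKs z hz).1 hzc).mono fun w hw hwA _ => (hw hwA).2 hzP
      · right
        rw [mem_interior_iff_mem_nhds]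
        exact (hP z (hKs z hz).1 hzc).mono fun w hw hwA _ h => hzP ((hw hwA).1 h)
    · obtain ⟨D, hD, hDs, -, hWD⟩ := htop z hz hzc
      rw [hzc] at hDs hWD
      rcases hPD D hD hDs with h | h
      · left
        rw [mem_interior_iff_mem_nhds]
        exact hWD.mono fun w hw hwA hwc => h (hw hwA hwc)
      · right
        rw [mem_interior_iff_mem_nhds]
        exact hWD.mono fun w hw hwA hwc => Set.disjoint_left.1 h (hw hwA hwc)
  obtain ⟨z, hz, h1, h2⟩ := hK O O' isOpen_interior isOpen_interior hcov
    ⟨x, hxK, (hcov hxK).resolve_right fun h => interior_subset h hx hxc hxP⟩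
    ⟨y, hyK, (hcov hyK).resolve_left fun h => hyP (interior_subset h hy hyc)⟩
  rcases (hKs z hz).2.lt_or_eq with hzc | hzc
  · exact interior_subset h2 (hKs z hz).1 hzc (interior_subset h1 (hKs z hz).1 hzc)
  · obtain ⟨D, hD, hDs, hcl, -⟩ := htop z hz hzc
    rw [hzc] at hDs
    obtain ⟨w, ⟨hw1, hw2⟩, hwD⟩ := mem_closure_iff.1 hcl _ (isOpen_interior.inter isOpen_interior)
      ⟨h1, h2⟩
    exact interior_subset hw2 (hDs w hwD).1 (hDs w hwD).2
      (interior_subset hw1 (hDs w hwD).1 (hDs w hwD).2)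

end MountainPass

/-! ### Charts modelled on convex cones, treating interior and boundary points together -/

section Charts

variable {X V : Type*} [TopologicalSpace X] [NormedAddCommGroup V] [NormedSpace ℝ V]

/-- In the chart `ψ`, the set `A` is the convex cone `C` near `0`. -/
structure ConeChart (A : Set X) (C : Set V) (ψ : V → X) (q : X) : Prop where
  zero : ψ 0 = q
  convex : Convex ℝ C
  smul_mem : ∀ v ∈ C, ∀ s : ℝ, 0 ≤ s → s • v ∈ C
  continuousAt : ∀ᶠ v in 𝓝 (0 : V), ContinuousAt ψ v
  image_mem : ∀ U ∈ 𝓝 (0 : V), ψ '' U ∈ 𝓝 q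
  mem_iff : ∀ᶠ v in 𝓝 (0 : V), (ψ v ∈ A ↔ v ∈ C)

theorem ConeChart.add_mem {A : Set X} {C : Set V} {ψ : V → X} {q : X} (h : ConeChart A C ψ q)
    {v w : V} (hv : v ∈ C) (hw : w ∈ C) : v + w ∈ C := by
  have := h.smul_mem _ (h.convex hv hw (a := 1 / 2) (b := 1 / 2) (by norm_num) (by norm_num)
    (by norm_num)) 2 (by norm_num)
  rw [smul_add, smul_smul, smul_smul] at this
  norm_num at this
  exact this

theorem ConeChart.exists_ball {A : Set X} {C : Set V} {ψ : V → X} {q : X}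
    (h : ConeChart A C ψ q) :
    ∃ r > 0, ContinuousOn ψ (Metric.ball 0 r) ∧ ∀ v ∈ Metric.ball (0 : V) r, (ψ v ∈ A ↔ v ∈ C) := by
  obtain ⟨r, hr, hb⟩ := Metric.eventually_nhds_iff_ball.1 (h.continuousAt.and h.mem_iff)
  exact ⟨r, hr, fun v hv => (hb v hv).1.continuousWithinAt, fun v hv => (hb v hv).2⟩

theorem ConeChart.locConnAt {A : Set X} {C : Set V} {ψ : V → X} {q : X}
    (h : ConeChart A C ψ q) : LocConnAt A q := by
  intro W hW
  obtain ⟨r, hr, hc, hm⟩ := h.exists_ball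
  have hW' : ψ ⁻¹' W ∈ 𝓝 (0 : V) := h.continuousAt.self_of_nhds (h.zero.symm ▸ hW)
  obtain ⟨ε, hε, hεW⟩ := Metric.mem_nhds_iff.1 hW'
  have hsub : Metric.ball (0 : V) (min r ε) ⊆ Metric.ball 0 r :=
    Metric.ball_subset_ball (min_le_left _ _)
  have hsub' : Metric.ball (0 : V) (min r ε) ⊆ Metric.ball 0 ε :=
    Metric.ball_subset_ball (min_le_right _ _)
  refine ⟨ψ '' Metric.ball 0 (min r ε), h.image_mem _ (Metric.ball_mem_nhds _ (lt_min hr hε)),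
    ψ '' (Metric.ball 0 (min r ε) ∩ C), ?_, ?_, ?_⟩
  · exact ((convex_ball _ _).inter h.convex).isPreconnected.image _
      (hc.mono (Set.inter_subset_left.trans hsub))
  · rintro _ ⟨v, ⟨hv, hvC⟩, rfl⟩
    exact ⟨(hm v (hsub hv)).2 hvC, hεW (hsub' hv)⟩
  · rintro _ ⟨hA, v, hv, rfl⟩
    exact ⟨v, ⟨hv, (hm v (hsub hv)).1 hA⟩, rfl⟩

/-- If a `C¹` function strictly decreases in a direction of the cone, it has no critical point. -/
theorem ConeChart.descendsAt {A : Set X} {C : Set V} {ψ : V → X} {q : X}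
    (h : ConeChart A C ψ q) {φ : X → ℝ} {G' : V → V →L[ℝ] ℝ}
    (hG : ∀ᶠ v in 𝓝 (0 : V), HasFDerivAt (fun v => φ (ψ v)) (G' v) v)
    (hG' : ContinuousAt G' 0) {w : V} (hw : w ∈ C) (hneg : G' 0 w < 0) : DescendsAt A φ q := by
  set G : V → ℝ := fun v => φ (ψ v) with hGdef
  have hev : ∀ᶠ v in 𝓝 (0 : V), G' v w < 0 := by
    have : ContinuousAt (fun v => G' v w) 0 := hG'.clm_apply continuousAt_const
    exact this.eventually (gt_mem_nhds hneg)
  obtain ⟨r₀, hr₀, hc, hm⟩ := h.exists_ball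
  obtain ⟨r₁, hr₁, hb⟩ := Metric.eventually_nhds_iff_ball.1 (hG.and hev)
  let r := min r₀ r₁
  have hr : 0 < r := lt_min hr₀ hr₁
  have hs₀ : Metric.ball (0 : V) r ⊆ Metric.ball 0 r₀ := Metric.ball_subset_ball (min_le_left _ _)
  have hs₁ : Metric.ball (0 : V) r ⊆ Metric.ball 0 r₁ := Metric.ball_subset_ball (min_le_right _ _)
  have hGq : G 0 = φ q := by rw [hGdef]; simp only [h.zero]
  -- moving along `w` decreases `G`
  have hdec : ∀ v, ∀ s : ℝ, 0 < s → (∀ t ∈ Set.Icc 0 s, v + t • w ∈ Metric.ball (0 : V) r) →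
      G (v + s • w) < G v := by
    intro v s hs hball
    have hderiv : ∀ t ∈ Set.Icc 0 s,
        HasDerivAt (fun t : ℝ => G (v + t • w)) (G' (v + t • w) w) t := by
      intro t ht
      have h1 : HasDerivAt (fun t : ℝ => v + t • w) w t := by
        simpa using ((hasDerivAt_id t).smul_const w).const_add v
      exact ((hb _ (hs₁ (hball t ht))).1).comp_hasDerivAt t h1
    have hanti := strictAntiOn_of_deriv_neg (convex_Icc 0 s)
      (f := fun t : ℝ => G (v + t • w)) (fun t ht => (hderiv t ht).continuousAt.continuousWithinAt)
      (fun t ht => by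
        rw [interior_Icc] at ht
        rw [(hderiv t (Set.Ioo_subset_Icc_self ht)).deriv]
        exact (hb _ (hs₁ (hball t (Set.Ioo_subset_Icc_self ht)))).2)
    simpa using hanti (Set.left_mem_Icc.2 hs.le) (Set.right_mem_Icc.2 hs.le) hs
  -- A displacement by `ε • w` starting in the ball of radius `r / 2` stays in the ball of radius
  -- `r`, where `G` decreases along `w`.
  obtain ⟨ε, hε, hεr⟩ : ∃ ε > 0, ε * ‖w‖ < r / 2 := by
    refine ⟨r / 2 / (‖w‖ + 1), by positivity, ?_⟩
    rw [div_mul_eq_mul_div, div_lt_iff₀ (by positivity)]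
    nlinarith [norm_nonneg w]
  have hmemball : ∀ v ∈ Metric.ball (0 : V) (r / 2), ∀ t ∈ Set.Icc 0 ε,
      v + t • w ∈ Metric.ball (0 : V) r := by
    intro v hv t ht
    rw [mem_ball_zero_iff] at hv ⊢
    calc ‖v + t • w‖ ≤ ‖v‖ + ‖t • w‖ := norm_add_le _ _
      _ ≤ ‖v‖ + ε * ‖w‖ := by
        rw [norm_smul, Real.norm_of_nonneg ht.1]
        gcongr
        exact ht.2
      _ < r := by linarith
  have hεG : G (ε • w) < G 0 := by
    simpa using hdec 0 ε hε (hmemball 0 (Metric.mem_ball_self (by positivity)))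
  have hεmem : ε • w ∈ Metric.ball (0 : V) (r / 2) := by
    rwa [mem_ball_zero_iff, norm_smul, Real.norm_of_nonneg hε.le]
  have hGc : ContinuousAt G (ε • w) :=
    (hb _ (hs₁ (Metric.ball_subset_ball (by linarith) hεmem))).1.continuousAt
  obtain ⟨ρ, hρ, hρG⟩ := Metric.eventually_nhds_iff_ball.1
    ((hGc.eventually (gt_mem_nhds hεG)).and (Metric.isOpen_ball.mem_nhds hεmem))
  let δ := min ρ (r / 2)
  have hδ : 0 < δ := lt_min hρ (by linarith)
  let B : Set V := Metric.ball (ε • w) δ ∩ C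
  let M : Set V := Metric.ball 0 δ ∩ C ∩ {v | G v < G 0}
  have hδr : Metric.ball (0 : V) δ ⊆ Metric.ball 0 (r / 2) :=
    Metric.ball_subset_ball (min_le_right _ _)
  let S : V → Set V := fun v => (fun t : ℝ => v + t • w) '' Set.Icc 0 ε
  have hεC : ε • w ∈ C := h.smul_mem w hw ε hε.le
  have hSB : ∀ v ∈ M, v + ε • w ∈ B := by
    rintro v ⟨⟨hv, hvC⟩, -⟩
    refine ⟨?_, h.add_mem hvC hεC⟩
    rw [mem_ball_zero_iff] at hv
    rwa [Metric.mem_ball, dist_eq_norm, add_sub_cancel_right]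
  have hBsub : B ⊆ Metric.ball 0 r ∩ C ∩ {v | G v < G 0} := by
    rintro v ⟨hv, hvC⟩
    have := hρG v (Metric.ball_subset_ball (min_le_left _ _) hv)
    exact ⟨⟨Metric.ball_subset_ball (by linarith) this.2, hvC⟩, this.1⟩
  have hSsub : ∀ v ∈ M, S v ⊆ Metric.ball 0 r ∩ C ∩ {v | G v < G 0} := by
    rintro v ⟨⟨hv, hvC⟩, hvG⟩ _ ⟨t, ht, rfl⟩
    refine ⟨⟨hmemball v (hδr hv) t ht, h.add_mem hvC (h.smul_mem w hw t ht.1)⟩, ?_⟩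
    rcases ht.1.eq_or_lt with h0 | h0
    · simpa [← h0] using hvG
    · exact (hdec v t h0 fun s hs => hmemball v (hδr hv) s ⟨hs.1, hs.2.trans ht.2⟩).trans hvG
  -- Every point below the level of `q` is swept along `w`, with `G` decreasing, into the convex set
  -- `B` around `ε • w`, where `G < G 0`. The common set `B` connects all these segments.
  let D : Set V := ⋃ v : M, (S v ∪ B)
  have hDpre : IsPreconnected D := by
    have hBne : ε • w ∈ B := ⟨Metric.mem_ball_self hδ, hεC⟩
    refine isPreconnected_iUnion ⟨ε • w, Set.mem_iInter.2 fun v => Or.inr hBne⟩ fun v => ?_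
    refine IsPreconnected.union (v.1 + ε • w) ⟨ε, ⟨hε.le, le_rfl⟩, rfl⟩ (hSB v.1 v.2) ?_
      ((convex_ball _ _).inter h.convex).isPreconnected
    exact isPreconnected_Icc.image _ (by fun_prop)
  have hDsub : D ⊆ Metric.ball 0 r ∩ C ∩ {v | G v < G 0} :=
    Set.iUnion_subset fun v => Set.union_subset (hSsub v.1 v.2) hBsub
  have hMD : M ⊆ D := fun v hv => Set.mem_iUnion.2 ⟨⟨v, hv⟩, Or.inl ⟨0, ⟨le_rfl, hε.le⟩, by simp⟩⟩
  refine ⟨ψ '' D, hDpre.image _ (hc.mono fun v hv => hs₀ (hDsub hv).1.1), ?_, ?_,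
    mem_of_superset (h.image_mem _ (Metric.ball_mem_nhds _ hδ)) ?_⟩
  · rintro _ ⟨v, hv, rfl⟩
    refine ⟨(hm v (hs₀ (hDsub hv).1.1)).2 (hDsub hv).1.2, ?_⟩
    rw [← hGq]
    exact (hDsub hv).2
  · rw [← h.zero]
    have hcl : (0 : V) ∈ closure M := by
      have hlim : Tendsto (fun t : ℝ => t • w) (𝓝[>] 0) (𝓝 0) := by
        have : Tendsto (fun t : ℝ => t • w) (𝓝 0) (𝓝 ((0 : ℝ) • w)) :=
          (continuous_id.smul continuous_const).tendsto 0
        rw [zero_smul] at this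
        exact this.mono_left nhdsWithin_le_nhds
      refine mem_closure_of_tendsto hlim ?_
      filter_upwards [hlim.eventually (Metric.ball_mem_nhds 0 hδ), Ioo_mem_nhdsGT hε] with t ht hte
      refine ⟨⟨ht, h.smul_mem w hw t hte.1.le⟩, ?_⟩
      have := hdec 0 t hte.1 fun s hs => hmemball 0 (Metric.mem_ball_self (by positivity)) s
        ⟨hs.1, hs.2.trans hte.2.le⟩
      simpa using this
    have hcont : ContinuousAt ψ 0 := h.continuousAt.self_of_nhds
    exact closure_mono (Set.image_mono hMD)
      (mem_closure_image hcont hcl)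
  · rintro _ ⟨v, hv, rfl⟩ hA hlt
    refine ⟨v, hMD ⟨⟨hv, (hm v (hs₀ (Metric.ball_subset_ball (by linarith) (hδr hv)))).1 hA⟩, ?_⟩,
      rfl⟩
    change G v < G 0
    rwa [hGq]

end Charts

/-- The second derivative test: a nondegenerate critical point with positive definite second
derivative is a strict local minimum. -/
theorem eventually_lt_of_second_fderiv_pos {E : Type*} [NormedAddCommGroup E] [NormedSpace ℝ E]
    [FiniteDimensional ℝ E] {g : E → ℝ} {g' : E → E →L[ℝ] ℝ} {g'' : E →L[ℝ] E →L[ℝ] ℝ} {x : E}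
    (hg : ∀ᶠ y in 𝓝 x, HasFDerivAt g (g' y) y) (hg' : HasFDerivAt g' g'' x) (h0 : g' x = 0)
    (hpos : ∀ v, v ≠ 0 → 0 < g'' v v) : ∀ᶠ y in 𝓝 x, y ≠ x → g x < g y := by
  obtain ⟨c, hc, hcv⟩ : ∃ c > 0, ∀ v, c * ‖v‖ ^ 2 ≤ g'' v v := by
    by_cases hne : (Metric.sphere (0 : E) 1).Nonempty
    · obtain ⟨e, he, hmin⟩ := (isCompact_sphere (0 : E) 1).exists_isMinOn hne
        (f := fun v => g'' v v) (by fun_prop)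
      have he0 : e ≠ 0 := by
        rintro rfl
        simp at he
      refine ⟨g'' e e, hpos e he0, fun v => ?_⟩
      by_cases hv : v = 0
      · simp [hv]
      have hv' : 0 < ‖v‖ := norm_pos_iff.2 hv
      have h1 := hmin (a := ‖v‖⁻¹ • v) (by simp [norm_smul, hv'.ne'])
      simp only [map_smul, smul_apply, smul_eq_mul, Set.mem_ofPred_eq] at h1
      calc g'' e e * ‖v‖ ^ 2 ≤ (‖v‖⁻¹ * (‖v‖⁻¹ * g'' v v)) * ‖v‖ ^ 2 := by gcongr
        _ = g'' v v := by field_simp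
    · refine ⟨1, one_pos, fun v => ?_⟩
      by_cases hv : v = 0
      · simp [hv]
      · exact absurd ⟨‖v‖⁻¹ • v, by simp [norm_smul, hv]⟩ hne
  have hlo := hg'.isLittleO.def (half_pos hc)
  obtain ⟨r, hr, hb⟩ := Metric.eventually_nhds_iff_ball.1 (hg.and hlo)
  refine Metric.eventually_nhds_iff_ball.2 ⟨r, hr, fun y hy hyx => ?_⟩
  set v := y - x with hv
  have hv0 : v ≠ 0 := sub_ne_zero.2 hyx
  have hvr : ‖v‖ < r := by rwa [Metric.mem_ball, dist_eq_norm] at hy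
  have hmem : ∀ t ∈ Set.Icc (0 : ℝ) 1, x + t • v ∈ Metric.ball x r := by
    intro t ht
    rw [Metric.mem_ball, dist_eq_norm, add_sub_cancel_left, norm_smul, Real.norm_of_nonneg ht.1]
    nlinarith [ht.2, norm_nonneg v]
  have hderiv : ∀ t ∈ Set.Icc (0 : ℝ) 1,
      HasDerivAt (fun t => g (x + t • v)) (g' (x + t • v) v) t := by
    intro t ht
    have h1 : HasDerivAt (fun t : ℝ => x + t • v) v t := by
      simpa using ((hasDerivAt_id t).smul_const v).const_add x
    exact (hb _ (hmem t ht)).1.comp_hasDerivAt t h1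
  have hmono := strictMonoOn_of_deriv_pos (convex_Icc (0 : ℝ) 1) (f := fun t => g (x + t • v))
    (fun t ht => (hderiv t ht).continuousAt.continuousWithinAt) (fun t ht => by
      rw [interior_Icc] at ht
      have htc := Set.Ioo_subset_Icc_self ht
      rw [(hderiv t htc).deriv]
      -- The radial derivative is at least `c t ‖v‖²` minus the Taylor error `(c / 2) t ‖v‖²`.
      have h1 := (hb _ (hmem t htc)).2
      rw [h0, sub_zero, add_sub_cancel_left] at h1
      have h2 := ((g' (x + t • v) - g'' (t • v)).le_opNorm v).trans
        (mul_le_mul_of_nonneg_right h1 (norm_nonneg v))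
      rw [norm_smul, Real.norm_of_nonneg ht.1.le] at h2
      have h3 := abs_le.1 (Real.norm_eq_abs _ ▸ h2)
      simp only [sub_apply, map_smul, smul_apply,
        smul_eq_mul] at h3
      have h4 := mul_le_mul_of_nonneg_left (hcv v) ht.1.le
      have h5 : 0 < c * t * ‖v‖ ^ 2 := by
        have := norm_pos_iff.2 hv0
        have := ht.1
        positivity
      nlinarith [h3.1])
  have := hmono (Set.left_mem_Icc.2 zero_le_one) (Set.right_mem_Icc.2 zero_le_one) one_pos
  simpa [hv] using this

/-! ### Minkowski geometry of the hyperboloid -/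

section Minkowski

theorem mink_comm (x y : Mink) : mink x y = mink y x := by
  simp only [mink]; ring

theorem mink_add_left (x y z : Mink) : mink (x + y) z = mink x z + mink y z := by
  simp only [mink, PiLp.add_apply]; ring

theorem mink_smul_left (c : ℝ) (x y : Mink) : mink (c • x) y = c * mink x y := by
  simp only [mink, PiLp.smul_apply, smul_eq_mul]; ring

theorem mink_add_right (x y z : Mink) : mink x (y + z) = mink x y + mink x z := by
  simp only [mink, PiLp.add_apply]; ring

theorem mink_smul_right (c : ℝ) (x y : Mink) : mink x (c • y) = c * mink x y := by
  simp only [mink, PiLp.smul_apply, smul_eq_mul]; ring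

theorem mink_sub_right (x y z : Mink) : mink x (y - z) = mink x y - mink x z := by
  simp only [mink, PiLp.sub_apply]; ring

theorem mink_neg_left (x y : Mink) : mink (-x) y = -mink x y := by
  simp only [mink, PiLp.neg_apply]; ring

theorem mink_neg_right (x y : Mink) : mink x (-y) = -mink x y := by
  simp only [mink, PiLp.neg_apply]; ring

/-- The Minkowski form as a continuous bilinear map. -/
def minkL : Mink →L[ℝ] Mink →L[ℝ] ℝ :=
  (LinearMap.mk₂ ℝ mink mink_add_left mink_smul_left mink_add_right
    mink_smul_right).toContinuousBilinearMap

theorem continuous_mink : Continuous fun p : Mink × Mink => mink p.1 p.2 := by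
  simp only [mink]
  fun_prop

theorem Continuous.mink {X : Type*} [TopologicalSpace X] {f g : X → Mink} (hf : Continuous f)
    (hg : Continuous g) : Continuous fun x => mink (f x) (g x) :=
  continuous_mink.comp (hf.prodMk hg)

/-- The three spatial coordinates. -/
def spatial : Mink →L[ℝ] E3 :=
  LinearMap.toContinuousLinearMap
    { toFun := fun x => !₂[x 1, x 2, x 3]
      map_add' := fun x y => by ext i; fin_cases i <;> simp
      map_smul' := fun c x => by ext i; fin_cases i <;> simp }

theorem spatial_apply (x : Mink) : spatial x = !₂[x 1, x 2, x 3] := rfl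

theorem inner_spatial (x y : Mink) :
    inner ℝ (spatial x) (spatial y) = mink x y + x 0 * y 0 := by
  simp [spatial_apply, PiLp.inner_apply, Fin.sum_univ_three, mink]
  ring

theorem norm_sq_spatial (x : H3) : ‖spatial x.1‖ ^ 2 = x.1 0 ^ 2 - 1 := by
  rw [← real_inner_self_eq_norm_sq, inner_spatial, x.2.1]
  ring

theorem spatial_lt (x : H3) : ‖spatial x.1‖ < x.1 0 :=
  lt_of_pow_lt_pow_left₀ 2 x.2.2.le (by rw [norm_sq_spatial]; linarith)

theorem one_le_coord (x : H3) : 1 ≤ x.1 0 := by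
  have h := norm_sq_spatial x
  nlinarith [sq_nonneg ‖spatial x.1‖, x.2.2]

theorem eq_zero_of_spatial {v : Mink} (h : spatial v = 0) (h0 : v 0 = 0) : v = 0 := by
  rw [spatial_apply] at h
  ext i
  fin_cases i
  · exact h0
  · simpa using congrArg (fun w : E3 => w 0) h
  · simpa using congrArg (fun w : E3 => w 1) h
  · simpa using congrArg (fun w : E3 => w 2) h

theorem eq_zero_of_tangent_of_spatial (x : H3) {v : Mink} (hv : mink x.1 v = 0)
    (h : spatial v = 0) : v = 0 := by
  refine eq_zero_of_spatial h ?_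
  have h1 := inner_spatial x.1 v
  rw [h, inner_zero_right, hv, zero_add] at h1
  exact (mul_eq_zero.1 h1.symm).resolve_left x.2.2.ne'

/-- Tangent vectors of hyperbolic space are spacelike. -/
theorem mink_self_pos (x : H3) {v : Mink} (hv : mink x.1 v = 0) (hv0 : v ≠ 0) :
    0 < mink v v := by
  have hs : 0 < ‖spatial v‖ := norm_pos_iff.2 fun h => hv0 (eq_zero_of_tangent_of_spatial x hv h)
  have h1 := real_inner_mul_inner_self_le (spatial x.1) (spatial v)
  simp only [real_inner_self_eq_norm_sq] at h1
  rw [inner_spatial, hv, zero_add, norm_sq_spatial] at h1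
  have h2 := inner_spatial v v
  rw [real_inner_self_eq_norm_sq] at h2
  have h3 : 0 < x.1 0 ^ 2 * mink v v := by nlinarith [pow_pos hs 2]
  exact pos_of_mul_pos_right h3 (sq_nonneg _)

theorem mink_self_nonneg (x : H3) {v : Mink} (hv : mink x.1 v = 0) : 0 ≤ mink v v := by
  by_cases h : v = 0
  · simp [h, mink]
  · exact (mink_self_pos x hv h).le

theorem neg_mink_pos (x y : H3) : 0 < -mink x.1 y.1 := by
  have h := real_inner_le_norm (spatial x.1) (spatial y.1)
  rw [inner_spatial] at h
  have hx := spatial_lt x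
  have hy := spatial_lt y
  nlinarith [norm_nonneg (spatial x.1), norm_nonneg (spatial y.1), x.2.2]

theorem mink_proj_tangent (x : H3) (y : Mink) : mink x.1 (y + mink x.1 y • x.1) = 0 := by
  rw [mink_add_right, mink_smul_right, x.2.1]; ring

theorem mink_proj_self (x y : H3) :
    mink (y.1 + mink x.1 y.1 • x.1) (y.1 + mink x.1 y.1 • x.1) = mink x.1 y.1 ^ 2 - 1 := by
  simp only [mink_add_left, mink_add_right, mink_smul_left, mink_smul_right, x.2.1, y.2.1,
    mink_comm y.1 x.1]
  ring

/-- Reverse Cauchy–Schwarz: the projection of `y` to the tangent space at `x` is spacelike, of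
square `⟨x, y⟩² - 1`. Equality forces this projection to vanish. -/
theorem one_le_neg_mink (x y : H3) : 1 ≤ -mink x.1 y.1 := by
  have h := mink_self_nonneg x (mink_proj_tangent x y.1)
  rw [mink_proj_self] at h
  nlinarith [neg_mink_pos x y]

theorem eq_of_neg_mink_le_one {x y : H3} (h : -mink x.1 y.1 ≤ 1) : x = y := by
  have h1 : mink x.1 y.1 = -1 := by linarith [one_le_neg_mink x y]
  by_contra hne
  have h0 : y.1 + mink x.1 y.1 • x.1 ≠ 0 := by
    intro h0
    rw [h1, neg_smul, one_smul, ← sub_eq_add_neg, sub_eq_zero] at h0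
    exact hne (Subtype.ext h0.symm)
  have := mink_self_pos x (mink_proj_tangent x y.1) h0
  rw [mink_proj_self, h1] at this
  norm_num at this

/-- Gives properness of the distance. With `r = ‖spatial x‖`, Cauchy–Schwarz yields `(x₀ - r) y₀ ≤
-⟨x, y⟩`, while `(x₀ - r)(x₀ + r) = 1` and `x₀ + r ≤ 2 x₀`. -/
theorem coord_le (x y : H3) : y.1 0 ≤ 2 * x.1 0 * -mink x.1 y.1 := by
  have h := real_inner_le_norm (spatial x.1) (spatial y.1)
  rw [inner_spatial] at h
  have hx := spatial_lt x
  have hy := spatial_lt y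
  have hx2 := norm_sq_spatial x
  set r := ‖spatial x.1‖
  have hr : 0 ≤ r := norm_nonneg _
  have h1 : (x.1 0 - r) * y.1 0 ≤ -mink x.1 y.1 := by nlinarith
  have h2 : 1 ≤ (x.1 0 - r) * (2 * x.1 0) := by nlinarith
  have h3 := mul_le_mul_of_nonneg_left h1 (by linarith [x.2.2] : 0 ≤ 2 * x.1 0)
  nlinarith [y.2.2]

/-- The point of hyperbolic space with given spatial coordinates, as a vector. -/
def liftVec (y : E3) : Mink := !₂[√(1 + ‖y‖ ^ 2), y 0, y 1, y 2]

theorem liftVec_mem (y : E3) : mink (liftVec y) (liftVec y) = -1 ∧ 0 < liftVec y 0 := by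
  constructor
  · have h : √(1 + ‖y‖ ^ 2) * √(1 + ‖y‖ ^ 2) = 1 + ‖y‖ ^ 2 := Real.mul_self_sqrt (by positivity)
    have h2 : ‖y‖ ^ 2 = y 0 ^ 2 + y 1 ^ 2 + y 2 ^ 2 := by
      simp [EuclideanSpace.real_norm_sq_eq, Fin.sum_univ_three]
    simp only [mink, liftVec]
    simp
    linarith
  · simp only [liftVec]
    simp
    positivity

theorem spatial_liftVec (y : E3) : spatial (liftVec y) = y := by
  ext i
  fin_cases i <;> simp [spatial_apply, liftVec]

theorem liftVec_spatial (x : H3) : liftVec (spatial x.1) = x.1 := by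
  have h : √(1 + ‖spatial x.1‖ ^ 2) = x.1 0 := by
    rw [norm_sq_spatial, add_sub_cancel, Real.sqrt_sq x.2.2.le]
  ext i
  fin_cases i
  · simpa [liftVec] using h
  all_goals simp [liftVec, spatial_apply]

theorem contDiff_liftVec {n : WithTop ℕ∞} : ContDiff ℝ n liftVec := by
  have h0 : ContDiff ℝ n fun y : E3 => √(1 + ‖y‖ ^ 2) :=
    (contDiff_const.add (contDiff_norm_sq ℝ)).sqrt fun y => by positivity
  rw [contDiff_piLp]
  intro i
  fin_cases i
  · exact h0
  · exact contDiff_piLp_apply (𝕜 := ℝ) (p := 2) (i := (0 : Fin 3))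
  · exact contDiff_piLp_apply (𝕜 := ℝ) (p := 2) (i := (1 : Fin 3))
  · exact contDiff_piLp_apply (𝕜 := ℝ) (p := 2) (i := (2 : Fin 3))

/-- Hyperbolic space is homeomorphic to Euclidean space, by the spatial coordinates. -/
def spatialHomeo : H3 ≃ₜ E3 where
  toFun x := spatial x.1
  invFun y := ⟨liftVec y, liftVec_mem y⟩
  left_inv x := Subtype.ext (liftVec_spatial x)
  right_inv y := spatial_liftVec y
  continuous_toFun := by fun_prop
  continuous_invFun := (contDiff_liftVec (n := 0)).continuous.subtype_mk _

theorem isCompact_coord_le (R : ℝ) : IsCompact {x : H3 | x.1 0 ≤ R} := by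
  have h : IsCompact (spatialHomeo ⁻¹' Metric.closedBall 0 R) :=
    spatialHomeo.isCompact_preimage.2 (isCompact_closedBall _ _)
  refine h.of_isClosed_subset (isClosed_le (by fun_prop) continuous_const) fun x hx => ?_
  rw [Set.mem_preimage, mem_closedBall_zero_iff]
  exact (spatial_lt x).le.trans hx

theorem isCompact_neg_mink_le (x : H3) (c : ℝ) : IsCompact {y : H3 | -mink y.1 x.1 ≤ c} := by
  refine (isCompact_coord_le (2 * x.1 0 * c)).of_isClosed_subset
    (isClosed_le (Continuous.mink (by fun_prop) (by fun_prop)).neg continuous_const) fun y hy => ?_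
  rw [Set.mem_ofPred_eq] at hy ⊢
  rw [mink_comm] at hy
  have := x.2.2
  exact (coord_le x y).trans (by gcongr)

instance : LocallyConnectedSpace H3 := spatialHomeo.locallyConnectedSpace

instance : ConnectedSpace H3 := by
  have := spatialHomeo.symm.surjective.connectedSpace spatialHomeo.symm.continuous
  exact this

end Minkowski

/-! ### Decomposition of Minkowski space along a surface -/

section Frames

/-- The vectors `q, N` together with the image of `D` span Minkowski space. -/
theorem exists_decomposition (q : H3) {N : Mink} (hqN : mink q.1 N = 0) (hN : mink N N = 1)
    {D : Plane →L[ℝ] Mink} (hD : Function.Injective D) (hqD : ∀ v, mink q.1 (D v) = 0)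
    (hDN : ∀ v, mink (D v) N = 0) (w : Mink) :
    ∃ v, w = -mink q.1 w • q.1 + mink N w • N + D v := by
  let L : (ℝ × ℝ × Plane) →ₗ[ℝ] Mink :=
    { toFun := fun p => p.1 • q.1 + p.2.1 • N + D p.2.2
      map_add' := fun a b => by simp only [Prod.fst_add, Prod.snd_add, map_add, add_smul]; abel
      map_smul' := fun c a => by
        simp only [Prod.smul_fst, Prod.smul_snd, map_smul, smul_eq_mul, mul_smul, smul_add,
          RingHom.id_apply] }
  have hLq : ∀ p, mink q.1 (L p) = -p.1 := by
    intro p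
    change mink q.1 (p.1 • q.1 + p.2.1 • N + D p.2.2) = _
    simp only [mink_add_right, mink_smul_right, q.2.1, hqN, hqD]
    ring
  have hLN : ∀ p, mink N (L p) = p.2.1 := by
    intro p
    change mink N (p.1 • q.1 + p.2.1 • N + D p.2.2) = _
    have hNq : mink N q.1 = 0 := by rw [mink_comm, hqN]
    have hND : ∀ v, mink N (D v) = 0 := fun v => by rw [mink_comm, hDN]
    simp only [mink_add_right, mink_smul_right, hN, hNq, hND]
    ring
  have hinj : Function.Injective L := by
    rw [← LinearMap.ker_eq_bot, LinearMap.ker_eq_bot']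
    rintro ⟨a, b, v⟩ h
    have h1 := hLq ⟨a, b, v⟩
    have h2 := hLN ⟨a, b, v⟩
    rw [h] at h1 h2
    have ha : a = 0 := by simpa [mink] using h1
    have hb : b = 0 := by simpa [mink] using h2.symm
    subst ha hb
    have h3 : D v = 0 := by
      have : L (0, 0, v) = (0 : ℝ) • q.1 + (0 : ℝ) • N + D v := rfl
      rw [h] at this
      simpa using this.symm
    have hv : v = 0 := hD (by rw [h3, map_zero])
    rw [hv]
    rfl
  have hsurj : Function.Surjective L := by
    refine (LinearMap.injective_iff_surjective_of_finrank_eq_finrank ?_).1 hinj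
    simp
  obtain ⟨⟨a, b, v⟩, rfl⟩ := hsurj w
  refine ⟨v, ?_⟩
  rw [hLq, hLN, neg_neg]
  rfl

/-- A vector orthogonal to the image of `D` is a combination of `q` and `N`. -/
theorem eq_of_orthogonal (q : H3) {N : Mink} (hqN : mink q.1 N = 0) (hN : mink N N = 1)
    {D : Plane →L[ℝ] Mink} (hD : Function.Injective D) (hqD : ∀ v, mink q.1 (D v) = 0)
    (hDN : ∀ v, mink (D v) N = 0) {w : Mink} (hw : ∀ v, mink (D v) w = 0) :
    w = -mink q.1 w • q.1 + mink N w • N := by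
  obtain ⟨v, hv⟩ := exists_decomposition q hqN hN hD hqD hDN w
  have h1 : mink (D v) (D v) = 0 := by
    have := hw v
    rw [hv] at this
    simpa only [mink_add_right, mink_smul_right, hDN, mink_comm (D v) q.1, hqD, mul_zero,
      zero_add] using this
  have h2 : D v = 0 := by
    by_contra h
    exact (mink_self_pos q (hqD v) h).ne' h1
  rw [h2, add_zero] at hv
  exact hv

end Frames

/-! ### Invariance of the Minkowski form under the group -/

section Isometries

/-- The linear action of `SL(2, ℂ)` on Minkowski space. -/
def lorentz (g : SL2C) : Mink →ₗ[ℝ] Mink where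
  toFun x := ofHerm ((g : Matrix (Fin 2) (Fin 2) ℂ) * toHerm x *
    (g : Matrix (Fin 2) (Fin 2) ℂ)ᴴ)
  map_add' x y := by
    have h : toHerm (x + y) = toHerm x + toHerm y := by
      ext i j
      fin_cases i <;> fin_cases j <;> simp [toHerm] <;> ring
    rw [h, mul_add, add_mul]
    ext i
    fin_cases i <;> simp [ofHerm] <;> ring
  map_smul' c x := by
    have h : toHerm (c • x) = (c : ℂ) • toHerm x := by
      ext i j
      fin_cases i <;> fin_cases j <;> simp [toHerm] <;> ring
    rw [h, Matrix.mul_smul, Matrix.smul_mul]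
    ext i
    fin_cases i <;> simp [ofHerm] <;> ring

theorem mink_lorentz_self (g : SL2C) (x : Mink) :
    mink (lorentz g x) (lorentz g x) = mink x x := by
  have hH : ((g : Matrix (Fin 2) (Fin 2) ℂ) * toHerm x *
      (g : Matrix (Fin 2) (Fin 2) ℂ)ᴴ).IsHermitian :=
    Matrix.isHermitian_mul_mul_conjTranspose _ (toHerm_isHermitian x)
  have h := det_toHerm (lorentz g x)
  change (toHerm (ofHerm _)).det = _ at h
  rw [toHerm_ofHerm hH, Matrix.det_mul, Matrix.det_mul, Matrix.det_conjTranspose, det_toHerm] at h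
  simp only [Matrix.SpecialLinearGroup.det_coe, one_mul, star_one, mul_one] at h
  have := Complex.ofReal_injective h
  linarith

theorem mink_lorentz (g : SL2C) (x y : Mink) : mink (lorentz g x) (lorentz g y) = mink x y := by
  have h := mink_lorentz_self g (x + y)
  rw [map_add] at h
  simp only [mink_add_left, mink_add_right, mink_lorentz_self] at h
  rw [mink_comm (lorentz g y) (lorentz g x), mink_comm y x] at h
  linarith

theorem mink_smul_smul (g : PSL2C) (x y : H3) :
    mink (g • x : H3).1 (g • y : H3).1 = mink x.1 y.1 := by
  induction g using QuotientGroup.induction_on with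
  | H g => exact mink_lorentz g x.1 y.1

theorem continuous_smul_H3 (g : PSL2C) : Continuous fun x : H3 => g • x := by
  induction g using QuotientGroup.induction_on with
  | H g =>
    refine Continuous.subtype_mk (f := fun x : H3 => lorentz g x.1) ?_ _
    exact (lorentz g).continuous_of_finiteDimensional.comp continuous_subtype_val

instance (Γ : Subgroup PSL2C) : ContinuousConstSMul Γ H3 :=
  ⟨fun γ => continuous_smul_H3 γ.1⟩

end Isometries

/-! ### Connected components of open sets -/

section Components

variable {X : Type*} [TopologicalSpace X] {A C D : Set X}

theorem IsComponent.subset (h : IsComponent A C) : C ⊆ A := by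
  obtain ⟨x, -, rfl⟩ := h
  exact connectedComponentIn_subset _ _

theorem IsComponent.nonempty (h : IsComponent A C) : C.Nonempty := by
  obtain ⟨x, hx, rfl⟩ := h
  exact ⟨x, mem_connectedComponentIn hx⟩

theorem IsComponent.isPreconnected (h : IsComponent A C) : IsPreconnected C := by
  obtain ⟨x, -, rfl⟩ := h
  exact isPreconnected_connectedComponentIn

theorem IsComponent.isOpen [LocallyConnectedSpace X] (h : IsComponent A C) (hA : IsOpen A) :
    IsOpen C := by
  obtain ⟨x, -, rfl⟩ := h
  exact hA.connectedComponentIn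

theorem IsComponent.subset_of_inter (h : IsComponent A C) (hD : IsPreconnected D) (hDA : D ⊆ A)
    (hne : (D ∩ C).Nonempty) : D ⊆ C := by
  obtain ⟨x, -, rfl⟩ := h
  obtain ⟨y, hyD, hyC⟩ := hne
  rw [connectedComponentIn_eq hyC]
  exact hD.subset_connectedComponentIn hyD hDA

theorem IsComponent.eq_of_inter (h : IsComponent A C) (h' : IsComponent A D)
    (hne : (D ∩ C).Nonempty) : C = D :=
  (h'.subset_of_inter h.isPreconnected h.subset (Set.inter_comm D C ▸ hne)).antisymm
    (h.subset_of_inter h'.isPreconnected h'.subset hne)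

theorem IsComponent.disjoint (h : IsComponent A C) (h' : IsComponent A D) (hne : C ≠ D) :
    Disjoint C D := by
  rw [Set.disjoint_iff_inter_eq_empty]
  by_contra hcon
  exact hne (h.eq_of_inter h' (Set.inter_comm C D ▸ Set.nonempty_iff_ne_empty.2 hcon))

theorem IsComponent.mem_of_mem_closure [LocallyConnectedSpace X] (h : IsComponent A C)
    (hA : IsOpen A) {x : X} (hx : x ∈ closure C) (hxA : x ∈ A) : x ∈ C := by
  have h' : IsComponent A (connectedComponentIn A x) := ⟨x, hxA, rfl⟩
  have hxm := mem_connectedComponentIn hxA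
  have hne := mem_closure_iff.1 hx _ (h'.isOpen hA) hxm
  rwa [h.eq_of_inter h' hne]

end Components

/-! ### Invariant sets with compact quotient -/

section Cocompact

/-- A closed `Γ`-invariant set with compact quotient. -/
structure IsCocompactSet (Γ : Subgroup PSL2C) (T : Set H3) : Prop where
  isClosed : IsClosed T
  smul_mem : ∀ γ : Γ, ∀ x ∈ T, γ • x ∈ T
  exists_compact : ∃ K, IsCompact K ∧ ∀ x ∈ T, ∃ γ : Γ, γ • x ∈ K

theorem continuous_proj (Γ : Subgroup PSL2C) : Continuous (proj Γ) := continuous_quotient_mk'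

theorem isOpenMap_proj (Γ : Subgroup PSL2C) : IsOpenMap (proj Γ) :=
  isOpenMap_quotient_mk'_mul (Γ := Γ) (T := H3)

theorem surjective_proj (Γ : Subgroup PSL2C) : Function.Surjective (proj Γ) :=
  Quotient.mk_surjective

theorem proj_smul (Γ : Subgroup PSL2C) (γ : Γ) (x : H3) : proj Γ (γ • x) = proj Γ x :=
  Quotient.sound ⟨γ, rfl⟩

theorem exists_smul_eq_of_proj_eq (Γ : Subgroup PSL2C) {x y : H3} (h : proj Γ x = proj Γ y) :
    ∃ γ : Γ, γ • y = x :=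
  Quotient.exact h

/-- The projections of the open sets `{x₀ < R}` cover the compact set `S`; a finite subcover lifts
to a compact set meeting every orbit in the preimage. -/
theorem isCocompactSet_preimage (Γ : Subgroup PSL2C) {S : Set (Quot3 Γ)} (hS : IsCompact S)
    (hcl : IsClosed S) : IsCocompactSet Γ (proj Γ ⁻¹' S) where
  isClosed := hcl.preimage (continuous_proj Γ)
  smul_mem γ x hx := by
    rw [Set.mem_preimage, proj_smul]
    exact hx
  exists_compact := by
    obtain ⟨t, ht⟩ := hS.elim_finite_subcover
      (fun R : ℝ => proj Γ '' {x : H3 | x.1 0 < R})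
      (fun R => isOpenMap_proj Γ _ (isOpen_lt (by fun_prop) continuous_const)) (by
        intro s _
        obtain ⟨x, rfl⟩ := surjective_proj Γ s
        exact Set.mem_iUnion.2 ⟨x.1 0 + 1, x, lt_add_one (x.1 0), rfl⟩)
    refine ⟨⋃ R ∈ t, {x : H3 | x.1 0 ≤ R}, t.isCompact_biUnion fun R _ => isCompact_coord_le R, ?_⟩
    intro x hx
    obtain ⟨R, hR, y, hy, hxy⟩ := Set.mem_iUnion₂.1 (ht hx)
    obtain ⟨γ, rfl⟩ := exists_smul_eq_of_proj_eq Γ hxy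
    exact ⟨γ, Set.mem_iUnion₂.2 ⟨R, hR, le_of_lt (show (γ • x : H3).1 0 < R from hy)⟩⟩

theorem IsFiberSurface.isCocompactSet {F : Type*} [TopologicalSpace F] [T2Space F]
    [CompactSpace F] {Γ : Subgroup PSL2C} {Φ : F × ℝ ≃ₜ Quot3 Γ} {S : Set (Quot3 Γ)}
    (h : IsFiberSurface Γ Φ S) : IsCocompactSet Γ (proj Γ ⁻¹' S) := by
  obtain ⟨j, -, rfl, -⟩ := h.homotopic
  have : T2Space (Quot3 Γ) := Φ.symm.isEmbedding.t2Space
  have hc : IsCompact (Set.range j) := isCompact_range j.continuous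
  exact isCocompactSet_preimage Γ hc hc.isClosed

theorem IsFiberSurface.nonempty {F : Type*} [TopologicalSpace F] [ConnectedSpace F]
    {Γ : Subgroup PSL2C} {Φ : F × ℝ ≃ₜ Quot3 Γ} {S : Set (Quot3 Γ)}
    (h : IsFiberSurface Γ Φ S) : (proj Γ ⁻¹' S).Nonempty := by
  obtain ⟨j, -, rfl, -⟩ := h.homotopic
  obtain ⟨x, hx⟩ := surjective_proj Γ (j (Classical.arbitrary F))
  exact ⟨x, _, hx.symm⟩

theorem mink_smul_smul_coe {Γ : Subgroup PSL2C} (γ : Γ) (x y : H3) :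
    mink (γ • x : H3).1 (γ • y : H3).1 = mink x.1 y.1 :=
  mink_smul_smul γ.1 x y

end Cocompact

/-! ### Behaviour near the sphere at infinity, in the Klein model -/

section Infinity

theorem klein_eq (x : H3) : klein x = (x.1 0)⁻¹ • spatial x.1 := by
  ext i
  fin_cases i <;> simp [klein, spatial_apply] <;> ring

theorem inner_klein (x y : H3) :
    inner ℝ (klein x) (klein y) = 1 + mink x.1 y.1 / (x.1 0 * y.1 0) := by
  rw [klein_eq, klein_eq, real_inner_smul_left, real_inner_smul_right, inner_spatial]
  have := x.2.2
  have := y.2.2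
  field_simp
  ring

theorem norm_sq_klein (x : H3) : ‖klein x‖ ^ 2 = 1 - ((x.1 0)⁻¹) ^ 2 := by
  rw [← real_inner_self_eq_norm_sq, inner_klein, x.2.1]
  have := x.2.2
  field_simp
  ring

theorem norm_klein_lt_one (x : H3) : ‖klein x‖ < 1 := by
  have h := norm_sq_klein x
  have : 0 < ((x.1 0)⁻¹) ^ 2 := by have := x.2.2; positivity
  nlinarith [norm_nonneg (klein x)]

/-- The part of hyperbolic space near a point at infinity. -/
def nearInfinity (ω : Bdry) (r : ℝ) : Set H3 := klein ⁻¹' Metric.ball (ω : E3) r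

theorem norm_bdry (ω : Bdry) : ‖(ω : E3)‖ = 1 := by
  simp

theorem inv_coord_sq_le {ω : Bdry} {r : ℝ} {x : H3} (hx : x ∈ nearInfinity ω r) :
    ((x.1 0)⁻¹) ^ 2 ≤ 2 * r := by
  have h1 : ‖klein x - ω‖ < r := by simpa [nearInfinity, dist_eq_norm] using hx
  have h2 : ‖(ω : E3)‖ - ‖klein x‖ ≤ ‖klein x - ω‖ := by
    rw [norm_sub_rev]; exact norm_sub_norm_le _ _
  rw [norm_bdry] at h2
  have h3 := norm_sq_klein x
  nlinarith [norm_klein_lt_one x, norm_nonneg (klein x)]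

/-- Relates the two geometries: pairs at bounded hyperbolic distance become Euclidean-close near the
sphere, whereas pairs kept apart in the Euclidean sense become hyperbolically far. -/
theorem norm_klein_sub_sq_le (x y : H3) :
    ‖klein x - klein y‖ ^ 2 ≤ 2 * -mink x.1 y.1 / (x.1 0 * y.1 0) := by
  rw [norm_sub_sq_real, inner_klein]
  have h1 : ‖klein x‖ ^ 2 ≤ 1 := by rw [norm_sq_klein]; linarith [sq_nonneg (x.1 0)⁻¹]
  have h2 : ‖klein y‖ ^ 2 ≤ 1 := by rw [norm_sq_klein]; linarith [sq_nonneg (y.1 0)⁻¹]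
  have h3 : 2 * -mink x.1 y.1 / (x.1 0 * y.1 0) = -2 * (mink x.1 y.1 / (x.1 0 * y.1 0)) := by ring
  rw [h3]
  linarith

theorem norm_klein_sub_sq_ge (x y : H3) :
    ‖klein x - klein y‖ ^ 2 * (x.1 0 * y.1 0) ≤ 2 * -mink x.1 y.1 := by
  have h := norm_klein_sub_sq_le x y
  rwa [le_div_iff₀ (mul_pos x.2.2 y.2.2)] at h

/-- By cocompactness each point of `T` is within a bounded distance of an orbit point of `o`. Points
of `T` tending to `ω` would drag orbit points with them, making `ω` a limit point. -/
theorem IsCocompactSet.exists_nearInfinity_disjoint {Γ : Subgroup PSL2C} {T : Set H3}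
    (hT : IsCocompactSet Γ T) {ω : Bdry} (hω : ω ∉ limitSet Γ) :
    ∃ r > 0, Disjoint (nearInfinity ω r) T := by
  let o : H3 := spatialHomeo.symm 0
  have hacc : ¬AccPt (ω : E3) (𝓟 (klein '' MulAction.orbit Γ o)) := fun h => hω ⟨o, h⟩
  rw [accPt_iff_nhds] at hacc
  push Not at hacc
  obtain ⟨U, hU, hUC⟩ := hacc
  obtain ⟨ε, hε, hεU⟩ := Metric.mem_nhds_iff.1 hU
  obtain ⟨K, hK, hKT⟩ := hT.exists_compact
  obtain ⟨C, hC⟩ : ∃ C, ∀ k ∈ K, -mink o.1 k.1 ≤ C := by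
    obtain ⟨C, hC⟩ := hK.bddAbove_image (f := fun k : H3 => -mink o.1 k.1)
      (Continuous.mink continuous_const continuous_subtype_val).neg.continuousOn
    exact ⟨C, fun k hk => hC ⟨k, hk, rfl⟩⟩
  -- Chosen so that `2 |C| s < (ε / 2)²`; the radius `s ^ 2 / 2` below forces `y₀⁻¹ ≤ s`.
  let s : ℝ := ε ^ 2 / (8 * (|C| + 1))
  have hs : 0 < s := by positivity
  have hsC : s * (8 * (|C| + 1)) = ε ^ 2 := by simp only [s]; field_simp
  refine ⟨min (ε / 2) (s ^ 2 / 2), by positivity, ?_⟩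
  rw [Set.disjoint_left]
  intro y hy hyT
  obtain ⟨γ, hγ⟩ := hKT y hyT
  let z : H3 := γ⁻¹ • o
  have hz : klein z ∉ U := by
    intro h
    have h1 := hUC _ ⟨h, z, ⟨γ⁻¹, rfl⟩, rfl⟩
    have := norm_klein_lt_one z
    rw [h1, norm_bdry] at this
    exact lt_irrefl _ this
  have hzy : -mink y.1 z.1 ≤ C := by
    have h1 := mink_smul_smul_coe γ y z
    rw [show γ • z = o from smul_inv_smul γ o] at h1
    rw [← h1, mink_comm]
    exact hC _ hγ
  have hys : (y.1 0)⁻¹ ≤ s := by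
    have h1 := inv_coord_sq_le hy
    have h2 := min_le_right (ε / 2) (s ^ 2 / 2)
    exact le_of_sq_le_sq (by linarith) hs.le
  have h1 := norm_klein_sub_sq_le y z
  have h2 : 2 * -mink y.1 z.1 / (y.1 0 * z.1 0) ≤ 2 * |C| * s := by
    have hz1 : (z.1 0)⁻¹ ≤ 1 := inv_le_one_of_one_le₀ (one_le_coord z)
    have hz0 := inv_pos.2 z.2.2
    have hy0 := inv_pos.2 y.2.2
    rw [div_eq_mul_inv, mul_inv]
    have h3 : (y.1 0)⁻¹ * (z.1 0)⁻¹ ≤ s * 1 := mul_le_mul hys hz1 hz0.le hs.le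
    have h4 : 2 * -mink y.1 z.1 ≤ 2 * |C| := by linarith [le_abs_self C]
    calc _ ≤ 2 * |C| * (s * 1) := mul_le_mul h4 h3 (by positivity) (by positivity)
      _ = _ := by ring
  have h3 : ‖klein y - klein z‖ < ε / 2 := by
    refine lt_of_pow_lt_pow_left₀ 2 (by positivity) ?_
    nlinarith [abs_nonneg C]
  have h4 : ‖klein y - ω‖ < ε / 2 := by
    have : dist (klein y) ω < min (ε / 2) (s ^ 2 / 2) := hy
    rw [dist_eq_norm] at this
    exact this.trans_le (min_le_left _ _)
  refine hz (hεU ?_)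
  rw [Metric.mem_ball, dist_eq_norm]
  have h5 := norm_sub_le_norm_sub_add_norm_sub (klein z) (klein y) (ω : E3)
  rw [norm_sub_rev (klein z) (klein y)] at h5
  linarith

/-- In the Klein model this is the intersection of two Euclidean balls, hence convex; `g` is the
inverse of the model map. -/
theorem isPreconnected_nearInfinity (ω : Bdry) (r : ℝ) : IsPreconnected (nearInfinity ω r) := by
  let g : E3 → H3 := fun k => spatialHomeo.symm ((√(1 - ‖k‖ ^ 2))⁻¹ • k)
  have hpos : ∀ k ∈ Metric.ball (0 : E3) 1, 0 < √(1 - ‖k‖ ^ 2) := by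
    intro k hk
    rw [mem_ball_zero_iff] at hk
    exact Real.sqrt_pos.2 (by nlinarith [norm_nonneg k])
  have hg : ContinuousOn g (Metric.ball 0 1) := by
    have h : ContinuousOn (fun k : E3 => (√(1 - ‖k‖ ^ 2))⁻¹) (Metric.ball 0 1) :=
      ContinuousOn.inv₀ (by fun_prop) fun k hk => (hpos k hk).ne'
    exact spatialHomeo.symm.continuous.comp_continuousOn
      (f := fun k : E3 => (√(1 - ‖k‖ ^ 2))⁻¹ • k) (h.smul continuousOn_id)
  have hleft : ∀ x, g (klein x) = x := by
    intro x
    have h1 : √(1 - ‖klein x‖ ^ 2) = (x.1 0)⁻¹ := by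
      rw [norm_sq_klein, sub_sub_cancel, Real.sqrt_sq (inv_nonneg.2 x.2.2.le)]
    simp only [g]
    rw [h1, inv_inv, klein_eq, smul_smul, mul_inv_cancel₀ x.2.2.ne', one_smul]
    exact spatialHomeo.symm_apply_apply x
  have hright : ∀ k ∈ Metric.ball (0 : E3) 1, klein (g k) = k := by
    intro k hk
    have h0 := hpos k hk
    have hsq : √(1 - ‖k‖ ^ 2) ^ 2 = 1 - ‖k‖ ^ 2 := Real.sq_sqrt (Real.sqrt_pos.1 h0).le
    have hsp : spatial (g k).1 = (√(1 - ‖k‖ ^ 2))⁻¹ • k := spatialHomeo.apply_symm_apply _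
    have h1 : (g k).1 0 = (√(1 - ‖k‖ ^ 2))⁻¹ := by
      have h2 := norm_sq_spatial (g k)
      rw [hsp, norm_smul, mul_pow, norm_inv, Real.norm_of_nonneg h0.le] at h2
      refine (sq_eq_sq₀ (g k).2.2.le (inv_pos.2 h0).le).1 ?_
      have h3 : (√(1 - ‖k‖ ^ 2))⁻¹ ^ 2 * (1 - ‖k‖ ^ 2) = 1 := by
        rw [inv_pow, hsq]
        exact inv_mul_cancel₀ (Real.sqrt_pos.1 h0).ne'
      linarith
    rw [klein_eq, h1, inv_inv, hsp, smul_smul, mul_inv_cancel₀ h0.ne', one_smul]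
  have heq : nearInfinity ω r = g '' (Metric.ball (ω : E3) r ∩ Metric.ball 0 1) := by
    ext x
    constructor
    · intro hx
      exact ⟨klein x, ⟨hx, by simpa using norm_klein_lt_one x⟩, hleft x⟩
    · rintro ⟨k, ⟨hk, hk1⟩, rfl⟩
      change klein (g k) ∈ Metric.ball (ω : E3) r
      rwa [hright k hk1]
  rw [heq]
  exact ((convex_ball _ _).inter (convex_ball _ _)).isPreconnected.image _
    (hg.mono Set.inter_subset_right)

theorem nearInfinity_mono (ω : Bdry) {r s : ℝ} (h : r ≤ s) :
    nearInfinity ω r ⊆ nearInfinity ω s :=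
  Set.preimage_mono (Metric.ball_subset_ball h)

theorem ClosureContains.exists_mem {C : Set H3} {Ω : Set Bdry} (h : ClosureContains C Ω)
    {ω : Bdry} (hω : ω ∈ Ω) {r : ℝ} (hr : 0 < r) : (nearInfinity ω r ∩ C).Nonempty := by
  obtain ⟨_, hb, y, hy, rfl⟩ := mem_closure_iff.1 (h ⟨ω, hω, rfl⟩) _ Metric.isOpen_ball
    (Metric.mem_ball_self hr)
  exact ⟨y, hb, hy⟩

theorem nearInfinity_subset {T C : Set H3} {Ω : Set Bdry} (hC : IsComponent Tᶜ C)
    (hΩ : ClosureContains C Ω) {ω : Bdry} (hω : ω ∈ Ω) {r : ℝ} (hr : 0 < r)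
    (hdis : Disjoint (nearInfinity ω r) T) : nearInfinity ω r ⊆ C :=
  hC.subset_of_inter (isPreconnected_nearInfinity ω r) hdis.subset_compl_right
    (hΩ.exists_mem hω hr)

/-- Points of hyperbolic space near a point at infinity which is not in the closure of `T` are far
from `T`. -/
theorem exists_nearInfinity_far {T : Set H3} {ω : Bdry} {r : ℝ} (hr : 0 < r)
    (hdis : Disjoint (nearInfinity ω r) T) (c : ℝ) :
    ∃ s > 0, s ≤ r ∧ ∀ z ∈ nearInfinity ω s, ∀ a ∈ T, c < -mink z.1 a.1 := by
  -- Near `ω` one gets `ρ z₀ ≥ 1`, while the Klein distance from `z` to `T` exceeds `r / 2`; with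
  -- this `ρ` the bound `(r / 2)² z₀ < 2 · (-⟨z, a⟩)` gives more than `|c| + 1`.
  let ρ : ℝ := r ^ 2 / (8 * (|c| + 1))
  have hρ : 0 < ρ := by positivity
  have hρc : ρ * (8 * (|c| + 1)) = r ^ 2 := by simp only [ρ]; field_simp
  refine ⟨min (r / 2) (ρ ^ 2 / 2), by positivity, (min_le_left _ _).trans (by linarith), ?_⟩
  intro z hz a ha
  have h1 : (z.1 0)⁻¹ ≤ ρ := by
    have h1 := inv_coord_sq_le hz
    have h2 := min_le_right (r / 2) (ρ ^ 2 / 2)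
    exact le_of_sq_le_sq (by linarith) hρ.le
  have h2 : ‖klein z - ω‖ < r / 2 := by
    have : dist (klein z) ω < min (r / 2) (ρ ^ 2 / 2) := hz
    rw [dist_eq_norm] at this
    exact this.trans_le (min_le_left _ _)
  have h3 : r ≤ ‖klein a - ω‖ := by
    by_contra h
    refine Set.disjoint_right.1 hdis ha ?_
    change dist _ _ < _
    rw [dist_eq_norm]
    exact not_le.1 h
  have h4 := norm_sub_le_norm_sub_add_norm_sub (klein a) (klein z) (ω : E3)
  rw [norm_sub_rev (klein a) (klein z)] at h4
  have h5 : r / 2 < ‖klein z - klein a‖ := by linarith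
  have h6 := norm_klein_sub_sq_ge z a
  have h7 : 1 ≤ ρ * z.1 0 := by
    have := mul_le_mul_of_nonneg_right h1 z.2.2.le
    rwa [inv_mul_cancel₀ z.2.2.ne'] at this
  have h8 : z.1 0 ≤ z.1 0 * a.1 0 := le_mul_of_one_le_right z.2.2.le (one_le_coord a)
  have h9 : (r / 2) ^ 2 < ‖klein z - klein a‖ ^ 2 := by gcongr
  have h10 : (r / 2) ^ 2 * z.1 0 < 2 * -mink z.1 a.1 := by
    have := z.2.2
    calc (r / 2) ^ 2 * z.1 0 < ‖klein z - klein a‖ ^ 2 * z.1 0 := by gcongr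
      _ ≤ ‖klein z - klein a‖ ^ 2 * (z.1 0 * a.1 0) := by gcongr
      _ ≤ _ := h6
  have h11 : (r / 2) ^ 2 * z.1 0 = 2 * (|c| + 1) * (ρ * z.1 0) := by
    rw [div_pow, ← hρc]; ring
  nlinarith [abs_nonneg c, le_abs_self c]

end Infinity

/-! ### Derivative identities for local parametrizations -/

section LocalParam

variable {T : Set H3} {U : Set Plane} {f : Plane → Mink} {u : Plane}

theorem IsLocalParam.exists_mem (h : IsLocalParam T U f) (hu : u ∈ U) :
    ∃ x ∈ T, f u = (x : H3).1 := by
  obtain ⟨V, -, hV⟩ := h.image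
  have : f u ∈ (fun x : H3 => (x : Mink)) '' T ∩ V := hV ▸ Set.mem_image_of_mem f hu
  obtain ⟨⟨x, hx, hxu⟩, -⟩ := this
  exact ⟨x, hx, hxu.symm⟩

theorem IsLocalParam.contDiffAt (h : IsLocalParam T U f) (hu : u ∈ U) : ContDiffAt ℝ 2 f u :=
  h.contDiffOn.contDiffAt (h.isOpen.mem_nhds hu)

theorem IsLocalParam.hasFDerivAt (h : IsLocalParam T U f) (hu : u ∈ U) :
    HasFDerivAt f (fderiv ℝ f u) u :=
  ((h.contDiffAt hu).differentiableAt (by norm_num)).hasFDerivAt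

theorem IsLocalParam.hasFDerivAt_fderiv (h : IsLocalParam T U f) (hu : u ∈ U) :
    HasFDerivAt (fderiv ℝ f) (fderiv ℝ (fderiv ℝ f) u) u :=
  (((h.contDiffAt hu).fderiv_right (m := 1) (by norm_num)).differentiableAt
    (by norm_num)).hasFDerivAt

theorem IsLocalParam.eventually_mem (h : IsLocalParam T U f) (hu : u ∈ U) : ∀ᶠ v in 𝓝 u, v ∈ U :=
  h.isOpen.mem_nhds hu

theorem IsLocalParam.mink_self (h : IsLocalParam T U f) (hu : u ∈ U) : mink (f u) (f u) = -1 := by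
  obtain ⟨x, -, hx⟩ := h.exists_mem hu
  rw [hx, x.2.1]

theorem IsLocalParam.mink_fderiv (h : IsLocalParam T U f) (hu : u ∈ U) (v : Plane) :
    mink (f u) (fderiv ℝ f u v) = 0 := by
  have h1 := minkL.hasFDerivAt_of_bilinear (h.hasFDerivAt hu) (h.hasFDerivAt hu)
  have h2 : HasFDerivAt (fun y => minkL (f y) (f y)) (0 : Plane →L[ℝ] ℝ) u :=
    (hasFDerivAt_const (-1 : ℝ) u).congr_of_eventuallyEq
      ((h.eventually_mem hu).mono fun y hy => h.mink_self hy)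
  have h3 : mink (f u) (fderiv ℝ f u v) + mink (fderiv ℝ f u v) (f u) = 0 :=
    congrArg (fun L : Plane →L[ℝ] ℝ => L v) (h1.unique h2)
  rw [mink_comm (fderiv ℝ f u v)] at h3
  linarith

/-- Differentiation of `⟨f, df w⟩ = 0`. This is the position component of the second derivative,
responsible for the first fundamental form in the Hessian of the distance. -/
theorem IsLocalParam.mink_fderiv_fderiv (h : IsLocalParam T U f) (hu : u ∈ U) (v w : Plane) :
    mink (f u) (fderiv ℝ (fderiv ℝ f) u v w) = -mink (fderiv ℝ f u v) (fderiv ℝ f u w) := by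
  have h0 : HasFDerivAt (fun y => fderiv ℝ f y w)
      ((fderiv ℝ (fderiv ℝ f) u).flip w) u := by
    simpa using (h.hasFDerivAt_fderiv hu).clm_apply (hasFDerivAt_const w u)
  have h1 := minkL.hasFDerivAt_of_bilinear (h.hasFDerivAt hu) h0
  have h2 : HasFDerivAt (fun y => minkL (f y) (fderiv ℝ f y w)) (0 : Plane →L[ℝ] ℝ) u :=
    (hasFDerivAt_const (0 : ℝ) u).congr_of_eventuallyEq
      ((h.eventually_mem hu).mono fun y hy => h.mink_fderiv hy w)
  have h3 : mink (f u) (fderiv ℝ (fderiv ℝ f) u v w) +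
      mink (fderiv ℝ f u v) (fderiv ℝ f u w) = 0 :=
    congrArg (fun L : Plane →L[ℝ] ℝ => L v) (h1.unique h2)
  linarith

theorem IsLocalParam.fderiv_fderiv_comm (h : IsLocalParam T U f) (hu : u ∈ U) (v w : Plane) :
    fderiv ℝ (fderiv ℝ f) u v w = fderiv ℝ (fderiv ℝ f) u w v :=
  ((h.contDiffAt hu).isSymmSndFDerivAt (by simp)) v w

end LocalParam

/-! ### Fundamental forms and principal curvatures -/

section Curvature

/-- If the eigenvalues of the pencil of two binary quadratic forms, the first one positive definite,
are less than one, then the second form is less than the first one. -/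
theorem form_lt_of_pencil {E F G l m n : ℝ} (hE : 0 < E) (hdet : 0 < E * G - F ^ 2)
    (hroot : ∀ k, (k * E - l) * (k * G - n) - (k * F - m) ^ 2 = 0 → k < 1) {a b : ℝ}
    (hab : a ≠ 0 ∨ b ≠ 0) :
    l * a ^ 2 + 2 * m * (a * b) + n * b ^ 2 < E * a ^ 2 + 2 * F * (a * b) + G * b ^ 2 := by
  have hpos : ∀ k, 1 ≤ k → 0 < (k * E - l) * (k * G - n) - (k * F - m) ^ 2 := by
    intro k hk
    by_contra hneg
    rw [not_lt] at hneg
    set α := E * G - F ^ 2 with hα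
    set β := -(E * n + G * l) + 2 * F * m with hβ
    set γ := l * n - m ^ 2 with hγ
    -- At `K` the polynomial `α K² + β K + γ` is positive, because `α K` dominates `|β| + |γ|` and
    -- `K ≥ 1`. A nonpositive value at `k` would produce a root in `[k, K]`.
    set K := k + (|β| + |γ|) / α + 1 with hK
    have hKk : k ≤ K := by
      have : 0 ≤ (|β| + |γ|) / α := by positivity
      linarith
    have hαK : α * K = α * k + (|β| + |γ|) + α := by
      rw [hK]; field_simp
    have hKpos : 0 < (K * E - l) * (K * G - n) - (K * F - m) ^ 2 := by
      have e : (K * E - l) * (K * G - n) - (K * F - m) ^ 2 = (α * K) * K + β * K + γ := by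
        rw [hα, hβ, hγ]; ring
      rw [e, hαK]
      have hK1 : 1 ≤ K := hk.trans hKk
      have h1 : 0 ≤ (|β| + β) * K := mul_nonneg (by linarith [neg_abs_le β]) (by linarith)
      have h2 : 0 ≤ |γ| * K + γ := by nlinarith [neg_abs_le γ, abs_nonneg γ]
      have h3 : 0 < (α * k + α) * K := by positivity
      nlinarith
    obtain ⟨z, hz, hz0⟩ := intermediate_value_Icc hKk
      (f := fun k => (k * E - l) * (k * G - n) - (k * F - m) ^ 2) (by fun_prop)
      ⟨hneg, hKpos.le⟩
    have := hroot z hz0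
    linarith [hz.1]
  have h1 := hpos 1 le_rfl
  have h2 : 0 < E - l := by
    by_contra h
    -- At `k = l / E` the product of diagonal terms vanishes, so the polynomial cannot be positive
    -- there.
    have hk : 1 ≤ l / E := by rw [le_div_iff₀ hE]; linarith
    have h3 := hpos _ hk
    rw [div_mul_cancel₀ _ hE.ne', sub_self, zero_mul] at h3
    nlinarith [sq_nonneg (l / E * F - m)]
  have h3 : 0 < (E - l) * ((E - l) * a ^ 2 + 2 * (F - m) * (a * b) + (G - n) * b ^ 2) := by
    have e : (E - l) * ((E - l) * a ^ 2 + 2 * (F - m) * (a * b) + (G - n) * b ^ 2) =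
        ((E - l) * a + (F - m) * b) ^ 2 +
          ((1 * E - l) * (1 * G - n) - (1 * F - m) ^ 2) * b ^ 2 := by ring
    rw [e]
    by_cases hb : b = 0
    · have ha : a ≠ 0 := hab.resolve_right fun h => h hb
      subst hb
      have : 0 < ((E - l) * a) ^ 2 := by positivity
      simpa using this
    · have : 0 < b ^ 2 := by positivity
      nlinarith [sq_nonneg ((E - l) * a + (F - m) * b), mul_pos h1 this]
  have h4 := pos_of_mul_pos_right h3 h2.le
  linarith

theorem plane_eq (v : Plane) :
    v = v 0 • EuclideanSpace.single 0 1 + v 1 • EuclideanSpace.single 1 1 := by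
  ext i
  fin_cases i <;> simp

theorem quadratic_plane (B : Plane →L[ℝ] Plane →L[ℝ] ℝ) (hB : ∀ v w, B v w = B w v) (v : Plane) :
    B v v = B (EuclideanSpace.single 0 1) (EuclideanSpace.single 0 1) * v 0 ^ 2 +
      2 * B (EuclideanSpace.single 0 1) (EuclideanSpace.single 1 1) * (v 0 * v 1) +
      B (EuclideanSpace.single 1 1) (EuclideanSpace.single 1 1) * v 1 ^ 2 := by
  conv_lhs => rw [plane_eq v]
  simp only [map_add, map_smul, add_apply, smul_apply, smul_eq_mul]
  rw [hB (EuclideanSpace.single 1 1) (EuclideanSpace.single 0 1)]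
  ring

/-- A point of a surface with a unit normal vector and a local parametrization. -/
structure IsFrame (T : Set H3) (x : H3) (N : Mink) (U : Set Plane) (f : Plane → Mink)
    (u : Plane) : Prop where
  param : IsLocalParam T U f
  mem : u ∈ U
  eq : f u = x.1
  normal : IsUnitNormal T x N

/-- The first fundamental form, as a bilinear map. -/
def formI (f : Plane → Mink) (u : Plane) : Plane →L[ℝ] Plane →L[ℝ] ℝ :=
  minkL.bilinearComp (fderiv ℝ f u) (fderiv ℝ f u)

/-- The second fundamental form, as a bilinear map. -/
def formII (f : Plane → Mink) (u : Plane) (N : Mink) : Plane →L[ℝ] Plane →L[ℝ] ℝ :=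
  ((ContinuousLinearMap.compL ℝ Plane Mink ℝ) (minkL.flip N)).comp (fderiv ℝ (fderiv ℝ f) u)

theorem formI_apply (f : Plane → Mink) (u v w : Plane) :
    formI f u v w = mink (fderiv ℝ f u v) (fderiv ℝ f u w) := rfl

theorem formII_apply (f : Plane → Mink) (u : Plane) (N : Mink) (v w : Plane) :
    formII f u N v w = mink (fderiv ℝ (fderiv ℝ f) u v w) N := rfl

variable {T : Set H3} {x : H3} {N : Mink} {U : Set Plane} {f : Plane → Mink} {u : Plane}

theorem IsFrame.mink_fderiv (h : IsFrame T x N U f u) (v : Plane) :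
    mink x.1 (fderiv ℝ f u v) = 0 := h.eq ▸ h.param.mink_fderiv h.mem v

theorem IsFrame.mink_fderiv_normal (h : IsFrame T x N U f u) (v : Plane) :
    mink (fderiv ℝ f u v) N = 0 := h.normal.normal U f h.param u h.mem h.eq v

theorem IsFrame.injective (h : IsFrame T x N U f u) : Function.Injective (fderiv ℝ f u) :=
  h.param.immersion u h.mem

theorem IsFrame.formI_pos (h : IsFrame T x N U f u) {v : Plane} (hv : v ≠ 0) :
    0 < formI f u v v :=
  mink_self_pos x (h.mink_fderiv v) fun h0 =>
    hv (h.injective (h0.trans (map_zero (fderiv ℝ f u)).symm))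

theorem formI_comm (f : Plane → Mink) (u v w : Plane) : formI f u v w = formI f u w v :=
  mink_comm _ _

theorem IsFrame.formII_comm (h : IsFrame T x N U f u) (N' : Mink) (v w : Plane) :
    formII f u N' v w = formII f u N' w v := by
  rw [formII_apply, formII_apply, h.param.fderiv_fderiv_comm h.mem]

theorem IsFrame.det_pos (h : IsFrame T x N U f u) :
    0 < formI f u (EuclideanSpace.single 0 1) (EuclideanSpace.single 0 1) *
        formI f u (EuclideanSpace.single 1 1) (EuclideanSpace.single 1 1) -
      formI f u (EuclideanSpace.single 0 1) (EuclideanSpace.single 1 1) ^ 2 := by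
  set E := formI f u (EuclideanSpace.single 0 1) (EuclideanSpace.single 0 1) with hE
  set F := formI f u (EuclideanSpace.single 0 1) (EuclideanSpace.single 1 1) with hF
  set G := formI f u (EuclideanSpace.single 1 1) (EuclideanSpace.single 1 1)
  have hEpos : 0 < E := h.formI_pos (by simp)
  -- This vector is orthogonal to the first basis vector, and its square is `E (E G - F²)`.
  have hv : (!₂[-F, E] : Plane) ≠ 0 := by
    intro h0
    have := congrArg (fun w : Plane => w 1) h0
    simp at this
    exact hEpos.ne' this
  have h1 := h.formI_pos hv
  rw [quadratic_plane _ (formI_comm f u)] at h1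
  simp only [Matrix.cons_val_zero, Matrix.cons_val_one] at h1
  have h2 : 0 < E * (E * G - F ^ 2) := by nlinarith
  exact pos_of_mul_pos_right h2 hEpos.le

/-- The characteristic polynomial of the shape operator is `det (k I - II) / det I`, so the
hypothesis says that `k` is one of its roots. -/
theorem IsFrame.hasEigenvalue_shape (h : IsFrame T x N U f u) {k : ℝ}
    (hk : (k * formI f u (EuclideanSpace.single 0 1) (EuclideanSpace.single 0 1) -
        formII f u N (EuclideanSpace.single 0 1) (EuclideanSpace.single 0 1)) *
      (k * formI f u (EuclideanSpace.single 1 1) (EuclideanSpace.single 1 1) -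
        formII f u N (EuclideanSpace.single 1 1) (EuclideanSpace.single 1 1)) -
      (k * formI f u (EuclideanSpace.single 0 1) (EuclideanSpace.single 1 1) -
        formII f u N (EuclideanSpace.single 0 1) (EuclideanSpace.single 1 1)) ^ 2 = 0) :
    Module.End.HasEigenvalue (Matrix.toLin' (shape f u N)) k := by
  have hdet : (firstForm f u).det ≠ 0 := by
    have := h.det_pos
    rw [Matrix.det_fin_two]
    simp only [firstForm, Matrix.of_apply]
    rw [mink_comm (fderiv ℝ f u (EuclideanSpace.single 1 1))
      (fderiv ℝ f u (EuclideanSpace.single 0 1))]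
    simp only [formI_apply] at this
    nlinarith
  have h1 : (k • firstForm f u - secondForm f u N).det = 0 := by
    rw [Matrix.det_fin_two]
    simp only [firstForm, secondForm, Matrix.of_apply, Matrix.sub_apply, Matrix.smul_apply,
      smul_eq_mul]
    rw [mink_comm (fderiv ℝ f u (EuclideanSpace.single 1 1))
      (fderiv ℝ f u (EuclideanSpace.single 0 1)),
      h.param.fderiv_fderiv_comm h.mem (EuclideanSpace.single 1 1) (EuclideanSpace.single 0 1)]
    simp only [formI_apply, formII_apply] at hk
    linarith
  rw [Module.End.hasEigenvalue_iff_isRoot_charpoly, Matrix.charpoly_toLin', Polynomial.IsRoot,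
    Matrix.eval_charpoly]
  have h2 : firstForm f u * (Matrix.scalar (Fin 2) k - shape f u N) =
      k • firstForm f u - secondForm f u N := by
    rw [mul_sub, shape, Matrix.mul_nonsing_inv_cancel_left _ _ (Ne.isUnit hdet)]
    congr 1
    rw [Matrix.scalar_apply, ← Matrix.smul_one_eq_diagonal, Matrix.mul_smul, mul_one]
  have h3 := congrArg Matrix.det h2
  rw [Matrix.det_mul, h1] at h3
  exact (mul_eq_zero.1 h3).resolve_left hdet

/-- If the principal curvatures are less than one in absolute value, then the second fundamental
form is bounded by the first one. -/
theorem IsFrame.abs_formII_lt (h : IsFrame T x N U f u) (hT : HasSmallCurvatures T) (hx : x ∈ T)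
    {v : Plane} (hv : v ≠ 0) : |formII f u N v v| < formI f u v v := by
  have hroot : ∀ k, Module.End.HasEigenvalue (Matrix.toLin' (shape f u N)) k →
      k ∈ Set.Ioo (-1 : ℝ) 1 := hT x hx N h.normal U f h.param u h.mem h.eq
  have hv' : v 0 ≠ 0 ∨ v 1 ≠ 0 := by
    by_contra hcon
    push Not at hcon
    apply hv
    rw [plane_eq v, hcon.1, hcon.2]
    simp
  have hE : 0 < formI f u (EuclideanSpace.single 0 1) (EuclideanSpace.single 0 1) :=
    h.formI_pos (by simp)
  rw [abs_lt, quadratic_plane _ (formI_comm f u), quadratic_plane _ (h.formII_comm N)]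
  constructor
  · have h1 := form_lt_of_pencil hE h.det_pos
      (l := -formII f u N (EuclideanSpace.single 0 1) (EuclideanSpace.single 0 1))
      (m := -formII f u N (EuclideanSpace.single 0 1) (EuclideanSpace.single 1 1))
      (n := -formII f u N (EuclideanSpace.single 1 1) (EuclideanSpace.single 1 1))
      (fun k hk => by
        have := (hroot (-k) (h.hasEigenvalue_shape (by linarith))).1
        linarith) hv'
    linarith
  · exact form_lt_of_pencil hE h.det_pos
      (fun k hk => (hroot k (h.hasEigenvalue_shape hk)).2) hv'

end Curvature

/-! ### Derivative of the inverse of the spatial coordinates -/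

section Lift

theorem hasFDerivAt_liftVec (y : E3) : HasFDerivAt liftVec (fderiv ℝ liftVec y) y :=
  (contDiff_liftVec (n := 1)).differentiable (by norm_num) y |>.hasFDerivAt

theorem spatial_fderiv_liftVec (y w : E3) : spatial (fderiv ℝ liftVec y w) = w := by
  have h1 := spatial.hasFDerivAt.comp y (hasFDerivAt_liftVec y)
  have h2 : HasFDerivAt (spatial ∘ liftVec) (ContinuousLinearMap.id ℝ E3) y := by
    rw [show (spatial ∘ liftVec) = id from funext spatial_liftVec]
    exact hasFDerivAt_id y
  exact congrArg (fun L : E3 →L[ℝ] E3 => L w) (h1.unique h2)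

theorem mink_fderiv_liftVec (y w : E3) : mink (liftVec y) (fderiv ℝ liftVec y w) = 0 := by
  have h1 := minkL.hasFDerivAt_of_bilinear (hasFDerivAt_liftVec y) (hasFDerivAt_liftVec y)
  have h2 : HasFDerivAt (fun y => minkL (liftVec y) (liftVec y)) (0 : E3 →L[ℝ] ℝ) y := by
    rw [show (fun y => minkL (liftVec y) (liftVec y)) = fun _ => (-1 : ℝ) from
      funext fun y => (liftVec_mem y).1]
    exact hasFDerivAt_const _ _
  have h3 : mink (liftVec y) (fderiv ℝ liftVec y w) +
      mink (fderiv ℝ liftVec y w) (liftVec y) = 0 :=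
    congrArg (fun L : E3 →L[ℝ] ℝ => L w) (h1.unique h2)
  rw [mink_comm (fderiv ℝ liftVec y w)] at h3
  linarith

/-- The derivative of the lift recovers a tangent vector from its spatial coordinates. -/
theorem fderiv_liftVec_spatial (x : H3) {w : Mink} (hw : mink x.1 w = 0) :
    fderiv ℝ liftVec (spatial x.1) (spatial w) = w := by
  rw [← sub_eq_zero]
  refine eq_zero_of_tangent_of_spatial x ?_ ?_
  · rw [mink_sub_right, hw, sub_zero]
    have := mink_fderiv_liftVec (spatial x.1) (spatial w)
    rwa [liftVec_spatial] at this
  · rw [map_sub, spatial_fderiv_liftVec, sub_self]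

end Lift

/-! ### The distance function away from the surface -/

section Distance

/-- The hyperbolic cosine of the distance to `p`. -/
def coshDist (p y : H3) : ℝ := -mink y.1 p.1

theorem continuous_coshDist (p : H3) : Continuous (coshDist p) :=
  (Continuous.mink continuous_subtype_val continuous_const).neg

theorem coshDist_comm (p y : H3) : coshDist p y = coshDist y p := by
  rw [coshDist, coshDist, mink_comm]

theorem hasFDerivAt_neg_mink {E : Type*} [NormedAddCommGroup E] [NormedSpace ℝ E] {g : E → Mink}
    {g' : E →L[ℝ] Mink} {e : E} (h : HasFDerivAt g g' e) (p : Mink) :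
    HasFDerivAt (fun y => -mink (g y) p) (-(minkL.flip p).comp g') e :=
  ((minkL.flip p).hasFDerivAt.comp e h).neg

/-- The chart of hyperbolic space at `q`, given by translated spatial coordinates. -/
def ballChart (q : H3) (v : E3) : H3 := spatialHomeo.symm (spatial q.1 + v)

theorem continuous_ballChart (q : H3) : Continuous (ballChart q) :=
  spatialHomeo.symm.continuous.comp (continuous_const.add continuous_id)

theorem ballChart_zero (q : H3) : ballChart q 0 = q := by
  rw [ballChart, add_zero]
  exact spatialHomeo.symm_apply_apply q

theorem coneChart_ballChart {A : Set H3} {q : H3} (hA : A ∈ 𝓝 q) :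
    ConeChart A Set.univ (ballChart q) q where
  zero := ballChart_zero q
  convex := convex_univ
  smul_mem _ _ _ _ := Set.mem_univ _
  continuousAt := Eventually.of_forall fun v => (continuous_ballChart q).continuousAt
  image_mem U hU := by
    let e : E3 ≃ₜ H3 := (Homeomorph.addLeft (spatial q.1)).trans spatialHomeo.symm
    have h : e '' U ∈ 𝓝 (e 0) := e.isOpenMap.image_mem_nhds hU
    rwa [show e 0 = q from ballChart_zero q] at h
  mem_iff := by
    have h := (continuous_ballChart q).continuousAt (x := 0)
    rw [ContinuousAt, ballChart_zero] at h
    filter_upwards [h hA] with v hv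
    exact ⟨fun _ => Set.mem_univ _, fun _ => hv⟩

/-- The tangent part `w` of `p` at `q` points towards `p`; the derivative along it is `1 - ⟨q, p⟩²`,
negative unless `q = p`. -/
theorem descendsAt_coshDist_of_mem_nhds {A : Set H3} {q p : H3} (hA : A ∈ 𝓝 q) (hqp : q ≠ p) :
    DescendsAt A (coshDist p) q := by
  let w : Mink := p.1 + mink q.1 p.1 • q.1
  have hw : mink q.1 w = 0 := mink_proj_tangent q p.1
  have hcd : ContDiff ℝ 1 fun v : E3 => -mink (liftVec (spatial q.1 + v)) p.1 :=
    ((minkL.flip p.1).contDiff.comp (contDiff_liftVec.comp (contDiff_const.add contDiff_id))).neg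
  have h0 : HasFDerivAt (fun v : E3 => liftVec (spatial q.1 + v))
      (fderiv ℝ liftVec (spatial q.1)) 0 := by
    have h1 := hasFDerivAt_liftVec (spatial q.1 + 0)
    have h2 := h1.comp (0 : E3) ((hasFDerivAt_id (0 : E3)).const_add (spatial q.1))
    rw [add_zero] at h2
    exact h2
  refine (coneChart_ballChart hA).descendsAt
    (G' := fderiv ℝ fun v : E3 => -mink (liftVec (spatial q.1 + v)) p.1)
    (Eventually.of_forall fun v => (hcd.differentiable (by norm_num) v).hasFDerivAt)
    (hcd.continuous_fderiv (by norm_num)).continuousAt (Set.mem_univ (spatial w)) ?_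
  rw [(hasFDerivAt_neg_mink h0 p.1).fderiv]
  change -mink (fderiv ℝ liftVec (spatial q.1) (spatial w)) p.1 < 0
  rw [fderiv_liftVec_spatial q hw]
  simp only [w, mink_add_left, mink_smul_left, p.2.1]
  have h1 := one_le_neg_mink q p
  have h2 : 1 < -mink q.1 p.1 := lt_of_not_ge fun h => hqp (eq_of_neg_mink_le_one h)
  nlinarith

end Distance

/-! ### Charts adapted to a surface -/

section SurfaceChart

/-- Coordinates near a surface: a point of the surface is moved in the direction `N`. -/
def chartE (f : Plane → Mink) (u : Plane) (N : Mink) (p : Plane × ℝ) : E3 :=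
  Real.cosh p.2 • spatial (f (u + p.1)) + Real.sinh p.2 • spatial N

/-- The chart of hyperbolic space adapted to a surface. -/
def chart (f : Plane → Mink) (u : Plane) (N : Mink) (p : Plane × ℝ) : H3 :=
  spatialHomeo.symm (chartE f u N p)

theorem coe_chart (f : Plane → Mink) (u : Plane) (N : Mink) (p : Plane × ℝ) :
    (chart f u N p).1 = liftVec (chartE f u N p) := rfl

theorem spatial_chart (f : Plane → Mink) (u : Plane) (N : Mink) (p : Plane × ℝ) :
    spatial (chart f u N p).1 = chartE f u N p := spatialHomeo.apply_symm_apply _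

variable {T : Set H3} {x : H3} {N : Mink} {U : Set Plane} {f : Plane → Mink} {u : Plane}

theorem mink_geo_self (x : H3) (hxN : mink x.1 N = 0) (hN : mink N N = 1) (t : ℝ) :
    mink (geo x N t) (geo x N t) = -1 := by
  simp only [geo, mink_add_left, mink_add_right, mink_smul_left, mink_smul_right, x.2.1, hN,
    mink_comm N, hxN]
  nlinarith [Real.cosh_sq t]

theorem geo_mem (x : H3) (hxN : mink x.1 N = 0) (hN : mink N N = 1) (t : ℝ) :
    mink (geo x N t) (geo x N t) = -1 ∧ 0 < geo x N t 0 := by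
  refine ⟨mink_geo_self x hxN hN t, ?_⟩
  have hcont : Continuous fun t => geo x N t 0 := by
    simp only [geo, PiLp.add_apply, PiLp.smul_apply, smul_eq_mul]
    exact (Real.continuous_cosh.mul continuous_const).add
      (Real.continuous_sinh.mul continuous_const)
  -- No vector of square `-1` has zero time coordinate, so the geodesic cannot pass to the lower
  -- sheet.
  have hne : ∀ t, geo x N t 0 ≠ 0 := by
    intro t h0
    have h1 := mink_geo_self x hxN hN t
    simp only [mink, h0] at h1
    nlinarith [mul_self_nonneg (geo x N t 1), mul_self_nonneg (geo x N t 2),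
      mul_self_nonneg (geo x N t 3)]
  by_contra hneg
  have h0 : geo x N 0 0 = x.1 0 := by simp [geo]
  obtain ⟨s, hs⟩ := mem_range_of_exists_le_of_exists_ge hcont ⟨t, not_lt.1 hneg⟩
    ⟨0, by rw [h0]; exact x.2.2.le⟩
  exact hne s hs

/-- The geodesic as a curve in hyperbolic space. -/
def geoPt (x : H3) (N : Mink) (hxN : mink x.1 N = 0) (hN : mink N N = 1) (t : ℝ) : H3 :=
  ⟨geo x N t, geo_mem x hxN hN t⟩

theorem continuous_geoPt (x : H3) (N : Mink) (hxN : mink x.1 N = 0) (hN : mink N N = 1) :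
    Continuous (geoPt x N hxN hN) :=
  Continuous.subtype_mk ((Real.continuous_cosh.smul continuous_const).add
    (Real.continuous_sinh.smul continuous_const)) _

namespace IsFrame

theorem chartE_zero (h : IsFrame T x N U f u) (t : ℝ) :
    chartE f u N (0, t) = spatial (geo x N t) := by
  rw [chartE, geo, add_zero, h.eq, map_add, map_smul, map_smul]

theorem chart_zero_snd (h : IsFrame T x N U f u) (t : ℝ) :
    chart f u N (0, t) = geoPt x N h.normal.tangent h.normal.unit t := by
  rw [chart, h.chartE_zero]
  exact spatialHomeo.symm_apply_apply (geoPt x N h.normal.tangent h.normal.unit t)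

theorem chart_zero (h : IsFrame T x N U f u) : chart f u N 0 = x := by
  have := h.chart_zero_snd 0
  rw [Prod.mk_zero_zero] at this
  rw [this]
  apply Subtype.ext
  simp [geoPt, geo]

theorem coe_chart_surface (h : IsFrame T x N U f u) {v : Plane} (hv : u + v ∈ U) :
    (chart f u N (v, 0)).1 = f (u + v) := by
  obtain ⟨y, -, hy⟩ := h.param.exists_mem hv
  rw [coe_chart, chartE, Real.cosh_zero, Real.sinh_zero, one_smul, zero_smul, add_zero, hy,
    liftVec_spatial]

/-- The direction `N` is frozen at the base point; transport along the varying normal field would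
cost one derivative. -/
theorem contDiffAt_chartE (h : IsFrame T x N U f u) : ContDiffAt ℝ 2 (chartE f u N) 0 := by
  have h1 : ContDiffAt ℝ 2 (fun p : Plane × ℝ => f (u + p.1)) 0 := by
    refine ContDiffAt.comp (g := f) 0 ?_ (contDiff_const.add contDiff_fst).contDiffAt
    simpa using h.param.contDiffAt h.mem
  have h2 : ContDiffAt ℝ 2 (fun p : Plane × ℝ => spatial (f (u + p.1))) 0 :=
    spatial.contDiff.contDiffAt.comp 0 h1
  exact ((Real.contDiff_cosh.comp contDiff_snd).contDiffAt.smul h2).add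
    ((Real.contDiff_sinh.comp contDiff_snd).contDiffAt.smul contDiffAt_const)

theorem fderiv_chartE (h : IsFrame T x N U f u) (p : Plane × ℝ) :
    fderiv ℝ (chartE f u N) 0 p = spatial (fderiv ℝ f u p.1 + p.2 • N) := by
  have h1 : HasFDerivAt (fun p : Plane × ℝ => f (u + p.1))
      ((fderiv ℝ f u).comp (ContinuousLinearMap.fst ℝ Plane ℝ)) 0 := by
    refine HasFDerivAt.comp (g := f) 0 ?_ (hasFDerivAt_fst.const_add u)
    simpa using h.param.hasFDerivAt h.mem
  have h2 := spatial.hasFDerivAt.comp (0 : Plane × ℝ) h1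
  have hc : HasFDerivAt (fun p : Plane × ℝ => Real.cosh p.2)
      (Real.sinh (0 : Plane × ℝ).2 • ContinuousLinearMap.snd ℝ Plane ℝ) 0 :=
    (Real.hasDerivAt_cosh _).comp_hasFDerivAt (0 : Plane × ℝ) hasFDerivAt_snd
  have hs : HasFDerivAt (fun p : Plane × ℝ => Real.sinh p.2)
      (Real.cosh (0 : Plane × ℝ).2 • ContinuousLinearMap.snd ℝ Plane ℝ) 0 :=
    (Real.hasDerivAt_sinh _).comp_hasFDerivAt (0 : Plane × ℝ) hasFDerivAt_snd
  have h3 := (hc.smul h2).add (hs.smul (hasFDerivAt_const (spatial N) (0 : Plane × ℝ)))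
  have h4 : HasFDerivAt (chartE f u N) _ 0 := h3
  rw [h4.fderiv]
  simp

theorem injective_fderiv_chartE (h : IsFrame T x N U f u) :
    Function.Injective (fderiv ℝ (chartE f u N) 0) := by
  rw [injective_iff_map_eq_zero]
  rintro ⟨v, t⟩ h0
  rw [h.fderiv_chartE] at h0
  have h1 : fderiv ℝ f u v + t • N = 0 :=
    eq_zero_of_tangent_of_spatial x (by
      rw [mink_add_right, mink_smul_right, h.mink_fderiv, h.normal.tangent, mul_zero, add_zero]) h0
  have h2 : t = 0 := by
    have h3 := congrArg (fun w => mink w N) h1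
    simp only [mink_add_left, mink_smul_left, h.mink_fderiv_normal, h.normal.unit] at h3
    simpa [mink] using h3
  subst h2
  rw [zero_smul, add_zero] at h1
  rw [h.injective (h1.trans (map_zero (fderiv ℝ f u)).symm)]
  rfl

theorem exists_hasStrictFDerivAt_chartE (h : IsFrame T x N U f u) :
    ∃ e : (Plane × ℝ) ≃L[ℝ] E3,
      HasStrictFDerivAt (chartE f u N) (e : (Plane × ℝ) →L[ℝ] E3) 0 := by
  let e' : (Plane × ℝ) ≃ₗ[ℝ] E3 := LinearEquiv.ofInjectiveOfFinrankEq
    (fderiv ℝ (chartE f u N) 0 : (Plane × ℝ) →ₗ[ℝ] E3) h.injective_fderiv_chartE (by simp)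
  refine ⟨e'.toContinuousLinearEquiv, ?_⟩
  have h1 := h.contDiffAt_chartE.hasStrictFDerivAt (by norm_num)
  have h2 : (e'.toContinuousLinearEquiv : (Plane × ℝ) →L[ℝ] E3) =
      fderiv ℝ (chartE f u N) 0 := ContinuousLinearMap.ext fun p => rfl
  rwa [h2]

theorem eventually_continuousAt_chart (h : IsFrame T x N U f u) :
    ∀ᶠ p in 𝓝 (0 : Plane × ℝ), ContinuousAt (chart f u N) p := by
  filter_upwards [h.contDiffAt_chartE.eventually (by simp)] with p hp
  exact spatialHomeo.symm.continuous.continuousAt.comp hp.continuousAt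

theorem image_chart_mem_nhds (h : IsFrame T x N U f u) {W : Set (Plane × ℝ)} (hW : W ∈ 𝓝 0) :
    chart f u N '' W ∈ 𝓝 x := by
  obtain ⟨e, he⟩ := h.exists_hasStrictFDerivAt_chartE
  have h1 : chartE f u N '' W ∈ 𝓝 (chartE f u N 0) := by
    rw [← he.map_nhds_eq_of_equiv]
    exact image_mem_map hW
  have h2 := spatialHomeo.symm.isOpenMap.image_mem_nhds h1
  rw [Set.image_image] at h2
  rw [← h.chart_zero]
  exact h2

theorem eventually_add_mem (h : IsFrame T x N U f u) :
    ∀ᶠ p in 𝓝 (0 : Plane × ℝ), u + p.1 ∈ U := by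
  have : Tendsto (fun p : Plane × ℝ => u + p.1) (𝓝 0) (𝓝 u) := by
    have h1 : Continuous fun p : Plane × ℝ => u + p.1 := by fun_prop
    simpa using h1.tendsto 0
  exact this.eventually (h.param.eventually_mem h.mem)

/-- In the adapted chart, the surface is the zero set of the second coordinate. -/
theorem eventually_chart_mem_iff (h : IsFrame T x N U f u) :
    ∀ᶠ p in 𝓝 (0 : Plane × ℝ), (chart f u N p ∈ T ↔ p.2 = 0) := by
  obtain ⟨e, he⟩ := h.exists_hasStrictFDerivAt_chartE
  let H := he.toOpenPartialHomeomorph (chartE f u N)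
  have hinj : Set.InjOn (chartE f u N) H.source := H.injOn
  have h0 : (0 : Plane × ℝ) ∈ H.source := he.mem_toOpenPartialHomeomorph_source
  obtain ⟨V, hVo, hV⟩ := h.param.image
  -- an open set cutting out the part of the surface parametrized by the source of the chart
  have hopen : IsOpen {w : U | (w.1 - u, (0 : ℝ)) ∈ H.source} :=
    H.open_source.preimage (by fun_prop)
  obtain ⟨V₁, hV₁o, hV₁⟩ := h.param.isEmbedding.isInducing.isOpen_iff.1 hopen
  have hV₁iff : ∀ w (hw : w ∈ U), f w ∈ V₁ ↔ (w - u, (0 : ℝ)) ∈ H.source := by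
    intro w hw
    have : (⟨w, hw⟩ : U) ∈ U.domRestrict f ⁻¹' V₁ ↔
        (⟨w, hw⟩ : U) ∈ {w : U | (w.1 - u, (0 : ℝ)) ∈ H.source} := by rw [hV₁]
    exact this
  have hxV : x.1 ∈ V := by
    have : f u ∈ (fun x : H3 => (x : Mink)) '' T ∩ V := hV ▸ Set.mem_image_of_mem f h.mem
    rw [← h.eq]
    exact this.2
  have hxV₁ : x.1 ∈ V₁ := by
    rw [← h.eq, hV₁iff u h.mem, sub_self]
    exact h0
  have hcont : Tendsto (fun p => (chart f u N p).1) (𝓝 0) (𝓝 x.1) := by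
    have h1 := h.eventually_continuousAt_chart.self_of_nhds
    rw [ContinuousAt, h.chart_zero] at h1
    exact (continuous_subtype_val.tendsto x).comp h1
  filter_upwards [hcont.eventually ((hVo.inter hV₁o).mem_nhds ⟨hxV, hxV₁⟩),
    H.open_source.mem_nhds h0, h.eventually_add_mem] with p hp hps hpU
  constructor
  · intro hpT
    have h1 : (chart f u N p).1 ∈ f '' U := hV ▸ ⟨⟨_, hpT, rfl⟩, hp.1⟩
    obtain ⟨w, hw, hwp⟩ := h1
    have h2 : (w - u, (0 : ℝ)) ∈ H.source := (hV₁iff w hw).1 (hwp ▸ hp.2)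
    have h3 : chartE f u N (w - u, 0) = chartE f u N p := by
      rw [← spatial_chart, ← spatial_chart, h.coe_chart_surface (by simpa using hw),
        add_sub_cancel, hwp]
    rw [← hinj h2 hps h3]
  · intro hp0
    obtain ⟨y, hy, hyf⟩ := h.param.exists_mem hpU
    have h1 : (chart f u N p).1 = y.1 := by
      rw [← hyf, ← h.coe_chart_surface hpU]
      exact congrArg (fun q => (chart f u N q).1) (Prod.ext rfl hp0)
    rw [Subtype.ext h1]
    exact hy

theorem exists_chart_ball (h : IsFrame T x N U f u) {P : Plane × ℝ → Prop}
    (hP : ∀ᶠ p in 𝓝 (0 : Plane × ℝ), P p) :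
    ∃ r > 0, ∀ p ∈ Metric.ball (0 : Plane × ℝ) r, P p ∧ ContinuousAt (chart f u N) p ∧
      (chart f u N p ∈ T ↔ p.2 = 0) :=
  Metric.eventually_nhds_iff_ball.1
    (hP.and (h.eventually_continuousAt_chart.and h.eventually_chart_mem_iff))

/-- The part of a small ball with second coordinate in `P` is convex, and its image misses `T`. A
single point of the normal geodesic in `C` then places the whole image in `C`. -/
theorem eventually_chart_mem_side (h : IsFrame T x N U f u) {C : Set H3} (hC : IsComponent Tᶜ C)
    {P : Set ℝ} (hP : Convex ℝ P) (h0 : (0 : ℝ) ∉ P)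
    (hfreq : ∃ᶠ t in 𝓝 (0 : ℝ), t ∈ P ∧ ∃ y ∈ C, geo x N t = y.1) :
    ∀ᶠ p in 𝓝 (0 : Plane × ℝ), p.2 ∈ P → chart f u N p ∈ C := by
  obtain ⟨r, hr, hb⟩ := h.exists_chart_ball (P := fun _ => True) (by simp)
  have hconv : Convex ℝ (Metric.ball (0 : Plane × ℝ) r ∩ Prod.snd ⁻¹' P) :=
    (convex_ball _ _).inter (hP.linear_preimage (LinearMap.snd ℝ Plane ℝ))
  have hpre : IsPreconnected (chart f u N '' (Metric.ball (0 : Plane × ℝ) r ∩ Prod.snd ⁻¹' P)) :=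
    hconv.isPreconnected.image _ fun p hp => (hb p hp.1).2.1.continuousWithinAt
  have hsub : chart f u N '' (Metric.ball (0 : Plane × ℝ) r ∩ Prod.snd ⁻¹' P) ⊆ Tᶜ := by
    rintro _ ⟨p, ⟨hp, hpP⟩, rfl⟩ hT
    exact h0 ((hb p hp).2.2.1 hT ▸ hpP)
  obtain ⟨t, ⟨htP, y, hy, hty⟩, htr⟩ := (hfreq.and_eventually (Metric.ball_mem_nhds 0 hr)).exists
  have hmem : ((0 : Plane), t) ∈ Metric.ball (0 : Plane × ℝ) r ∩ Prod.snd ⁻¹' P := by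
    refine ⟨?_, htP⟩
    rw [dist_zero_right] at htr
    rw [mem_ball_zero_iff, Prod.norm_mk, norm_zero]
    exact max_lt hr htr
  have hyC : chart f u N (0, t) ∈ C := by
    rw [h.chart_zero_snd, show geoPt x N h.normal.tangent h.normal.unit t = y from Subtype.ext hty]
    exact hy
  have hall := hC.subset_of_inter hpre hsub ⟨_, ⟨_, hmem, rfl⟩, hyC⟩
  filter_upwards [Metric.ball_mem_nhds (0 : Plane × ℝ) hr] with p hp hpP
  exact hall ⟨p, ⟨hp, hpP⟩, rfl⟩

theorem contDiffAt_coshDist_chart (h : IsFrame T x N U f u) (p : H3) :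
    ContDiffAt ℝ 2 (fun v => coshDist p (chart f u N v)) 0 :=
  ((minkL.flip p.1).contDiff.contDiffAt.comp 0
    (contDiff_liftVec.contDiffAt.comp 0 h.contDiffAt_chartE)).neg

theorem fderiv_coshDist_chart (h : IsFrame T x N U f u) (p : H3) (w : Plane × ℝ) :
    fderiv ℝ (fun v => coshDist p (chart f u N v)) 0 w =
      -mink (fderiv ℝ f u w.1) p.1 - w.2 * mink N p.1 := by
  have h1 := (h.contDiffAt_chartE.differentiableAt (by norm_num)).hasFDerivAt
  have h0 : chartE f u N 0 = spatial x.1 := by rw [← spatial_chart, h.chart_zero]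
  have h2 : HasFDerivAt liftVec (fderiv ℝ liftVec (spatial x.1)) (chartE f u N 0) :=
    h0 ▸ hasFDerivAt_liftVec _
  have h3 := hasFDerivAt_neg_mink (h2.comp 0 h1) p.1
  have h4 : HasFDerivAt (fun v => coshDist p (chart f u N v)) _ 0 := h3
  rw [h4.fderiv]
  change -mink (fderiv ℝ liftVec (spatial x.1) (fderiv ℝ (chartE f u N) 0 w)) p.1 = _
  rw [h.fderiv_chartE, fderiv_liftVec_spatial x (by
    rw [mink_add_right, mink_smul_right, h.mink_fderiv, h.normal.tangent, mul_zero, add_zero]),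
    mink_add_left, mink_smul_left]
  ring

theorem eventually_hasFDerivAt_coshDist_chart (h : IsFrame T x N U f u) (p : H3) :
    ∀ᶠ v in 𝓝 (0 : Plane × ℝ), HasFDerivAt (fun v => coshDist p (chart f u N v))
      (fderiv ℝ (fun v => coshDist p (chart f u N v)) v) v := by
  filter_upwards [(h.contDiffAt_coshDist_chart p).eventually (by simp)] with v hv
  exact (hv.differentiableAt (by norm_num)).hasFDerivAt

theorem continuousAt_fderiv_coshDist_chart (h : IsFrame T x N U f u) (p : H3) :
    ContinuousAt (fderiv ℝ (fun v => coshDist p (chart f u N v))) 0 :=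
  ((h.contDiffAt_coshDist_chart p).fderiv_right (m := 1) (by norm_num)).continuousAt

/-- The function `coshDist p` restricted to the surface has a strict local minimum at a
nondegenerate critical point. -/
theorem eventually_coshDist_surface_lt (h : IsFrame T x N U f u) {p : H3}
    (hcrit : ∀ v, mink (fderiv ℝ f u v) p.1 = 0)
    (hpos : ∀ v, v ≠ 0 → mink (fderiv ℝ (fderiv ℝ f) u v v) p.1 < 0) :
    ∀ᶠ y in 𝓝 u, y ≠ u → coshDist p x < -mink (f y) p.1 := by
  have h1 : ∀ᶠ y in 𝓝 u, HasFDerivAt (fun y => -mink (f y) p.1)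
      (-(minkL.flip p.1).comp (fderiv ℝ f y)) y :=
    (h.param.eventually_mem h.mem).mono fun y hy =>
      hasFDerivAt_neg_mink (h.param.hasFDerivAt hy) p.1
  have h2 : HasFDerivAt (fun y => -(minkL.flip p.1).comp (fderiv ℝ f y))
      (-((ContinuousLinearMap.compL ℝ Plane Mink ℝ) (minkL.flip p.1)).comp
        (fderiv ℝ (fderiv ℝ f) u)) u :=
    (((ContinuousLinearMap.compL ℝ Plane Mink ℝ) (minkL.flip p.1)).hasFDerivAt.comp u
      (h.param.hasFDerivAt_fderiv h.mem)).neg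
  have h3 := eventually_lt_of_second_fderiv_pos h1 h2 (by
    ext1 v
    change -mink (fderiv ℝ f u v) p.1 = 0
    rw [hcrit v, neg_zero]) (fun v hv => by
    change 0 < -mink (fderiv ℝ (fderiv ℝ f) u v v) p.1
    linarith [hpos v hv])
  rw [h.eq] at h3
  exact h3

end IsFrame

end SurfaceChart

/-! ### Two-sided surfaces and uniqueness of nearest points -/

section Sided

/-- The unit normal `N` of `T` at `x` points from `Cm` to `Cp`. -/
structure IsNormalFromTo (T Cm Cp : Set H3) (x : H3) (N : Mink) : Prop where
  isUnitNormal : IsUnitNormal T x N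
  eventually : ∀ᶠ t in 𝓝[>] (0 : ℝ), (∃ y ∈ Cp, geo x N t = y.1) ∧ ∃ y ∈ Cm, geo x N (-t) = y.1

/-- A closed surface separating two components of its complement. -/
structure IsSided (T Cm Cp : Set H3) : Prop where
  isClosed : IsClosed T
  isSurface : IsSurface T
  pos : IsComponent Tᶜ Cp
  neg : IsComponent Tᶜ Cm
  ne : Cp ≠ Cm
  exists_normal : ∀ x ∈ T, ∃ N, IsNormalFromTo T Cm Cp x N

variable {T Cm Cp : Set H3} {x p : H3} {N : Mink} {U : Set Plane} {f : Plane → Mink} {u : Plane}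

theorem IsUnitNormal.neg (hN : IsUnitNormal T x N) : IsUnitNormal T x (-N) where
  tangent := by rw [mink_neg_right, hN.tangent, neg_zero]
  unit := by rw [mink_neg_right, mink_neg_left, hN.unit, neg_neg]
  normal U f hf u hu hux v := by rw [mink_neg_right, hN.normal U f hf u hu hux v, neg_zero]

theorem IsNormalFromTo.neg (hN : IsNormalFromTo T Cm Cp x N) : IsNormalFromTo T Cp Cm x (-N) where
  isUnitNormal := hN.isUnitNormal.neg
  eventually := by
    have hg : ∀ t, geo x (-N) t = geo x N (-t) := fun t => by
      simp [geo]
    filter_upwards [hN.eventually] with t ht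
    rw [hg, hg, neg_neg]
    exact ⟨ht.2, ht.1⟩

theorem IsSurface.exists_isFrame (hT : IsSurface T) (hx : x ∈ T) (hN : IsUnitNormal T x N) :
    ∃ U f u, IsFrame T x N U f u := by
  obtain ⟨U, f, hf, u, hu, hux⟩ := hT x hx
  exact ⟨U, f, u, hf, hu, hux, hN⟩

theorem IsFrame.eventually_chart_mem_pos (h : IsFrame T x N U f u) (hCp : IsComponent Tᶜ Cp)
    (hN : IsNormalFromTo T Cm Cp x N) :
    ∀ᶠ v in 𝓝 (0 : Plane × ℝ), 0 < v.2 → chart f u N v ∈ Cp := by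
  refine h.eventually_chart_mem_side hCp (convex_Ioi 0) (lt_irrefl (0 : ℝ)) ?_
  have h1 : ∀ᶠ t in 𝓝[>] (0 : ℝ), t ∈ Set.Ioi (0 : ℝ) ∧ ∃ y ∈ Cp, geo x N t = y.1 := by
    filter_upwards [hN.eventually, self_mem_nhdsWithin] with t ht ht0
    exact ⟨ht0, ht.1⟩
  exact h1.frequently.filter_mono nhdsWithin_le_nhds

theorem IsFrame.eventually_chart_mem_neg (h : IsFrame T x N U f u) (hCm : IsComponent Tᶜ Cm)
    (hN : IsNormalFromTo T Cm Cp x N) :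
    ∀ᶠ v in 𝓝 (0 : Plane × ℝ), v.2 < 0 → chart f u N v ∈ Cm := by
  refine h.eventually_chart_mem_side hCm (convex_Iio 0) (lt_irrefl (0 : ℝ)) ?_
  have h1 : ∀ᶠ t in 𝓝[>] (0 : ℝ), -t ∈ Set.Iio (0 : ℝ) ∧ ∃ y ∈ Cm, geo x N (-t) = y.1 := by
    filter_upwards [hN.eventually, self_mem_nhdsWithin] with t ht ht0
    exact ⟨show -t < 0 from neg_lt_zero.2 ht0, ht.2⟩
  have h2 : Tendsto (fun t : ℝ => -t) (𝓝[>] 0) (𝓝 0) := by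
    have : Tendsto (fun t : ℝ => -t) (𝓝 0) (𝓝 (-0)) := continuous_neg.tendsto 0
    rw [neg_zero] at this
    exact this.mono_left nhdsWithin_le_nhds
  exact h2.frequently h1.frequently

namespace IsSided

theorem isOpen_pos (h : IsSided T Cm Cp) : IsOpen Cp := h.pos.isOpen h.isClosed.isOpen_compl

theorem isOpen_neg (h : IsSided T Cm Cp) : IsOpen Cm := h.neg.isOpen h.isClosed.isOpen_compl

theorem disjoint (h : IsSided T Cm Cp) : Disjoint Cp Cm := h.pos.disjoint h.neg h.ne

theorem notMem_of_mem_pos (h : IsSided T Cm Cp) (hp : p ∈ Cp) : p ∉ T := h.pos.subset hp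

theorem exists_frame (h : IsSided T Cm Cp) (hx : x ∈ T) :
    ∃ N U f u, IsNormalFromTo T Cm Cp x N ∧ IsFrame T x N U f u := by
  obtain ⟨N, hN⟩ := h.exists_normal x hx
  obtain ⟨U, f, u, hf⟩ := h.isSurface.exists_isFrame hx hN.isUnitNormal
  exact ⟨N, U, f, u, hN, hf⟩

theorem eventually_chart (h : IsSided T Cm Cp) (hf : IsFrame T x N U f u)
    (hN : IsNormalFromTo T Cm Cp x N) :
    ∀ᶠ v in 𝓝 (0 : Plane × ℝ), (0 < v.2 → chart f u N v ∈ Cp) ∧ (v.2 < 0 → chart f u N v ∈ Cm) ∧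
      (v.2 = 0 → chart f u N v ∈ T) := by
  filter_upwards [hf.eventually_chart_mem_pos h.pos hN, hf.eventually_chart_mem_neg h.neg hN,
    hf.eventually_chart_mem_iff] with v h1 h2 h3
  exact ⟨h1, h2, h3.2⟩

/-- The union is clopen: adapted charts make it a neighbourhood of each point of `T`, and a limit
point off `T` stays in its component. -/
theorem union_eq_univ (h : IsSided T Cm Cp) : Cp ∪ (Cm ∪ T) = Set.univ := by
  have hopen : IsOpen (Cp ∪ (Cm ∪ T)) := by
    rw [isOpen_iff_mem_nhds]
    rintro x (hx | hx | hx)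
    · exact mem_of_superset (h.isOpen_pos.mem_nhds hx) Set.subset_union_left
    · exact mem_of_superset (h.isOpen_neg.mem_nhds hx) fun y hy => Or.inr (Or.inl hy)
    · obtain ⟨N, U, f, u, hN, hf⟩ := h.exists_frame hx
      refine mem_of_superset (hf.image_chart_mem_nhds (h.eventually_chart hf hN)) ?_
      rintro _ ⟨v, ⟨h1, h2, h3⟩, rfl⟩
      rcases lt_trichotomy v.2 0 with hv | hv | hv
      · exact Or.inr (Or.inl (h2 hv))
      · exact Or.inr (Or.inr (h3 hv))
      · exact Or.inl (h1 hv)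
  have hclosed : IsClosed (Cp ∪ (Cm ∪ T)) := by
    refine isClosed_of_closure_subset fun x hx => ?_
    by_cases hxT : x ∈ T
    · exact Or.inr (Or.inr hxT)
    · rw [closure_union, closure_union, h.isClosed.closure_eq] at hx
      have hTo := h.isClosed.isOpen_compl
      rcases hx with hx | hx | hx
      · exact Or.inl (h.pos.mem_of_mem_closure hTo hx hxT)
      · exact Or.inr (Or.inl (h.neg.mem_of_mem_closure hTo hx hxT))
      · exact absurd hx hxT
  obtain ⟨y, hy⟩ := h.pos.nonempty
  exact IsClopen.eq_univ ⟨hclosed, hopen⟩ ⟨y, Or.inl hy⟩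

theorem compl_pos (h : IsSided T Cm Cp) : Cpᶜ = Cm ∪ T := by
  ext y
  constructor
  · intro hy
    have : y ∈ Cp ∪ (Cm ∪ T) := h.union_eq_univ ▸ Set.mem_univ y
    exact this.resolve_left hy
  · rintro (hy | hy) hyp
    · exact Set.disjoint_left.1 h.disjoint hyp hy
    · exact h.notMem_of_mem_pos hyp hy

theorem isClosed_neg_union (h : IsSided T Cm Cp) : IsClosed (Cm ∪ T) := by
  rw [← h.compl_pos]
  exact h.isOpen_pos.isClosed_compl

theorem subset_closure_neg (h : IsSided T Cm Cp) : T ⊆ closure Cm := by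
  intro x hx
  obtain ⟨N, hN⟩ := h.exists_normal x hx
  let g : ℝ → H3 := geoPt x N hN.isUnitNormal.tangent hN.isUnitNormal.unit
  have h0 : g 0 = x := Subtype.ext (by simp [g, geoPt, geo])
  have hlim : Tendsto (fun t : ℝ => g (-t)) (𝓝[>] 0) (𝓝 x) := by
    have h1 : Tendsto (fun t : ℝ => g (-t)) (𝓝 0) (𝓝 (g (-0))) :=
      ((continuous_geoPt x N _ _).comp continuous_neg).tendsto 0
    rw [neg_zero, h0] at h1
    exact h1.mono_left nhdsWithin_le_nhds
  refine mem_closure_of_tendsto hlim ?_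
  filter_upwards [hN.eventually] with t ht
  obtain ⟨y, hy, hty⟩ := ht.2
  rwa [show g (-t) = y from Subtype.ext hty]

theorem isPreconnected_neg_union (h : IsSided T Cm Cp) : IsPreconnected (Cm ∪ T) :=
  h.neg.isPreconnected.subset_closure Set.subset_union_left
    (Set.union_subset subset_closure h.subset_closure_neg)

theorem symm (h : IsSided T Cm Cp) : IsSided T Cp Cm where
  isClosed := h.isClosed
  isSurface := h.isSurface
  pos := h.neg
  neg := h.pos
  ne := h.ne.symm
  exists_normal x hx := by
    obtain ⟨N, hN⟩ := h.exists_normal x hx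
    exact ⟨-N, hN.neg⟩

theorem subset_closure_pos (h : IsSided T Cm Cp) : T ⊆ closure Cp := h.symm.subset_closure_neg

theorem coneChart (h : IsSided T Cm Cp) (hf : IsFrame T x N U f u)
    (hN : IsNormalFromTo T Cm Cp x N) :
    ConeChart (Cm ∪ T) {v : Plane × ℝ | v.2 ≤ 0} (chart f u N) x where
  zero := hf.chart_zero
  convex := (convex_Iic (0 : ℝ)).linear_preimage (LinearMap.snd ℝ Plane ℝ)
  smul_mem v hv s hs := mul_nonpos_of_nonneg_of_nonpos hs hv
  continuousAt := hf.eventually_continuousAt_chart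
  image_mem W hW := hf.image_chart_mem_nhds hW
  mem_iff := by
    filter_upwards [h.eventually_chart hf hN] with v ⟨h1, h2, h3⟩
    constructor
    · intro hA
      by_contra hv
      have h4 := h1 (not_le.1 hv)
      rw [← h.compl_pos] at hA
      exact hA h4
    · intro hv
      rcases lt_or_eq_of_le (show v.2 ≤ 0 from hv) with hv | hv
      · exact Or.inl (h2 hv)
      · exact Or.inr (h3 hv)

theorem locConnAt (h : IsSided T Cm Cp) (hx : x ∈ Cm ∪ T) : LocConnAt (Cm ∪ T) x := by
  rcases hx with hx | hx
  · exact (coneChart_ballChart (mem_of_superset (h.isOpen_neg.mem_nhds hx)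
      Set.subset_union_left)).locConnAt
  · obtain ⟨N, U, f, u, hN, hf⟩ := h.exists_frame hx
    exact (h.coneChart hf hN).locConnAt

end IsSided

theorem IsFrame.eq_combination (hf : IsFrame T x N U f u)
    (hcrit : ∀ v, mink (fderiv ℝ f u v) p.1 = 0) :
    p.1 = -mink x.1 p.1 • x.1 + mink N p.1 • N :=
  eq_of_orthogonal x hf.normal.tangent hf.normal.unit hf.injective hf.mink_fderiv
    hf.mink_fderiv_normal hcrit

/-- At a critical point `p` is a combination of `x` and `N` of square `-1`: up to sign its
coefficients are a hyperbolic cosine and sine. -/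
theorem IsFrame.sq_eq (hf : IsFrame T x N U f u) (hcrit : ∀ v, mink (fderiv ℝ f u v) p.1 = 0) :
    mink x.1 p.1 ^ 2 = 1 + mink N p.1 ^ 2 := by
  have h1 := hf.eq_combination hcrit
  have h2 : mink p.1 p.1 = mink (-mink x.1 p.1 • x.1 + mink N p.1 • N) p.1 :=
    congrArg (fun w => mink w p.1) h1
  rw [p.2.1, mink_add_left, mink_smul_left, mink_smul_left] at h2
  linarith

theorem IsFrame.mink_fderiv_fderiv_eq (hf : IsFrame T x N U f u)
    (hcrit : ∀ v, mink (fderiv ℝ f u v) p.1 = 0) (v : Plane) :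
    mink (fderiv ℝ (fderiv ℝ f) u v v) p.1 =
      mink x.1 p.1 * formI f u v v + mink N p.1 * formII f u N v v := by
  conv_lhs => rw [hf.eq_combination hcrit]
  have h2 := hf.param.mink_fderiv_fderiv hf.mem v v
  rw [hf.eq] at h2
  rw [mink_add_right, mink_smul_right, mink_smul_right, mink_comm _ x.1, h2, formI_apply,
    formII_apply]
  ring

/-- Hessian of the distance function at a critical point on a surface with small curvatures. -/
theorem IsFrame.hessian_neg (hf : IsFrame T x N U f u) (hT : HasSmallCurvatures T) (hx : x ∈ T)
    (hcrit : ∀ v, mink (fderiv ℝ f u v) p.1 = 0) {v : Plane} (hv : v ≠ 0) :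
    mink (fderiv ℝ (fderiv ℝ f) u v v) p.1 < 0 := by
  have h1 := hf.mink_fderiv_fderiv_eq hcrit v
  have h3 := hf.abs_formII_lt hT hx hv
  have h4 := hf.sq_eq hcrit
  -- The Hessian is `-⟨x, p⟩ I - ⟨N, p⟩ II`; both the coefficient and the form in the second term
  -- are dominated by those of the first.
  have h5 : |mink N p.1| < -mink x.1 p.1 := by
    refine abs_lt_of_sq_lt_sq (by nlinarith) (neg_mink_pos x p).le
  have h6 : mink N p.1 * formII f u N v v ≤ |mink N p.1| * |formII f u N v v| := by
    rw [← abs_mul]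
    exact le_abs_self _
  have h7 : |mink N p.1| * |formII f u N v v| < -mink x.1 p.1 * formI f u v v :=
    mul_lt_mul'' h5 h3 (abs_nonneg _) (abs_nonneg _)
  linarith

namespace IsSided

/-- A critical point on the surface, seen from the side of `Cp`, is a strict local minimum on
the complement of `Cp`. -/
theorem strictMinAt (h : IsSided T Cm Cp) (hT : HasSmallCurvatures T) (hx : x ∈ T)
    (hf : IsFrame T x N U f u) (hN : IsNormalFromTo T Cm Cp x N)
    (hcrit : ∀ v, mink (fderiv ℝ f u v) p.1 = 0) (hpos : 0 < mink N p.1) :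
    StrictMinAt (Cm ∪ T) (coshDist p) x := by
  set G : Plane × ℝ → ℝ := fun v => coshDist p (chart f u N v) with hG
  have hneg : fderiv ℝ G 0 (0, 1) < 0 := by
    rw [hG, hf.fderiv_coshDist_chart]
    simp only [map_zero, one_mul]
    have : mink 0 p.1 = 0 := by simp [mink]
    linarith
  have hev : ∀ᶠ v in 𝓝 (0 : Plane × ℝ), fderiv ℝ G v (0, 1) < 0 := by
    have : ContinuousAt (fun v => fderiv ℝ G v (0, 1)) 0 :=
      (hf.continuousAt_fderiv_coshDist_chart p).clm_apply continuousAt_const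
    exact this.eventually (gt_mem_nhds hneg)
  have hsurf : ∀ᶠ v in 𝓝 (0 : Plane × ℝ), v.1 ≠ 0 → coshDist p x < -mink (f (u + v.1)) p.1 := by
    have h1 := hf.eventually_coshDist_surface_lt hcrit fun v hv => hf.hessian_neg hT hx hcrit hv
    have h2 : Tendsto (fun v : Plane × ℝ => u + v.1) (𝓝 0) (𝓝 u) := by
      have h1 : Continuous fun p : Plane × ℝ => u + p.1 := by fun_prop
      simpa using h1.tendsto 0
    filter_upwards [h2.eventually h1] with v hv hv0
    exact hv (by simpa using hv0)
  obtain ⟨r, hr, hb⟩ := Metric.eventually_nhds_iff_ball.1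
    ((hf.eventually_hasFDerivAt_coshDist_chart p).and (hev.and (hsurf.and
      (hf.eventually_add_mem.and (h.coneChart hf hN).mem_iff))))
  refine mem_of_superset (hf.image_chart_mem_nhds (Metric.ball_mem_nhds 0 hr)) ?_
  rintro _ ⟨⟨v, t⟩, hv, rfl⟩ hA hne
  have ht : t ≤ 0 := (hb _ hv).2.2.2.2.1 hA
  have hv0 : ∀ s ∈ Set.Icc t 0, (v, s) ∈ Metric.ball (0 : Plane × ℝ) r := by
    intro s hs
    rw [mem_ball_zero_iff, Prod.norm_mk, max_lt_iff] at hv ⊢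
    refine ⟨hv.1, lt_of_le_of_lt ?_ hv.2⟩
    rw [Real.norm_eq_abs, Real.norm_eq_abs, abs_of_nonpos hs.2, abs_of_nonpos ht]
    linarith [hs.1]
  have hG0 : G (v, 0) = -mink (f (u + v)) p.1 := by
    rw [hG]
    simp only [coshDist]
    rw [hf.coe_chart_surface (hb _ hv).2.2.2.1]
  -- A point of the far side is compared with the point `(v, 0)` of the surface: the Hessian
  -- controls the surface, and moving to negative second coordinate strictly increases `G`.
  have h1 : coshDist p x ≤ G (v, 0) := by
    rw [hG0]
    by_cases hv1 : v = 0
    · rw [hv1, add_zero, hf.eq]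
      exact le_rfl
    · exact ((hb _ hv).2.2.1 hv1).le
  rcases ht.lt_or_eq with ht | ht
  · have hderiv : ∀ s ∈ Set.Icc t 0,
        HasDerivAt (fun s : ℝ => G (v, s)) (fderiv ℝ G (v, s) (0, 1)) s := by
      intro s hs
      have h2 : HasDerivAt (fun s : ℝ => (v, s)) ((0 : Plane), (1 : ℝ)) s :=
        (hasDerivAt_const s v).prodMk (hasDerivAt_id s)
      exact (hb _ (hv0 s hs)).1.comp_hasDerivAt s h2
    have hanti := strictAntiOn_of_deriv_neg (convex_Icc t 0) (f := fun s : ℝ => G (v, s))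
      (fun s hs => (hderiv s hs).continuousAt.continuousWithinAt) (fun s hs => by
        rw [interior_Icc] at hs
        rw [(hderiv s (Set.Ioo_subset_Icc_self hs)).deriv]
        exact (hb _ (hv0 s (Set.Ioo_subset_Icc_self hs))).2.1)
    exact h1.trans_lt (hanti (Set.left_mem_Icc.2 ht.le) (Set.right_mem_Icc.2 ht.le) ht)
  · subst ht
    have hv1 : v ≠ 0 := by
      rintro rfl
      exact hne hf.chart_zero
    have h2 := (hb _ hv).2.2.1 hv1
    rw [← hG0] at h2
    exact h2

/-- First-order condition on a half-space. Without a descent direction the differential is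
nonnegative on it, hence zero along the surface and `⟨N, p⟩ ≥ 0`; the value zero would put `p` at
`x`, on `T`. -/
theorem descendsAt_or (h : IsSided T Cm Cp) (hp : p ∈ Cp) (hx : x ∈ T)
    (hf : IsFrame T x N U f u) (hN : IsNormalFromTo T Cm Cp x N) :
    DescendsAt (Cm ∪ T) (coshDist p) x ∨
      ((∀ v, mink (fderiv ℝ f u v) p.1 = 0) ∧ 0 < mink N p.1) := by
  by_contra hcon
  rw [not_or] at hcon
  obtain ⟨hdes, hcon⟩ := hcon
  have key : ∀ w : Plane × ℝ, w.2 ≤ 0 →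
      0 ≤ -mink (fderiv ℝ f u w.1) p.1 - w.2 * mink N p.1 := by
    intro w hw
    by_contra hneg
    refine hdes ((h.coneChart hf hN).descendsAt (hf.eventually_hasFDerivAt_coshDist_chart p)
      (hf.continuousAt_fderiv_coshDist_chart p) (w := w) hw ?_)
    rw [hf.fderiv_coshDist_chart]
    exact not_le.1 hneg
  have hcrit : ∀ v, mink (fderiv ℝ f u v) p.1 = 0 := by
    intro v
    have h1 := key (v, 0) le_rfl
    have h2 := key (-v, 0) le_rfl
    simp only [map_neg, mink_neg_left, zero_mul] at h1 h2
    linarith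
  have h0 : 0 ≤ mink N p.1 := by
    have h1 := key (0, -1) (by norm_num)
    simp only [map_zero] at h1
    have : mink 0 p.1 = 0 := by simp [mink]
    linarith
  refine hcon ⟨hcrit, lt_of_le_of_ne h0 fun h1 => ?_⟩
  have h2 := hf.sq_eq hcrit
  rw [← h1] at h2
  have h3 := neg_mink_pos x p
  have h4 : x = p := eq_of_neg_mink_le_one (by nlinarith)
  exact h.notMem_of_mem_pos hp (h4 ▸ hx)

theorem descendsAt_or_strictMinAt (h : IsSided T Cm Cp) (hT : HasSmallCurvatures T) (hp : p ∈ Cp)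
    (hx : x ∈ Cm ∪ T) :
    DescendsAt (Cm ∪ T) (coshDist p) x ∨ StrictMinAt (Cm ∪ T) (coshDist p) x := by
  rcases hx with hx | hx
  · left
    refine descendsAt_coshDist_of_mem_nhds
      (mem_of_superset (h.isOpen_neg.mem_nhds hx) Set.subset_union_left) ?_
    rintro rfl
    exact Set.disjoint_left.1 h.disjoint hp hx
  · obtain ⟨N, U, f, u, hN, hf⟩ := h.exists_frame hx
    exact (h.descendsAt_or hp hx hf hN).imp id fun ⟨h1, h2⟩ => h.strictMinAt hT hx hf hN h1 h2

/-- The mountain pass is run on the whole closed far side `Cm ∪ T` rather than on `T`: its interior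
has no critical points, since `p` is not there. -/
theorem strictMinAt_unique (h : IsSided T Cm Cp) (hT : HasSmallCurvatures T) (hp : p ∈ Cp)
    {y : H3} (hx : x ∈ T) (hy : y ∈ T) (hxm : StrictMinAt (Cm ∪ T) (coshDist p) x)
    (hym : StrictMinAt (Cm ∪ T) (coshDist p) y) : x = y :=
  QF.strictMinAt_unique (continuous_coshDist p) h.isPreconnected_neg_union
    (fun c => (isCompact_neg_mink_le p c).inter_left h.isClosed_neg_union)
    (fun _ => h.locConnAt) (fun _ => h.descendsAt_or_strictMinAt hT hp) (Or.inr hx) (Or.inr hy)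
    hxm hym

end IsSided

/-- The point `x` of `T` is a nearest point to `p`. -/
def IsFoot (T : Set H3) (p x : H3) : Prop := x ∈ T ∧ ∀ a ∈ T, coshDist p x ≤ coshDist p a

theorem exists_isMinOn_coshDist {A : Set H3} (hA : IsClosed A) (hne : A.Nonempty) (p : H3) :
    ∃ x ∈ A, ∀ a ∈ A, coshDist p x ≤ coshDist p a := by
  obtain ⟨a, ha⟩ := hne
  have hc : IsCompact (A ∩ {y | coshDist p y ≤ coshDist p a}) :=
    (isCompact_neg_mink_le p (coshDist p a)).inter_left hA
  obtain ⟨x, hx, hmin⟩ := hc.exists_isMinOn ⟨a, ha, le_refl (coshDist p a)⟩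
    (continuous_coshDist p).continuousOn
  refine ⟨x, hx.1, fun b hb => ?_⟩
  rcases le_total (coshDist p b) (coshDist p a) with h | h
  · exact hmin ⟨hb, h⟩
  · exact le_trans (show coshDist p x ≤ coshDist p a from hx.2) h

theorem DescendsAt.exists_lt {X : Type*} [TopologicalSpace X] {A : Set X} {φ : X → ℝ} {q : X}
    (h : DescendsAt A φ q) : ∃ y ∈ A, φ y < φ q := by
  obtain ⟨D, -, hD, hcl, -⟩ := h
  obtain ⟨y, hy⟩ := closure_nonempty_iff.1 ⟨q, hcl⟩
  exact ⟨y, hD y hy⟩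

namespace IsSided

/-- A minimum over the closed far side exists by properness and cannot be interior, where the
distance to `p` can be decreased. -/
theorem exists_foot (h : IsSided T Cm Cp) (hp : p ∈ Cp) :
    ∃ x ∈ T, ∀ a ∈ Cm ∪ T, coshDist p x ≤ coshDist p a := by
  obtain ⟨y, hy⟩ := h.neg.nonempty
  obtain ⟨x, hx, hmin⟩ := exists_isMinOn_coshDist h.isClosed_neg_union ⟨y, Or.inl hy⟩ p
  refine ⟨x, hx.resolve_left fun hxm => ?_, hmin⟩
  have hd : DescendsAt (Cm ∪ T) (coshDist p) x := descendsAt_coshDist_of_mem_nhds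
    (mem_of_superset (h.isOpen_neg.mem_nhds hxm) Set.subset_union_left) (by
      rintro rfl
      exact Set.disjoint_left.1 h.disjoint hp hxm)
  obtain ⟨z, hz, hlt⟩ := hd.exists_lt
  exact absurd (hmin z hz) (not_le.2 hlt)

/-- The foot of a point of `Cp` is a critical point, with normal pointing to the given point. -/
theorem critical_of_isFoot (h : IsSided T Cm Cp) (hp : p ∈ Cp) (hx : IsFoot T p x)
    (hf : IsFrame T x N U f u) (hN : IsNormalFromTo T Cm Cp x N) :
    (∀ v, mink (fderiv ℝ f u v) p.1 = 0) ∧ 0 < mink N p.1 := by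
  refine (h.descendsAt_or hp hx.1 hf hN).resolve_left fun hd => ?_
  obtain ⟨z, hz, hlt⟩ := hd.exists_lt
  obtain ⟨y, hy, hmin⟩ := h.exists_foot hp
  exact absurd ((hx.2 y hy).trans (hmin z hz)) (not_le.2 hlt)

theorem strictMinAt_of_isFoot (h : IsSided T Cm Cp) (hT : HasSmallCurvatures T) (hp : p ∈ Cp)
    (hx : IsFoot T p x) : StrictMinAt (Cm ∪ T) (coshDist p) x := by
  obtain ⟨N, U, f, u, hN, hf⟩ := h.exists_frame hx.1
  obtain ⟨h1, h2⟩ := h.critical_of_isFoot hp hx hf hN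
  exact h.strictMinAt hT hx.1 hf hN h1 h2

theorem isFoot_unique (h : IsSided T Cm Cp) (hT : HasSmallCurvatures T) (hp : p ∈ Cp) {y : H3}
    (hx : IsFoot T p x) (hy : IsFoot T p y) : x = y :=
  h.strictMinAt_unique hT hp hx.1 hy.1 (h.strictMinAt_of_isFoot hT hp hx)
    (h.strictMinAt_of_isFoot hT hp hy)

/-- Moving in the normal direction, the foot does not change. -/
theorem isFoot_of_eq (h : IsSided T Cm Cp) (hT : HasSmallCurvatures T) (hp : p ∈ Cp) (hx : x ∈ T)
    (hN : IsNormalFromTo T Cm Cp x N) {a b : ℝ} (hb : 0 < b) (hpe : p.1 = a • x.1 + b • N) :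
    IsFoot T p x := by
  obtain ⟨U, f, u, hf⟩ := h.isSurface.exists_isFrame hx hN.isUnitNormal
  have hcrit : ∀ v, mink (fderiv ℝ f u v) p.1 = 0 := by
    intro v
    rw [hpe, mink_add_right, mink_smul_right, mink_smul_right, mink_comm _ x.1, hf.mink_fderiv,
      hf.mink_fderiv_normal]
    ring
  have hpos : 0 < mink N p.1 := by
    rw [hpe, mink_add_right, mink_smul_right, mink_smul_right, mink_comm N x.1,
      hN.isUnitNormal.tangent, hN.isUnitNormal.unit]
    linarith
  -- The given point is a strict local minimum and so is the true foot; uniqueness identifies them.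
  obtain ⟨y, hy, hmin⟩ := h.exists_foot hp
  have hyf : IsFoot T p y := ⟨hy, fun a ha => hmin a (Or.inr ha)⟩
  rwa [h.strictMinAt_unique hT hp hx hy (h.strictMinAt hT hx hf hN hcrit hpos)
    (h.strictMinAt_of_isFoot hT hp hyf)]

end IsSided

end Sided

/-! ### Normal geodesics and parallel sets -/

section Push

variable {T Cm Cp T' Cm' Cp' : Set H3} {x p : H3} {N : Mink}

theorem mink_geo (hN : IsNormalFromTo T Cm Cp x N) (s : ℝ) :
    mink (geo x N s) x.1 = -Real.cosh s := by
  rw [geo, mink_add_left, mink_smul_left, mink_smul_left, x.2.1, mink_comm N,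
    hN.isUnitNormal.tangent]
  ring

/-- The geodesic normal to the surface, as a curve in hyperbolic space. -/
def IsNormalFromTo.ray (hN : IsNormalFromTo T Cm Cp x N) (s : ℝ) : H3 :=
  geoPt x N hN.isUnitNormal.tangent hN.isUnitNormal.unit s

theorem IsNormalFromTo.coe_ray (hN : IsNormalFromTo T Cm Cp x N) (s : ℝ) :
    (hN.ray s).1 = Real.cosh s • x.1 + Real.sinh s • N := rfl

theorem IsNormalFromTo.continuous_ray (hN : IsNormalFromTo T Cm Cp x N) : Continuous hN.ray :=
  continuous_geoPt x N hN.isUnitNormal.tangent hN.isUnitNormal.unit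

theorem IsNormalFromTo.coshDist_ray (hN : IsNormalFromTo T Cm Cp x N) (s : ℝ) :
    coshDist (hN.ray s) x = Real.cosh s := by
  rw [coshDist_comm, coshDist]
  change -mink (geo x N s) x.1 = _
  rw [mink_geo hN, neg_neg]

namespace IsSided

theorem isFoot_ray (h : IsSided T Cm Cp) (hT : HasSmallCurvatures T) (hx : x ∈ T)
    (hN : IsNormalFromTo T Cm Cp x N) {s : ℝ} (hs : 0 < s) (hp : hN.ray s ∈ Cp) :
    IsFoot T (hN.ray s) x :=
  h.isFoot_of_eq hT hp hx hN (Real.sinh_pos_iff.2 hs) rfl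

/-- The normal geodesics stay on the positive side. -/
theorem ray_mem (h : IsSided T Cm Cp) (hT : HasSmallCurvatures T) (hx : x ∈ T)
    (hN : IsNormalFromTo T Cm Cp x N) {s : ℝ} (hs : 0 < s) : hN.ray s ∈ Cp := by
  let O : Set ℝ := Set.Ioi 0 ∩ hN.ray ⁻¹' Cp
  have hO : IsOpen O := isOpen_Ioi.inter (h.isOpen_pos.preimage hN.continuous_ray)
  have hne : (Set.Ioi (0 : ℝ) ∩ O).Nonempty := by
    obtain ⟨t, ht, ht0⟩ := (hN.eventually.and self_mem_nhdsWithin).exists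
    obtain ⟨y, hy, hty⟩ := ht.1
    refine ⟨t, ht0, ht0, ?_⟩
    rw [Set.mem_preimage, show hN.ray t = y from Subtype.ext hty]
    exact hy
  have hcl : closure O ∩ Set.Ioi 0 ⊆ O := by
    rintro t ⟨ht, ht0⟩
    refine ⟨ht0, ?_⟩
    have h1 : hN.ray t ∈ closure Cp :=
      closure_mono (by rintro _ ⟨r, hr, rfl⟩; exact hr.2)
        (mem_closure_image hN.continuous_ray.continuousAt ht)
    refine h.pos.mem_of_mem_closure h.isClosed.isOpen_compl h1 fun htT => ?_
    -- As long as the ray is in `Cp` its foot is `x`. If it returned to `T` at time `t`, letting `r`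
    -- tend to `t` would give `cosh t ≤ 1`.
    have h2 : ∀ r ∈ O, Real.cosh r ≤ coshDist (hN.ray r) (hN.ray t) := by
      intro r hr
      rw [← hN.coshDist_ray]
      exact (h.isFoot_ray hT hx hN hr.1 hr.2).2 _ htT
    have hc : Continuous fun r => coshDist (hN.ray r) (hN.ray t) := by
      simp only [coshDist_comm _ (hN.ray t)]
      exact (continuous_coshDist _).comp hN.continuous_ray
    have h3 : Real.cosh t ≤ coshDist (hN.ray t) (hN.ray t) :=
      closure_minimal (t := {r | Real.cosh r ≤ coshDist (hN.ray r) (hN.ray t)})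
        h2 (isClosed_le Real.continuous_cosh hc) ht
    rw [coshDist, (hN.ray t).2.1, neg_neg] at h3
    exact absurd h3 (not_le.2 (Real.one_lt_cosh.2 (ne_of_gt ht0)))
  exact (isPreconnected_Ioi.subset_of_closure_inter_subset hO hne hcl hs).2

/-- Every point on the positive side lies on a normal geodesic. -/
theorem exists_ray_eq (h : IsSided T Cm Cp) (hp : p ∈ Cp) (hx : IsFoot T p x)
    (hN : IsNormalFromTo T Cm Cp x N) : ∃ s, 0 < s ∧ hN.ray s = p := by
  obtain ⟨U, f, u, hf⟩ := h.isSurface.exists_isFrame hx.1 hN.isUnitNormal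
  obtain ⟨hcrit, hpos⟩ := h.critical_of_isFoot hp hx hf hN
  -- The parameter is read off from the normal component of `p`, which is `sinh s`.
  refine ⟨Real.arsinh (mink N p.1), Real.arsinh_pos_iff.2 hpos, Subtype.ext ?_⟩
  rw [hN.coe_ray, Real.sinh_arsinh, Real.cosh_arsinh, ← hf.sq_eq hcrit, Real.sqrt_sq_eq_abs,
    abs_of_neg (by linarith [neg_mink_pos x p])]
  exact (hf.eq_combination hcrit).symm

theorem exists_isFoot (h : IsSided T Cm Cp) (hp : p ∈ Cp) : ∃ x, IsFoot T p x := by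
  obtain ⟨x, hx, hmin⟩ := h.exists_foot hp
  exact ⟨x, hx, fun a ha => hmin a (Or.inr ha)⟩

/-- The foot depends continuously on the point. -/
theorem tendsto_isFoot (h : IsSided T Cm Cp) (hT : HasSmallCurvatures T) (hp : p ∈ Cp)
    (hx : IsFoot T p x) {ι : Type*} {l : Filter ι} {z y : ι → H3} (hz : Tendsto z l (𝓝 p))
    (hy : ∀ᶠ i in l, IsFoot T (z i) (y i)) : Tendsto y l (𝓝 x) := by
  have hcont : Continuous fun q : H3 × H3 => coshDist q.1 q.2 :=
    (Continuous.mink (by fun_prop) (by fun_prop)).neg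
  -- By `coord_le`, this bounds the time coordinate of every foot of a point near `p`. Compactness
  -- reduces continuity to uniqueness: any cluster point of feet is a foot of `p`.
  let R : ℝ := 2 * (p.1 0 + 1) * (coshDist p x + 1)
  have hK : IsCompact ({q : H3 | q.1 0 ≤ R} ∩ T) := (isCompact_coord_le R).inter_right h.isClosed
  have h1 : ∀ᶠ i in l, coshDist (z i) x < coshDist p x + 1 := by
    have hc : Continuous fun q : H3 => coshDist q x :=
      hcont.comp (continuous_id.prodMk continuous_const)
    exact ((hc.tendsto p).comp hz).eventually (gt_mem_nhds (lt_add_one _))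
  have h2 : ∀ᶠ i in l, (z i).1 0 < p.1 0 + 1 := by
    have hc : Continuous fun q : H3 => q.1 0 := by fun_prop
    exact ((hc.tendsto p).comp hz).eventually (gt_mem_nhds (lt_add_one _))
  refine hK.tendsto_nhds_of_unique_mapClusterPt ?_ ?_
  · filter_upwards [h1, h2, hy] with i hi1 hi2 hi3
    refine ⟨?_, hi3.1⟩
    have h3 := coord_le (z i) (y i)
    rw [mink_comm] at h3
    change (y i).1 0 ≤ 2 * (z i).1 0 * coshDist (z i) (y i) at h3
    have h4 := (hi3.2 x hx.1).trans hi1.le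
    have h5 : 0 < coshDist (z i) (y i) := neg_mink_pos _ _
    change (y i).1 0 ≤ 2 * (p.1 0 + 1) * (coshDist p x + 1)
    refine h3.trans ?_
    have := (z i).2.2
    have := p.2.2
    gcongr
  · rintro w ⟨-, hwT⟩ hw
    refine h.isFoot_unique hT hp ⟨hwT, fun a ha => ?_⟩ hx
    by_contra hcon
    rw [not_le] at hcon
    have ho : IsOpen {q : H3 × H3 | coshDist q.1 a < coshDist q.1 q.2} :=
      isOpen_lt (hcont.comp (continuous_fst.prodMk continuous_const)) hcont
    have hmem : (p, w) ∈ {q : H3 × H3 | coshDist q.1 a < coshDist q.1 q.2} := hcon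
    obtain ⟨V, hV, W, hW, hVW⟩ := mem_nhds_prod_iff.1 (ho.mem_nhds hmem)
    obtain ⟨i, hi1, hi2, hi3⟩ := ((hw.frequently hW).and_eventually
      ((hz.eventually hV).and hy)).exists
    have h3 : coshDist (z i) a < coshDist (z i) (y i) := hVW (Set.mk_mem_prod hi2 hi1)
    exact absurd (hi3.2 a ha) (not_le.2 h3)

/-- The parallel set at distance greater than `t` is connected. -/
theorem isPreconnected_parallel (h : IsSided T Cm Cp) (hT : HasSmallCurvatures T) (t : ℝ) :
    ∃ D : Set H3, IsPreconnected D ∧ ∀ q, q ∈ D ↔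
      ∃ x ∈ T, ∃ N, ∃ hN : IsNormalFromTo T Cm Cp x N, ∃ s, 0 < s ∧ hN.ray (s + t) = q := by
  choose! foot hfoot using fun p (hp : p ∈ Cp) => h.exists_isFoot hp
  have hfc : ContinuousOn foot Cp := fun p hp =>
    h.tendsto_isFoot hT hp (hfoot p hp) (z := id) (tendsto_id'.2 nhdsWithin_le_nhds)
      (eventually_nhdsWithin_of_forall hfoot)
  let c : H3 → ℝ := fun p => -mink p.1 (foot p).1
  have hcc : ContinuousOn c Cp := by
    have := continuous_mink.comp_continuousOn
      (continuous_subtype_val.continuousOn.prodMk (continuous_subtype_val.comp_continuousOn hfc))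
    exact this.neg
  -- With `c p = cosh s`, the vector `(c p · p - foot p) / sinh s` is the velocity at `p` of the
  -- geodesic from the foot, and `g` prolongs it by `t`. Only the foot enters, so its continuity
  -- suffices.
  let g : H3 → Mink := fun p => Real.cosh t • p.1 +
    Real.sinh t • ((√(c p ^ 2 - 1))⁻¹ • (c p • p.1 - (foot p).1))
  have hgray : ∀ x ∈ T, ∀ N, ∀ hN : IsNormalFromTo T Cm Cp x N, ∀ s, 0 < s →
      g (hN.ray s) = (hN.ray (s + t)).1 ∧ 0 < c (hN.ray s) ^ 2 - 1 := by
    intro x hx N hN s hs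
    have hmem := h.ray_mem hT hx hN hs
    have hfx : foot (hN.ray s) = x :=
      h.isFoot_unique hT hmem (hfoot _ hmem) (h.isFoot_ray hT hx hN hs hmem)
    have hc : c (hN.ray s) = Real.cosh s := by
      simp only [c, hfx]
      exact (coshDist_comm _ _).trans (hN.coshDist_ray s)
    have hsinh := Real.sinh_pos_iff.2 hs
    have hsq : Real.cosh s ^ 2 - 1 = Real.sinh s ^ 2 := by rw [Real.cosh_sq]; ring
    constructor
    · simp only [g, hc, hfx]
      rw [hsq, Real.sqrt_sq hsinh.le]
      have h1 : Real.cosh s • (hN.ray s).1 - x.1 =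
          Real.sinh s • (Real.sinh s • x.1 + Real.cosh s • N) := by
        rw [hN.coe_ray, smul_add, smul_add, smul_smul, smul_smul, smul_smul, smul_smul,
          ← sq, ← sq, Real.cosh_sq, add_smul, one_smul, mul_comm (Real.cosh s)]
        abel
      rw [h1, inv_smul_smul₀ hsinh.ne', hN.coe_ray, hN.coe_ray,
        Real.cosh_add, Real.sinh_add]
      module
    · rw [hc, hsq]
      positivity
  have hray : ∀ p ∈ Cp, ∃ x ∈ T, ∃ N, ∃ hN : IsNormalFromTo T Cm Cp x N, ∃ s, 0 < s ∧
      hN.ray s = p := by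
    intro p hp
    obtain ⟨N, hN⟩ := h.exists_normal _ (hfoot p hp).1
    obtain ⟨s, hs, hsp⟩ := h.exists_ray_eq hp (hfoot p hp) hN
    exact ⟨_, (hfoot p hp).1, N, hN, s, hs, hsp⟩
  have hgc : ContinuousOn g Cp := by
    have h1 : ContinuousOn (fun p => (√(c p ^ 2 - 1))⁻¹) Cp := by
      refine ContinuousOn.inv₀ (Real.continuous_sqrt.comp_continuousOn
        ((hcc.pow 2).sub continuousOn_const)) fun p hp => ?_
      obtain ⟨x, hx, N, hN, s, hs, rfl⟩ := hray p hp
      exact (Real.sqrt_pos.2 (hgray x hx N hN s hs).2).ne'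
    have h2 : ContinuousOn (fun p : H3 => p.1) Cp := continuous_subtype_val.continuousOn
    have h3 : ContinuousOn (fun p => (foot p).1) Cp := continuous_subtype_val.comp_continuousOn hfc
    have h4 : ContinuousOn (fun p => c p • p.1 - (foot p).1) Cp := (hcc.smul h2).sub h3
    exact (h2.const_smul (Real.cosh t)).add ((h1.smul h4).const_smul (Real.sinh t))
  let F : H3 → H3 := fun p => spatialHomeo.symm (spatial (g p))
  have hFray : ∀ x ∈ T, ∀ N, ∀ hN : IsNormalFromTo T Cm Cp x N, ∀ s, 0 < s →
      F (hN.ray s) = hN.ray (s + t) := by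
    intro x hx N hN s hs
    simp only [F]
    rw [(hgray x hx N hN s hs).1]
    exact spatialHomeo.symm_apply_apply _
  refine ⟨F '' Cp, h.pos.isPreconnected.image _ (spatialHomeo.symm.continuous.comp_continuousOn
    (spatial.continuous.comp_continuousOn hgc)), fun q => ⟨?_, ?_⟩⟩
  · rintro ⟨p, hp, rfl⟩
    obtain ⟨x, hx, N, hN, s, hs, rfl⟩ := hray p hp
    exact ⟨x, hx, N, hN, s, hs, (hFray x hx N hN s hs).symm⟩
  · rintro ⟨x, hx, N, hN, s, hs, rfl⟩
    exact ⟨hN.ray s, h.ray_mem hT hx hN hs, hFray x hx N hN s hs⟩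

/-- If `T'` lies within distance `t` from `T`, then the points at distance more than `t` from `T`
on its positive side are on the positive side of `T'`. -/
theorem ray_mem_of_dist_le (h : IsSided T Cm Cp) (hT : HasSmallCurvatures T)
    (h' : IsSided T' Cm' Cp') {t : ℝ} (ht : 0 ≤ t)
    (hdist : ∀ y ∈ T', ∃ a ∈ T, coshDist y a ≤ Real.cosh t)
    (hfar : ∃ z ∈ Cp ∩ Cp', ∀ a ∈ T, Real.cosh t < coshDist z a)
    (hx : x ∈ T) (hN : IsNormalFromTo T Cm Cp x N) {s : ℝ} (hs : 0 < s) :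
    hN.ray (s + t) ∈ Cp' := by
  -- `D` is connected, and it misses `T'` because its points are farther than `t` from `T`. The
  -- point `z` places it in `Cp'`.
  obtain ⟨D, hD, hmem⟩ := h.isPreconnected_parallel hT t
  have hsub : D ⊆ T'ᶜ := by
    intro q hq hqT'
    obtain ⟨y, hy, M, hM, r, hr, rfl⟩ := (hmem q).1 hq
    obtain ⟨a, ha, hle⟩ := hdist _ hqT'
    have hrt : 0 < r + t := by linarith
    have h1 := (h.isFoot_ray hT hy hM hrt (h.ray_mem hT hy hM hrt)).2 a ha
    rw [hM.coshDist_ray] at h1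
    have h2 := Real.cosh_le_cosh.1 (h1.trans hle)
    rw [abs_of_pos hrt, abs_of_nonneg ht] at h2
    linarith
  refine h'.pos.subset_of_inter hD hsub ?_ ((hmem _).2 ⟨x, hx, N, hN, s, hs, rfl⟩)
  obtain ⟨z, ⟨hz, hz'⟩, hzfar⟩ := hfar
  obtain ⟨y, hy⟩ := h.exists_isFoot hz
  obtain ⟨M, hM⟩ := h.exists_normal y hy.1
  obtain ⟨r, hr, rfl⟩ := h.exists_ray_eq hz hy hM
  refine ⟨_, (hmem _).2 ⟨y, hy.1, M, hM, r - t, ?_, by rw [sub_add_cancel]⟩, hz'⟩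
  have h1 := hzfar y hy.1
  rw [hM.coshDist_ray, Real.cosh_lt_cosh, abs_of_pos hr, abs_of_nonneg ht] at h1
  linarith

end IsSided

end Push

/-! ### Comparison of second fundamental forms -/

section Comparison

variable {T Cm Cp T' Cm' Cp' : Set H3} {x x' p : H3} {N N' : Mink} {U U' : Set Plane}
  {f f' : Plane → Mink} {u u' : Plane}

/-- The numerator of the trace of a quadratic form with respect to another one. -/
theorem IsFrame.trace_shape (h : IsFrame T x N U f u) (w₁ w₂ : Plane) :
    (shape f u N).trace * (formI f u w₁ w₁ * formI f u w₂ w₂ - formI f u w₁ w₂ ^ 2) =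
      formI f u w₁ w₁ * formII f u N w₂ w₂ - 2 * (formI f u w₁ w₂ * formII f u N w₁ w₂) +
        formI f u w₂ w₂ * formII f u N w₁ w₁ := by
  set e₀ : Plane := EuclideanSpace.single 0 1 with he₀
  set e₁ : Plane := EuclideanSpace.single 1 1 with he₁
  have hdet := h.det_pos
  rw [← he₀, ← he₁] at hdet
  have htr : (shape f u N).trace * (formI f u e₀ e₀ * formI f u e₁ e₁ - formI f u e₀ e₁ ^ 2) =
      formI f u e₀ e₀ * formII f u N e₁ e₁ - 2 * (formI f u e₀ e₁ * formII f u N e₀ e₁) +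
        formI f u e₁ e₁ * formII f u N e₀ e₀ := by
    have hI : firstForm f u = !![formI f u e₀ e₀, formI f u e₀ e₁; formI f u e₀ e₁,
        formI f u e₁ e₁] := by
      ext i j
      fin_cases i <;> fin_cases j
      · rfl
      · rfl
      · exact formI_comm f u e₁ e₀
      · rfl
    have hII : secondForm f u N = !![formII f u N e₀ e₀, formII f u N e₀ e₁; formII f u N e₀ e₁,
        formII f u N e₁ e₁] := by
      ext i j
      fin_cases i <;> fin_cases j
      · rfl
      · rfl
      · exact h.formII_comm N e₁ e₀
      · rfl
    rw [shape, hI, hII, Matrix.inv_def, Matrix.det_fin_two_of, Matrix.adjugate_fin_two_of,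
      Ring.inverse_eq_inv', Matrix.smul_mul, Matrix.trace_smul, Matrix.trace_fin_two]
    simp only [Matrix.mul_apply, Fin.sum_univ_two, Matrix.of_apply, Matrix.cons_val', Matrix.cons_val_zero,
      Matrix.cons_val_one, Matrix.cons_val_fin_one, smul_eq_mul]
    rw [← sq, mul_comm, ← mul_assoc, mul_inv_cancel₀ hdet.ne']
    ring
  have hexp : ∀ B : Plane →L[ℝ] Plane →L[ℝ] ℝ, (∀ v w, B v w = B w v) → ∀ v w,
      B v w = v 0 * w 0 * B e₀ e₀ + (v 0 * w 1 + v 1 * w 0) * B e₀ e₁ + v 1 * w 1 * B e₁ e₁ := by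
    intro B hB v w
    conv_lhs => rw [plane_eq v, plane_eq w]
    simp only [map_add, map_smul, add_apply, smul_apply, smul_eq_mul]
    rw [hB e₁ e₀]
    ring
  rw [hexp _ (formI_comm f u) w₁ w₁, hexp _ (formI_comm f u) w₁ w₂, hexp _ (formI_comm f u) w₂ w₂,
    hexp _ (h.formII_comm N) w₁ w₁, hexp _ (h.formII_comm N) w₁ w₂,
    hexp _ (h.formII_comm N) w₂ w₂]
  -- Replacing the standard basis by `w₁, w₂` multiplies both sides by the square of the
  -- determinant.
  linear_combination (w₁ 0 * w₂ 1 - w₁ 1 * w₂ 0) ^ 2 * htr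

/-- A binary quadratic form whose trace with respect to a positive definite form vanishes takes a
nonnegative value. -/
theorem exists_nonneg_of_trace_eq_zero {E F G l m n : ℝ} (hE : 0 < E) (hdet : 0 < E * G - F ^ 2)
    (htr : E * n - 2 * (F * m) + G * l = 0) :
    ∃ a b : ℝ, (a ≠ 0 ∨ b ≠ 0) ∧ 0 ≤ l * a ^ 2 + 2 * m * (a * b) + n * b ^ 2 := by
  by_cases hl : 0 ≤ l
  · exact ⟨1, 0, Or.inl one_ne_zero, by simpa using hl⟩
  · refine ⟨-F, E, Or.inr hE.ne', ?_⟩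
    have e : l * (-F) ^ 2 + 2 * m * (-F * E) + n * E ^ 2 = -((E * G - F ^ 2) * l) := by
      linear_combination E * htr
    rw [e]
    nlinarith

/-- The comparison form is positive definite when the second form is bounded by the first one. -/
theorem comparison_form_pos {I B : Plane →L[ℝ] Plane →L[ℝ] ℝ} (hI : ∀ v w, I v w = I w v)
    (hB : ∀ v w, B v w = B w v) (hlt : ∀ v, v ≠ 0 → |B v v| < I v v) {a b : ℝ} (ha : 1 < a)
    (hb : 0 ≤ b) (hab : b ^ 2 = a ^ 2 - 1) {v w : Plane} (hvw : v ≠ 0 ∨ w ≠ 0) :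
    0 < a * I v v - b * B v v - 2 * I v w + (a * I w w + b * B w w) := by
  -- Half-angle substitution: since `b = k l`, the form becomes a quarter of `(I - B)(P, P) + (I +
  -- B)(M, M)`, and both summands are nonnegative.
  obtain ⟨k, hk, hk2⟩ : ∃ k, 0 < k ∧ k ^ 2 = a - 1 :=
    ⟨√(a - 1), Real.sqrt_pos.2 (by linarith), Real.sq_sqrt (by linarith)⟩
  obtain ⟨l, hl, hl2⟩ : ∃ l, 0 < l ∧ l ^ 2 = a + 1 :=
    ⟨√(a + 1), Real.sqrt_pos.2 (by linarith), Real.sq_sqrt (by linarith)⟩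
  have hkl : b = k * l := by
    refine (sq_eq_sq₀ hb (by positivity)).1 ?_
    rw [mul_pow, hk2, hl2, hab]; ring
  set P : Plane := k • (v + w) + l • (v - w) with hP
  set M : Plane := k • (v + w) - l • (v - w) with hM
  have hPM : P ≠ 0 ∨ M ≠ 0 := by
    by_contra hcon
    push Not at hcon
    have h1 : (2 * k) • (v + w) = 0 := by
      have : P + M = (2 * k) • (v + w) := by rw [hP, hM]; module
      rw [← this, hcon.1, hcon.2, add_zero]
    have h2 : (2 * l) • (v - w) = 0 := by
      have : P - M = (2 * l) • (v - w) := by rw [hP, hM]; module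
      rw [← this, hcon.1, hcon.2, sub_zero]
    have h3 : v + w = 0 := (smul_eq_zero.1 h1).resolve_left (by positivity)
    have h4 : v - w = 0 := (smul_eq_zero.1 h2).resolve_left (by positivity)
    have hv : v = 0 := by
      have : (2 : ℝ) • v = (v + w) + (v - w) := by module
      rw [h3, h4, add_zero] at this
      exact (smul_eq_zero.1 this).resolve_left (by norm_num)
    have hw : w = 0 := by rw [hv, zero_add] at h3; exact h3
    exact hvw.elim (fun h => h hv) fun h => h hw
  have e : a * I v v - b * B v v - 2 * I v w + (a * I w w + b * B w w) =
      1 / 4 * ((I P P - B P P) + (I M M + B M M)) := by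
    rw [hP, hM]
    simp only [map_add, map_sub, map_smul, add_apply, sub_apply, smul_apply, smul_eq_mul, hI w v,
      hB w v]
    rw [hkl]
    linear_combination (-1 / 2 * (I v v + 2 * I v w + I w w)) * hk2 +
      (-1 / 2 * (I v v - 2 * I v w + I w w)) * hl2
  rw [e]
  have hnn : ∀ v, 0 ≤ I v v - B v v ∧ 0 ≤ I v v + B v v := by
    intro v
    by_cases hv : v = 0
    · simp [hv]
    · have := abs_lt.1 (hlt v hv)
      exact ⟨by linarith, by linarith⟩
  rcases hPM with h | h
  · have h1 := abs_lt.1 (hlt P h)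
    have := (hnn M).2
    linarith
  · have h1 := abs_lt.1 (hlt M h)
    have := (hnn P).1
    linarith

/-- Second derivative test for the distance between a point of a surface and a point of a curve on
another surface. -/
theorem eventually_neg_mink_lt (hf : IsFrame T x N U f u) (hf' : IsFrame T' x' N' U' f' u')
    (hcrit : ∀ v, mink (fderiv ℝ f u v) x'.1 = 0) (hcrit' : ∀ v, mink (fderiv ℝ f' u' v) x.1 = 0)
    {v₀ : Plane} (hpos : ∀ w : Plane × ℝ, w ≠ 0 →
      mink (fderiv ℝ (fderiv ℝ f) u w.1 w.1) x'.1 +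
        2 * w.2 * mink (fderiv ℝ f u w.1) (fderiv ℝ f' u' v₀) +
        w.2 ^ 2 * mink (fderiv ℝ (fderiv ℝ f') u' v₀ v₀) x.1 < 0) :
    ∀ᶠ q in 𝓝 (0 : Plane × ℝ), q ≠ 0 →
      -mink x.1 x'.1 < -mink (f (u + q.1)) (f' (u' + q.2 • v₀)) := by
  -- The second surface enters only through the line of direction `v₀`, because the second forms are
  -- compared in one direction only.
  let A : (Plane × ℝ) →L[ℝ] Plane := ContinuousLinearMap.fst ℝ Plane ℝ
  let A' : (Plane × ℝ) →L[ℝ] Plane := (ContinuousLinearMap.snd ℝ Plane ℝ).smulRight v₀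
  have hA : ∀ q, HasFDerivAt (fun q => u + A q) A q := fun q => A.hasFDerivAt.const_add u
  have hA' : ∀ q, HasFDerivAt (fun q => u' + A' q) A' q := fun q => A'.hasFDerivAt.const_add u'
  have hAt : ∀ᶠ q in 𝓝 (0 : Plane × ℝ), u + A q ∈ U := by
    have : Tendsto (fun q => u + A q) (𝓝 0) (𝓝 (u + A 0)) := (hA 0).continuousAt
    rw [map_zero, add_zero] at this
    exact this.eventually (hf.param.eventually_mem hf.mem)
  have hAt' : ∀ᶠ q in 𝓝 (0 : Plane × ℝ), u' + A' q ∈ U' := by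
    have : Tendsto (fun q => u' + A' q) (𝓝 0) (𝓝 (u' + A' 0)) := (hA' 0).continuousAt
    rw [map_zero, add_zero] at this
    exact this.eventually (hf'.param.eventually_mem hf'.mem)
  have h0 : u + A 0 = u := by rw [map_zero, add_zero]
  have h0' : u' + A' 0 = u' := by rw [map_zero, add_zero]
  have hF : ∀ q, u + A q ∈ U →
      HasFDerivAt (fun q => f (u + A q)) ((fderiv ℝ f (u + A q)).comp A) q :=
    fun q hq => (hf.param.hasFDerivAt hq).comp q (hA q)
  have hF' : ∀ q, u' + A' q ∈ U' →
      HasFDerivAt (fun q => f' (u' + A' q)) ((fderiv ℝ f' (u' + A' q)).comp A') q :=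
    fun q hq => (hf'.param.hasFDerivAt hq).comp q (hA' q)
  have hD : HasFDerivAt (fun q => fderiv ℝ f (u + A q)) ((fderiv ℝ (fderiv ℝ f) u).comp A) 0 := by
    refine HasFDerivAt.comp (g := fderiv ℝ f) 0 ?_ (hA 0)
    rw [h0]
    exact hf.param.hasFDerivAt_fderiv hf.mem
  have hD' : HasFDerivAt (fun q => fderiv ℝ f' (u' + A' q))
      ((fderiv ℝ (fderiv ℝ f') u').comp A') 0 := by
    refine HasFDerivAt.comp (g := fderiv ℝ f') 0 ?_ (hA' 0)
    rw [h0']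
    exact hf'.param.hasFDerivAt_fderiv hf'.mem
  let g' : Plane × ℝ → (Plane × ℝ) →L[ℝ] ℝ := fun q =>
    -((minkL (f (u + A q))).comp ((fderiv ℝ f' (u' + A' q)).comp A') +
      (minkL.flip (f' (u' + A' q))).comp ((fderiv ℝ f (u + A q)).comp A))
  have h1 : ∀ᶠ q in 𝓝 (0 : Plane × ℝ),
      HasFDerivAt (fun q => -mink (f (u + A q)) (f' (u' + A' q))) (g' q) q := by
    filter_upwards [hAt, hAt'] with q hq hq'
    exact (minkL.hasFDerivAt_of_bilinear (hF q hq) (hF' q hq')).neg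
  have hm : HasFDerivAt (fun q => minkL (f (u + A q))) (minkL.comp ((fderiv ℝ f u).comp A)) 0 := by
    have h2 := hF 0 (by rw [h0]; exact hf.mem)
    rw [h0] at h2
    exact minkL.hasFDerivAt.comp 0 h2
  have hm' : HasFDerivAt (fun q => minkL.flip (f' (u' + A' q)))
      (minkL.flip.comp ((fderiv ℝ f' u').comp A')) 0 := by
    have h2 := hF' 0 (by rw [h0']; exact hf'.mem)
    rw [h0'] at h2
    exact minkL.flip.hasFDerivAt.comp 0 h2
  have hDA : HasFDerivAt (fun q => (fderiv ℝ f (u + A q)).comp A)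
      (((ContinuousLinearMap.compL ℝ (Plane × ℝ) Plane Mink).flip A).comp
        ((fderiv ℝ (fderiv ℝ f) u).comp A)) 0 :=
    ((ContinuousLinearMap.compL ℝ (Plane × ℝ) Plane Mink).flip A).hasFDerivAt.comp 0 hD
  have hDA' : HasFDerivAt (fun q => (fderiv ℝ f' (u' + A' q)).comp A')
      (((ContinuousLinearMap.compL ℝ (Plane × ℝ) Plane Mink).flip A').comp
        ((fderiv ℝ (fderiv ℝ f') u').comp A')) 0 :=
    ((ContinuousLinearMap.compL ℝ (Plane × ℝ) Plane Mink).flip A').hasFDerivAt.comp 0 hD'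
  have h2 := ((hm.clm_comp hDA').add (hm'.clm_comp hDA)).neg
  have h3 := eventually_lt_of_second_fderiv_pos (g' := g') h1 h2 (by
    refine ContinuousLinearMap.ext fun w => ?_
    change -(mink (f (u + A 0)) (fderiv ℝ f' (u' + A' 0) (A' w)) +
      mink (fderiv ℝ f (u + A 0) (A w)) (f' (u' + A' 0))) = 0
    rw [h0, h0', hf.eq, hf'.eq, hcrit, mink_comm, hcrit']
    simp) (fun w hw => by
    change 0 < -((mink (f (u + A 0)) (fderiv ℝ (fderiv ℝ f') u' (A' w) (A' w)) +
        mink (fderiv ℝ f u (A w)) (fderiv ℝ f' (u' + A' 0) (A' w))) +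
      (mink (fderiv ℝ (fderiv ℝ f) u (A w) (A w)) (f' (u' + A' 0)) +
        mink (fderiv ℝ f (u + A 0) (A w)) (fderiv ℝ f' u' (A' w))))
    rw [h0, h0', hf.eq, hf'.eq]
    have h4 := hpos w hw
    change 0 < -((mink x.1 (fderiv ℝ (fderiv ℝ f') u' (w.2 • v₀) (w.2 • v₀)) +
        mink (fderiv ℝ f u w.1) (fderiv ℝ f' u' (w.2 • v₀))) +
      (mink (fderiv ℝ (fderiv ℝ f) u w.1 w.1) x'.1 +
        mink (fderiv ℝ f u w.1) (fderiv ℝ f' u' (w.2 • v₀))))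
    simp only [map_smul, smul_apply, mink_smul_right]
    rw [mink_comm x.1]
    linarith)
  rw [h0, h0', hf.eq, hf'.eq] at h3
  exact h3

end Comparison

/-! ### The maximum principle for the distance between the surfaces -/

section MaximumPrinciple

variable {T Cm Cp T' Cm' Cp' : Set H3} {x x' : H3} {N N' : Mink} {U U' : Set Plane}
  {f f' : Plane → Mink} {u u' : Plane}

/-- The shape operator with respect to the normal pointing from `Cm` to `Cp` has trace `c`. -/
def HasTrace (T Cm Cp : Set H3) (c : ℝ) : Prop :=
  ∀ x ∈ T, ∃ N, IsNormalFromTo T Cm Cp x N ∧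
    ∀ U f u, IsFrame T x N U f u → (shape f u N).trace = c

theorem shape_neg (f : Plane → Mink) (u : Plane) (N : Mink) : shape f u (-N) = -shape f u N := by
  have : secondForm f u (-N) = -secondForm f u N := by
    ext i j
    simp [secondForm, mink_neg_right]
  rw [shape, this, Matrix.mul_neg, shape]

theorem HasTrace.symm {c : ℝ} (h : HasTrace T Cm Cp c) : HasTrace T Cp Cm (-c) := by
  intro x hx
  obtain ⟨N, hN, htr⟩ := h x hx
  refine ⟨-N, hN.neg, fun U f u hf => ?_⟩
  rw [shape_neg, Matrix.trace_neg, htr U f u ⟨hf.param, hf.mem, hf.eq, hN.isUnitNormal⟩]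

theorem IsFrame.hasDerivAt_line (hf : IsFrame T x N U f u) (v : Plane) :
    HasDerivAt (fun s : ℝ => f (u + s • v)) (fderiv ℝ f u v) 0 := by
  have h1 : HasDerivAt (fun s : ℝ => u + s • v) v 0 := by
    simpa using ((hasDerivAt_id (0 : ℝ)).smul_const v).const_add u
  have h2 : HasFDerivAt f (fderiv ℝ f u) (u + (0 : ℝ) • v) := by
    simpa using hf.param.hasFDerivAt hf.mem
  exact h2.comp_hasDerivAt 0 h1

/-- If the distance to `T` is maximal on `T'` at `x'`, with foot `x`, then points of `T'` on a
curve through `x'` have feet close to `x`, at a distance which is not larger. -/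
theorem IsSided.exists_feet_along_curve (h : IsSided T Cm Cp) (hT : HasSmallCurvatures T)
    (hx'p : x' ∈ Cp) (hx : IsFoot T x' x)
    (hmax : ∀ y ∈ T', ∃ a ∈ T, coshDist y a ≤ coshDist x' x) (hf' : IsFrame T' x' N' U' f' u')
    (v : Plane) :
    ∃ Z : ℝ → H3, Tendsto Z (𝓝[>] 0) (𝓝 x) ∧ ∀ᶠ s in 𝓝[>] (0 : ℝ), Z s ∈ T ∧
      -mink (Z s).1 (f' (u' + s • v)) ≤ -mink x.1 x'.1 := by
  let Y : ℝ → H3 := fun s => spatialHomeo.symm (spatial (f' (u' + s • v)))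
  have hline : Tendsto (fun s : ℝ => u' + s • v) (𝓝[>] 0) (𝓝 u') := by
    have : Continuous fun s : ℝ => u' + s • v := by fun_prop
    simpa using (this.tendsto 0).mono_left nhdsWithin_le_nhds
  have hY : ∀ᶠ s in 𝓝[>] (0 : ℝ), Y s ∈ T' ∧ (Y s).1 = f' (u' + s • v) := by
    filter_upwards [hline.eventually (hf'.param.eventually_mem hf'.mem)] with s hs
    obtain ⟨y, hy, hyf⟩ := hf'.param.exists_mem hs
    have : Y s = y := by
      simp only [Y]
      rw [hyf]
      exact spatialHomeo.symm_apply_apply y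
    rw [this]
    exact ⟨hy, hyf.symm⟩
  have hYlim : Tendsto Y (𝓝[>] 0) (𝓝 x') := by
    have h1 : Tendsto (fun s : ℝ => f' (u' + s • v)) (𝓝[>] 0) (𝓝 x'.1) := by
      rw [← hf'.eq]
      exact (hf'.param.hasFDerivAt hf'.mem).continuousAt.tendsto.comp hline
    have h2 : Tendsto Y (𝓝[>] 0) (𝓝 (spatialHomeo.symm (spatial x'.1))) :=
      ((spatialHomeo.symm.continuous.comp spatial.continuous).tendsto x'.1).comp h1
    rwa [show spatialHomeo.symm (spatial x'.1) = x' from spatialHomeo.symm_apply_apply x'] at h2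
  have hYC : ∀ᶠ s in 𝓝[>] (0 : ℝ), Y s ∈ Cp := hYlim.eventually (h.isOpen_pos.mem_nhds hx'p)
  choose! foot hfoot using fun p (hp : p ∈ Cp) => h.exists_isFoot hp
  refine ⟨fun s => foot (Y s), h.tendsto_isFoot hT hx'p hx hYlim
    (hYC.mono fun s hs => hfoot _ hs), ?_⟩
  filter_upwards [hY, hYC] with s hs hsC
  refine ⟨(hfoot _ hsC).1, ?_⟩
  obtain ⟨a, ha, hle⟩ := hmax _ hs.1
  rw [← hs.2]
  exact ((hfoot _ hsC).2 a ha).trans hle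

/-- Envelope argument. For `y` on a curve through `x'` with foot `z`, maximality gives `-⟨z, y⟩ ≤
-⟨x, x'⟩ ≤ -⟨z, x'⟩`, so `⟨z, y - x'⟩ ≥ 0`. Dividing by the parameter and letting `z` tend to `x`
gives one inequality; reversing the curve gives the other. -/
theorem IsSided.critical_of_max (h : IsSided T Cm Cp) (hT : HasSmallCurvatures T)
    (hx'p : x' ∈ Cp) (hx : IsFoot T x' x)
    (hmax : ∀ y ∈ T', ∃ a ∈ T, coshDist y a ≤ coshDist x' x) (hf' : IsFrame T' x' N' U' f' u')
    (v : Plane) : mink (fderiv ℝ f' u' v) x.1 = 0 := by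
  have key : ∀ v, 0 ≤ mink x.1 (fderiv ℝ f' u' v) := by
    intro v
    obtain ⟨Z, hZ, hev⟩ := h.exists_feet_along_curve hT hx'p hx hmax hf' v
    have h1 := (hf'.hasDerivAt_line v).tendsto_slope_zero_right
    have h2 : Tendsto (fun s : ℝ => mink (Z s).1 (s⁻¹ • (f' (u' + (0 + s) • v) -
        f' (u' + (0 : ℝ) • v)))) (𝓝[>] 0) (𝓝 (mink x.1 (fderiv ℝ f' u' v))) :=
      (continuous_mink.tendsto (x.1, fderiv ℝ f' u' v)).comp
        (((continuous_subtype_val.tendsto x).comp hZ).prodMk_nhds h1)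
    refine ge_of_tendsto h2 ?_
    filter_upwards [hev, self_mem_nhdsWithin] with s hs hs0
    have h3 : coshDist x' x ≤ coshDist x' (Z s) := hx.2 _ hs.1
    rw [zero_add, zero_smul, add_zero, hf'.eq, mink_smul_right, mink_sub_right]
    change -mink x.1 x'.1 ≤ -mink (Z s).1 x'.1 at h3
    have h4 : 0 < s⁻¹ := inv_pos.2 hs0
    exact mul_nonneg h4.le (by linarith [hs.2])
  have h1 := key v
  have h2 := key (-v)
  rw [map_neg, mink_neg_right] at h2
  rw [mink_comm]
  linarith

/-- The maximum principle: the distance from `T'` to a surface `T` with small curvatures and the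
same constant mean curvature has no maximum on the positive side of `T`. -/
theorem IsSided.not_max (h : IsSided T Cm Cp) (hT : HasSmallCurvatures T)
    (h' : IsSided T' Cm' Cp') {c : ℝ} (htr : HasTrace T Cm Cp c) (htr' : HasTrace T' Cm' Cp' c)
    (hx' : x' ∈ T') (hx'p : x' ∈ Cp) (hx : IsFoot T x' x)
    (hmax : ∀ y ∈ T', ∃ a ∈ T, coshDist y a ≤ coshDist x' x)
    (hfar : ∃ z ∈ Cp ∩ Cp', ∀ a ∈ T, coshDist x' x < coshDist z a) : False := by
  obtain ⟨N, hN, hNtr⟩ := htr x hx.1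
  obtain ⟨N', hN', hNtr'⟩ := htr' x' hx'
  obtain ⟨U, f, u, hf⟩ := h.isSurface.exists_isFrame hx.1 hN.isUnitNormal
  obtain ⟨U', f', u', hf'⟩ := h'.isSurface.exists_isFrame hx' hN'.isUnitNormal
  obtain ⟨hcrit, hbpos⟩ := h.critical_of_isFoot hx'p hx hf hN
  have hcrit' := h.critical_of_max hT hx'p hx hmax hf'
  obtain ⟨t, ht, htx'⟩ := h.exists_ray_eq hx'p hx hN
  have hdist : coshDist x' x = Real.cosh t := by rw [← htx', hN.coshDist_ray]
  have hxx' : mink x.1 x'.1 = -Real.cosh t := by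
    rw [← hdist, coshDist, neg_neg]
  have hNx' : mink N x'.1 = Real.sinh t := by
    rw [← htx', hN.coe_ray, mink_add_right, mink_smul_right, mink_smul_right, mink_comm N x.1,
      hN.isUnitNormal.tangent, hN.isUnitNormal.unit]
    ring
  have hsinh := Real.sinh_pos_iff.2 ht
  have hcosh := Real.one_lt_cosh.2 ht.ne'
  have hcs := Real.cosh_sq t
  -- the normal of `T'` at `x'` points away from `x`
  have hN'x : mink N' x.1 = -Real.sinh t := by
    have h1 := hf'.sq_eq hcrit'
    have h2 := hf'.eq_combination hcrit'
    rw [mink_comm x'.1, hxx'] at h1 h2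
    have h3 : mink N' x.1 ^ 2 = Real.sinh t ^ 2 := by nlinarith
    refine (sq_eq_sq_iff_eq_or_eq_neg.1 h3).resolve_left fun h4 => ?_
    rw [h4, neg_neg] at h2
    have hNe : N' = -(Real.sinh t • x.1 + Real.cosh t • N) := by
      have h5 : Real.sinh t • N' = Real.sinh t • -(Real.sinh t • x.1 + Real.cosh t • N) := by
        have h6 : Real.sinh t • N' = x.1 - Real.cosh t • x'.1 := by
          rw [eq_sub_iff_add_eq, add_comm]
          exact h2.symm
        rw [h6, ← htx', hN.coe_ray]
        have h7 : Real.cosh t • Real.cosh t • x.1 = x.1 + Real.sinh t • Real.sinh t • x.1 := by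
          rw [smul_smul, smul_smul, ← sq, ← sq, hcs]
          module
        rw [smul_add, h7]
        module
      exact smul_right_injective _ hsinh.ne' h5
    -- With the opposite normal, points just beyond `x'` on the ray would lie in `Cm'` by the choice
    -- of `N'`, but in `Cp'` because the region far from `T` is connected.
    obtain ⟨s, hs, hs0⟩ := (hN'.eventually.and self_mem_nhdsWithin).exists
    obtain ⟨y, hy, hsy⟩ := hs.2
    have h8 : hN.ray (s + t) ∈ Cp' := h.ray_mem_of_dist_le hT h' ht.le
      (by rwa [← hdist]) (by rwa [← hdist]) hx.1 hN hs0
    have h9 : hN.ray (s + t) = y := by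
      apply Subtype.ext
      rw [← hsy, geo, ← htx', hN.coe_ray, hN.coe_ray, hNe, Real.cosh_neg, Real.sinh_neg,
        Real.cosh_add, Real.sinh_add]
      module
    exact Set.disjoint_left.1 h'.disjoint (h9 ▸ h8) hy
  -- the tangent planes at `x` and `x'` agree
  have hplane : ∀ v, ∃ w, fderiv ℝ f' u' v = fderiv ℝ f u w := by
    intro v
    obtain ⟨w, hw⟩ := exists_decomposition x hf.normal.tangent hf.normal.unit hf.injective
      hf.mink_fderiv hf.mink_fderiv_normal (fderiv ℝ f' u' v)
    have h1 : mink x.1 (fderiv ℝ f' u' v) = 0 := by rw [mink_comm, hcrit']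
    have h2 : mink N (fderiv ℝ f' u' v) = 0 := by
      have h3 := hf'.mink_fderiv v
      rw [← htx', hN.coe_ray, mink_add_left, mink_smul_left, mink_smul_left, h1, mul_zero,
        zero_add] at h3
      exact (mul_eq_zero.1 h3).resolve_left hsinh.ne'
    rw [h1, h2, neg_zero, zero_smul, zero_smul, zero_add, zero_add] at hw
    exact ⟨w, hw⟩
  set e₀ : Plane := EuclideanSpace.single 0 1 with he₀
  set e₁ : Plane := EuclideanSpace.single 1 1 with he₁
  obtain ⟨w₀, hw₀⟩ := hplane e₀
  obtain ⟨w₁, hw₁⟩ := hplane e₁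
  -- a direction in which the second form of `T'` is at least the one of `T`
  obtain ⟨v, w, hv0, hvw, hII⟩ : ∃ v w, v ≠ 0 ∧ fderiv ℝ f' u' v = fderiv ℝ f u w ∧
      formII f u N w w ≤ formII f' u' N' v v := by
    have ht1 := hf.trace_shape w₀ w₁
    have ht2 := hf'.trace_shape e₀ e₁
    rw [hNtr U f u hf] at ht1
    rw [hNtr' U' f' u' hf'] at ht2
    have hI00 : formI f' u' e₀ e₀ = formI f u w₀ w₀ := by rw [formI_apply, hw₀, formI_apply]
    have hI01 : formI f' u' e₀ e₁ = formI f u w₀ w₁ := by rw [formI_apply, hw₀, hw₁, formI_apply]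
    have hI11 : formI f' u' e₁ e₁ = formI f u w₁ w₁ := by rw [formI_apply, hw₁, formI_apply]
    have hdet := hf'.det_pos
    rw [← he₀, ← he₁] at hdet
    have hE : 0 < formI f' u' e₀ e₀ := hf'.formI_pos (by simp [he₀])
    -- The difference of the two second forms on the common tangent plane has trace zero, the mean
    -- curvatures being equal.
    obtain ⟨a, b, hab, hnn⟩ := exists_nonneg_of_trace_eq_zero hE hdet
      (l := formII f' u' N' e₀ e₀ - formII f u N w₀ w₀)
      (m := formII f' u' N' e₀ e₁ - formII f u N w₀ w₁)
      (n := formII f' u' N' e₁ e₁ - formII f u N w₁ w₁) (by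
        rw [hI00, hI01, hI11] at ht2 ⊢
        linarith)
    refine ⟨a • e₀ + b • e₁, a • w₀ + b • w₁, ?_, ?_, ?_⟩
    · intro h0
      have h1 := congrArg (fun q : Plane => q 0) h0
      have h2 := congrArg (fun q : Plane => q 1) h0
      simp [he₀, he₁] at h1 h2
      exact hab.elim (fun h => h h1) fun h => h h2
    · rw [map_add, map_smul, map_smul, hw₀, hw₁, map_add, map_smul, map_smul]
    · simp only [map_add, map_smul, add_apply, smul_apply, smul_eq_mul]
      rw [hf.formII_comm N w₁ w₀, hf'.formII_comm N' e₁ e₀]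
      nlinarith
  have hw0 : w ≠ 0 := by
    rintro rfl
    rw [map_zero] at hvw
    exact hv0 (hf'.injective (hvw.trans (map_zero _).symm))
  -- The negated Hessian at `(α, β)` is minus the comparison form at `α, β w`, minus `β² sinh t`
  -- times the nonnegative gap between the second forms.
  have hloc := eventually_neg_mink_lt hf hf' hcrit hcrit' (v₀ := v) (by
    rintro ⟨α, β⟩ hαβ
    have h1 := hf.mink_fderiv_fderiv_eq hcrit α
    have h2 := hf'.mink_fderiv_fderiv_eq hcrit' v
    rw [hxx', hNx'] at h1
    rw [mink_comm x'.1, hxx', hN'x] at h2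
    simp only
    rw [h1, h2, hvw, ← formI_apply]
    have hI : formI f' u' v v = formI f u w w := by rw [formI_apply, hvw, formI_apply]
    rw [hI]
    have hne : α ≠ 0 ∨ β • w ≠ 0 := by
      by_contra hcon
      push Not at hcon
      exact hαβ (Prod.ext hcon.1 ((smul_eq_zero.1 hcon.2).resolve_right hw0))
    have h3 := comparison_form_pos (formI_comm f u) (hf.formII_comm N)
      (fun v hv => hf.abs_formII_lt hT hx.1 hv) hcosh hsinh.le (by linarith) hne
    simp only [map_smul, smul_apply, smul_eq_mul] at h3
    have h4 : 0 ≤ β ^ 2 * (Real.sinh t * (formII f' u' N' v v - formII f u N w w)) := by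
      have := sub_nonneg.2 hII
      positivity
    nlinarith)
  -- Feet of points on the curve provide pairs close to `(x, x')`, different from it and at no
  -- larger distance, against the strict local minimum.
  obtain ⟨Z, hZ, hev⟩ := h.exists_feet_along_curve hT hx'p hx hmax hf' v
  obtain ⟨V, hV, W, hW, hVW⟩ := mem_nhds_prod_iff.1
    (show {q : Plane × ℝ | q ≠ 0 → -mink x.1 x'.1 < -mink (f (u + q.1)) (f' (u' + q.2 • v))} ∈
      𝓝 ((0 : Plane), (0 : ℝ)) from hloc)
  have hVn : ∀ᶠ q in 𝓝 (0 : Plane × ℝ), q.1 ∈ V := continuous_fst.continuousAt hV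
  have himg := hf.image_chart_mem_nhds (hVn.and (hf.eventually_chart_mem_iff.and
    hf.eventually_add_mem))
  have hWn : ∀ᶠ s in 𝓝[>] (0 : ℝ), s ∈ W := nhdsWithin_le_nhds hW
  have hpos : ∀ᶠ s in 𝓝[>] (0 : ℝ), 0 < s := self_mem_nhdsWithin
  obtain ⟨s, hs, hsW, hs0, hsZ⟩ := (hev.and (hWn.and (hpos.and (hZ.eventually himg)))).exists
  obtain ⟨⟨α, r⟩, ⟨hα, hiff, hU⟩, hαZ⟩ := hsZ
  have hr : r = 0 := hiff.1 (hαZ ▸ hs.1)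
  subst hr
  have h1 := hVW (Set.mk_mem_prod hα hsW) fun h0 => (ne_of_gt hs0) (congrArg Prod.snd h0)
  simp only at h1
  rw [← hf.coe_chart_surface hU, hαZ] at h1
  exact absurd hs.2 (not_le.2 h1)

end MaximumPrinciple

/-! ### Uniqueness of the surface -/

section Uniqueness

variable {Γ : Subgroup PSL2C} {T T' Cm Cp Cm' Cp' : Set H3}

/-- The distance to `T` is invariant under `Γ`, so its maximum over `T'` may be sought in a compact
set. An infimum of continuous functions is upper semicontinuous, which suffices. -/
theorem exists_max_coshDist (hT : IsCocompactSet Γ T) (hne : T.Nonempty)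
    (hT' : IsCocompactSet Γ T') (hne' : T'.Nonempty) :
    ∃ x' ∈ T', ∃ x, IsFoot T x' x ∧ ∀ y ∈ T', ∃ a ∈ T, coshDist y a ≤ coshDist x' x := by
  choose foot hfoot hmin using fun p => exists_isMinOn_coshDist hT.isClosed hne p
  obtain ⟨K, hK, hKT⟩ := hT'.exists_compact
  have husc : UpperSemicontinuous fun y => coshDist y (foot y) := by
    intro y c hc
    have h1 : ∀ᶠ z in 𝓝 y, coshDist z (foot y) < c := by
      simp only [coshDist_comm _ (foot y)] at hc ⊢
      exact (continuous_coshDist (foot y)).continuousAt.eventually (gt_mem_nhds hc)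
    exact h1.mono fun z hz => (hmin z _ (hfoot y)).trans_lt hz
  obtain ⟨y₀, hy₀⟩ := hne'
  obtain ⟨γ₀, hγ₀⟩ := hKT y₀ hy₀
  have hKne : (K ∩ T').Nonempty := ⟨γ₀ • y₀, hγ₀, hT'.smul_mem γ₀ y₀ hy₀⟩
  obtain ⟨x', hx', hmax⟩ := (husc.upperSemicontinuousOn (K ∩ T')).exists_isMaxOn hKne
    (hK.inter_right hT'.isClosed)
  refine ⟨x', hx'.2, foot x', ⟨hfoot x', hmin x'⟩, fun y hy => ?_⟩
  obtain ⟨γ, hγ⟩ := hKT y hy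
  refine ⟨γ⁻¹ • foot (γ • y), hT.smul_mem _ _ (hfoot _), ?_⟩
  have h1 : coshDist y (γ⁻¹ • foot (γ • y)) = coshDist (γ • y) (foot (γ • y)) := by
    have := mink_smul_smul_coe γ (γ⁻¹ • foot (γ • y)) y
    rw [smul_inv_smul] at this
    rw [coshDist, coshDist, this]
  rw [h1]
  have h2 : γ • y ∈ K ∩ T' := ⟨hγ, hT'.smul_mem γ y hy⟩
  exact hmax h2

/-- The mean curvature hypothesis supplies components separately at each point of `T`. They are the
same at all points: near a point of `Ω` the set `T` is absent, so two components with `Ω` in their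
closures share points there. -/
theorem exists_isSided {Ωp Ωm : Set Bdry} {H : ℝ} (hT : IsCocompactSet Γ T) (hne : T.Nonempty)
    (hsurf : IsSurface T) (hΩ : AreDomains Γ Ωp Ωm) (hH : HasMeanCurvature T Ωp Ωm H) :
    ∃ Cm Cp, IsSided T Cm Cp ∧ ClosureContains Cp Ωp ∧ ClosureContains Cm Ωm ∧
      HasTrace T Cm Cp (2 * H) := by
  have huniq : ∀ {Ω : Set Bdry}, IsComponent (limitSet Γ)ᶜ Ω → ∀ C D, IsComponent Tᶜ C →
      IsComponent Tᶜ D → ClosureContains C Ω → ClosureContains D Ω → C = D := by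
    intro Ω hΩ C D hC hD hCΩ hDΩ
    obtain ⟨ω, hω⟩ := hΩ.nonempty
    obtain ⟨r, hr, hdis⟩ := hT.exists_nearInfinity_disjoint (hΩ.subset hω)
    obtain ⟨y, hy, hyC⟩ := hCΩ.exists_mem hω hr
    exact hC.eq_of_inter hD ⟨y, nearInfinity_subset hD hDΩ hω hr hdis hy, hyC⟩
  obtain ⟨x, hx⟩ := hne
  obtain ⟨N, ⟨hN, Cp, Cm, hCp, hCm, hpm, hp, hm, -⟩, -⟩ := hH x hx
  have key : HasTrace T Cm Cp (2 * H) := by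
    intro y hy
    obtain ⟨M, ⟨hM, Dp, Dm, hDp, hDm, -, hp', hm', hev⟩, htr⟩ := hH y hy
    rw [huniq hΩ.pos Dp Cp hDp hCp hp' hp, huniq hΩ.neg Dm Cm hDm hCm hm' hm] at hev
    refine ⟨M, ⟨hM, hev⟩, fun U f u hf => ?_⟩
    have := htr U f hf.param u hf.mem hf.eq
    linarith
  refine ⟨Cm, Cp, ⟨hT.isClosed, hsurf, hCp, hCm, hpm, fun y hy => ?_⟩, hp, hm, key⟩
  obtain ⟨M, hM, -⟩ := key y hy
  exact ⟨M, hM⟩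

theorem exists_far_mem {Ω : Set Bdry} (hΩ : IsComponent (limitSet Γ)ᶜ Ω)
    (hT : IsCocompactSet Γ T) (hT' : IsCocompactSet Γ T') (hC : IsComponent Tᶜ Cp)
    (hC' : IsComponent T'ᶜ Cp') (hp : ClosureContains Cp Ω) (hp' : ClosureContains Cp' Ω) (c : ℝ) :
    ∃ z ∈ Cp ∩ Cp', ∀ a ∈ T, c < coshDist z a := by
  obtain ⟨ω, hω⟩ := hΩ.nonempty
  obtain ⟨r, hr, hdis⟩ := hT.exists_nearInfinity_disjoint (hΩ.subset hω)
  obtain ⟨r', hr', hdis'⟩ := hT'.exists_nearInfinity_disjoint (hΩ.subset hω)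
  obtain ⟨s, hs, hsr, hfar⟩ := exists_nearInfinity_far hr hdis c
  obtain ⟨z, hz, -⟩ := hp.exists_mem hω (lt_min hs hr')
  refine ⟨z, ⟨nearInfinity_subset hC hp hω hr hdis
    (nearInfinity_mono ω ((min_le_left _ _).trans hsr) hz),
    nearInfinity_subset hC' hp' hω hr' hdis' (nearInfinity_mono ω (min_le_right _ _) hz)⟩,
    fun a ha => ?_⟩
  rw [coshDist_comm]
  exact hfar z (nearInfinity_mono ω (min_le_left _ _) hz) a ha

/-- The sides of `T` lie in the corresponding sides of `T'`. A point of `T` is a limit of both sides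
of `T`, so it cannot be in either open side of `T'`. -/
theorem IsSided.eq_of_subset (h : IsSided T Cm Cp) (h' : IsSided T' Cm' Cp') (hsub : T' ⊆ T)
    (hp : (Cp ∩ Cp').Nonempty) (hm : (Cm ∩ Cm').Nonempty) : T = T' := by
  refine Set.Subset.antisymm (fun x hx => ?_) hsub
  have hps : Cp ⊆ Cp' := h'.pos.subset_of_inter h.pos.isPreconnected
    (h.pos.subset.trans (Set.compl_subset_compl.2 hsub)) hp
  have hms : Cm ⊆ Cm' := h'.neg.subset_of_inter h.neg.isPreconnected
    (h.neg.subset.trans (Set.compl_subset_compl.2 hsub)) hm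
  have hu : x ∈ Cp' ∪ (Cm' ∪ T') := h'.union_eq_univ ▸ Set.mem_univ x
  rcases hu with hu | hu | hu
  · obtain ⟨y, hy, hyC⟩ := mem_closure_iff.1 (h.subset_closure_neg hx) _ h'.isOpen_pos hu
    exact absurd (hms hyC) (Set.disjoint_left.1 h'.disjoint hy)
  · obtain ⟨y, hy, hyC⟩ := mem_closure_iff.1 (h.subset_closure_pos hx) _ h'.isOpen_neg hu
    exact absurd hy (Set.disjoint_left.1 h'.disjoint (hps hyC))
  · exact hu

/-- Uniqueness of the surface with small curvatures, on the level of universal covers. -/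
theorem eq_of_hasMeanCurvature {Ωp Ωm : Set Bdry} {H : ℝ} (hΩ : AreDomains Γ Ωp Ωm)
    (hT : IsCocompactSet Γ T) (hne : T.Nonempty) (hsurf : IsSurface T)
    (hT' : IsCocompactSet Γ T') (hne' : T'.Nonempty) (hsurf' : IsSurface T')
    (hH : HasMeanCurvature T Ωp Ωm H) (hH' : HasMeanCurvature T' Ωp Ωm H)
    (hsmall : HasSmallCurvatures T) : T = T' := by
  obtain ⟨Cm, Cp, h, hp, hm, htr⟩ := exists_isSided hT hne hsurf hΩ hH
  obtain ⟨Cm', Cp', h', hp', hm', htr'⟩ := exists_isSided hT' hne' hsurf' hΩ hH'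
  obtain ⟨x', hx', x, hx, hmax⟩ := exists_max_coshDist hT hne hT' hne'
  have hfar := exists_far_mem hΩ.pos hT hT' h.pos h'.pos hp hp' (coshDist x' x)
  have hfar' := exists_far_mem hΩ.neg hT hT' h.neg h'.neg hm hm' (coshDist x' x)
  have hx'T : x' ∈ T := by
    have hu : x' ∈ Cp ∪ (Cm ∪ T) := h.union_eq_univ ▸ Set.mem_univ x'
    rcases hu with hu | hu | hu
    · exact (h.not_max hsmall h' htr htr' hx' hu hx hmax hfar).elim
    · exact (h.symm.not_max hsmall h'.symm htr.symm htr'.symm hx' hu hx hmax hfar').elim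
    · exact hu
  refine h.eq_of_subset h' (fun y hy => ?_) ?_ ?_
  · obtain ⟨a, ha, hle⟩ := hmax y hy
    -- The farthest point of `T'` is on `T`, so the maximal distance is zero.
    have h1 : coshDist x' x ≤ 1 := by
      refine (hx.2 x' hx'T).trans ?_
      rw [coshDist, x'.2.1, neg_neg]
    have h2 : y = a := eq_of_neg_mink_le_one ((coshDist_comm a y ▸ hle.trans h1 :))
    exact h2 ▸ ha
  · obtain ⟨z, hz, -⟩ := hfar
    exact ⟨z, hz⟩
  · obtain ⟨z, hz, -⟩ := hfar'
    exact ⟨z, hz⟩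

end Uniqueness

end QF

end

theorem mainTheorem5 {F : Type*} [TopologicalSpace F] [T2Space F] [CompactSpace F]
    [ConnectedSpace F] [ChartedSpace (EuclideanSpace ℝ (Fin 2)) F]
    (Γ : Subgroup QF.PSL2C) (hΓ : QF.IsQuasiFuchsian Γ) (Φ : F × ℝ ≃ₜ QF.Quot3 Γ)
    (Ωp Ωm : Set QF.Bdry) (hΩ : QF.AreDomains Γ Ωp Ωm)
    (H : ℝ) (hH : H ∈ Set.Ioo (-1 : ℝ) 1) (S S' : Set (QF.Quot3 Γ))
    (hS : QF.IsFiberSurface Γ Φ S) (hS' : QF.IsFiberSurface Γ Φ S')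
    (hSH : QF.HasMeanCurvature (QF.proj Γ ⁻¹' S) Ωp Ωm H)
    (hSH' : QF.HasMeanCurvature (QF.proj Γ ⁻¹' S') Ωp Ωm H)
    (hsmall : QF.HasSmallCurvatures (QF.proj Γ ⁻¹' S)) :
    S = S' :=
  (QF.surjective_proj Γ).preimage_injective <|
    QF.eq_of_hasMeanCurvature hΩ hS.isCocompactSet hS.nonempty hS.isSurface
      hS'.isCocompactSet hS'.nonempty hS'.isSurface hSH hSH' hsmall
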